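/- Let $a<0$, let $T>\frac{2\pi}{\sqrt{-2a}}$, and let $\omega\neq 0$ be real with $\frac{\omega T}{2\pi}\in\mathbb Z$. For $0<k<1$ let $K(k)=\int_0^{\pi/2}\frac{d\theta}{\sqrt{1-k^2\sin^2\theta}}$, and let $\mathrm{dn}(y;k)=\sqrt{1-k^2\sin^2\theta}$, where $\theta$ is determined by $y=\int_0^{\theta}\frac{ds}{\sqrt{1-k^2\sin^2 s}}$, be the Jacobi elliptic function. Then there are $r_0>0$ and $k\in(0,1)$ with $$a=(k^2-2)r_0^2,\qquad T=\frac{2K(k)}{r_0}.$$ For any such $r_0,k$, either choice of sign and any $y_0\in\mathbb R$, put $r(y)=\mp r_0\,\mathrm{dn}(r_0(y-y_0);k)$ and $$\varphi(x,t)=e^{i\omega(x+(3a+\omega^2)t)}\,r\bigl(x+(a+3\omega^2)t\bigr).$$ Then $\varphi$ is orbitally stable in $H^1$ for the complex modified Korteweg–de Vries equation $$u_t+6|u|^2u_x+u_{xxx}=0,\qquad(1)$$ in the following sense. For functions $f,g$ of period $T$ let $$d(f,g)=\inf_{(\eta,\xi)\in\mathbb R^2}\bigl\|f-e^{i\omega\eta}g(\cdot-\xi)\bigr\|_1,\qquad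 \|h\|_1^2=\int_0^T\bigl(|h|^2+|h_x|^2\bigr)\,dx .$$ For every $\varepsilon>0$ there is $\delta>0$ such that, if $s>\frac32$, $0<\tau\le\infty$, and $u\in C([0,\tau);H^s)\cap C^1([0,\tau);H^{s-3})$ is a solution of (1) on $[0,\tau)$ of period $T$ in $x$ (where $H^s=H^s[0,T]$ are the $T$-periodic Sobolev spaces and (1) holds in $H^{s-3}$) with $d(u(\cdot,0),\varphi(\cdot,0))<\delta$, then $d(u(\cdot,t),\varphi(\cdot,t))<\varepsilon$ for all $t\in[0,\tau)$; in particular for all $t\in[0,\infty)$ if $u$ is global. Here $\delta$ does not depend on $u$, $s$ or $\tau$. -/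

import Mathlib

namespace CmKdV

/-! Periodic Sobolev spaces, by Fourier coefficients. -/

/-- The `n`-th Fourier coefficient of a `T`-periodic function,
`(1/T) ∫_0^T e^{-2πinx/T} f(x) dx`. -/
noncomputable def fourierCoef (T : ℝ) (f : ℝ → ℂ) (n : ℤ) : ℂ :=
  (1 / (T : ℂ)) * ∫ x in (0 : ℝ)..T,
    Complex.exp (-(2 * (Real.pi : ℂ) * Complex.I * (n : ℂ) * (x : ℂ) / (T : ℂ))) * f x

/-- The Hilbert space of square summable sequences `ℤ → ℂ`. -/
abbrev EllTwo : Type := lp (fun _ : ℤ => ℂ) 2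

/-- The sequence of Fourier coefficients `c` defines an element of the periodic Sobolev space
of (real) order `s`, and `U` is its image under the isometry `c ↦ ((1 + n²)^{s/2} c_n)_n` of that
space, normed by `(∑ (1 + n²)^s |c_n|²)^{1/2}`, onto `ℓ²(ℤ)`. Hence continuity and differentiability
of a curve in the Sobolev space are those of the corresponding curve `U` in `ℓ²(ℤ)`. -/
def IsSobolev (s : ℝ) (c : ℤ → ℂ) (U : EllTwo) : Prop :=
  ∀ n : ℤ, U n = (((1 + (n : ℝ) ^ 2) ^ (s / 2) : ℝ) : ℂ) * c n

/-- The time interval `[0, τ)`, where `τ = ⊤` is allowed. -/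
def timeInterval (τ : EReal) : Set ℝ := {t : ℝ | 0 ≤ t ∧ (t : EReal) < τ}

/-- The Fourier coefficients of the distribution `-(f_xxx + 6 |f|² f_x)`, for a `C¹` function `f`
of period `T`. -/
noncomputable def rhsCoef (T : ℝ) (f : ℝ → ℂ) (n : ℤ) : ℂ :=
  -((2 * (Real.pi : ℂ) * Complex.I * (n : ℂ) / (T : ℂ)) ^ 3 * fourierCoef T f n
    + fourierCoef T (fun x => 6 * ((‖f x‖ ^ 2 : ℝ) : ℂ) * deriv f x) n)

/-- `u` (with `u t x` the value at time `t` and position `x`) is a solution of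
`u_t + 6 |u|² u_x + u_xxx = 0` on `[0, τ)`, of period `T` in `x`, in the class
`C([0, τ); H^s) ∩ C¹([0, τ); H^{s-3})`, the equation being an equality in `H^{s-3}`.
It is used for `s > 3/2`, where the elements of `H^s` are `C¹` functions. -/
structure IsSolution (T s : ℝ) (τ : EReal) (u : ℝ → ℝ → ℂ) : Prop where
  contDiff : ∀ t ∈ timeInterval τ, ContDiff ℝ 1 (u t)
  periodic : ∀ t ∈ timeInterval τ, Function.Periodic (u t) T
  continuous_curve : ∃ U : ℝ → EllTwo, ContinuousOn U (timeInterval τ) ∧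
    ∀ t ∈ timeInterval τ, IsSobolev s (fourierCoef T (u t)) (U t)
  equation : ∃ V V' : ℝ → EllTwo, ContinuousOn V' (timeInterval τ) ∧
    ∀ t ∈ timeInterval τ, HasDerivWithinAt V (V' t) (timeInterval τ) t ∧
      IsSobolev (s - 3) (fourierCoef T (u t)) (V t) ∧
      IsSobolev (s - 3) (rhsCoef T (u t)) (V' t)

/-- The `H¹[0,T]` norm of a `C¹` function of period `T`. -/
noncomputable def normH1 (T : ℝ) (f : ℝ → ℂ) : ℝ :=
  Real.sqrt (∫ x in (0 : ℝ)..T, (‖f x‖ ^ 2 + ‖deriv f x‖ ^ 2))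

/-- The pseudometric `inf_{η, ξ} ‖f - e^{iωη} g(· - ξ)‖_{H¹}`. -/
noncomputable def orbitDist (T ω : ℝ) (f g : ℝ → ℂ) : ℝ :=
  ⨅ p : ℝ × ℝ, normH1 T (fun x =>
    f x - Complex.exp (Complex.I * (ω : ℂ) * (p.1 : ℂ)) * g (x - p.2))

/-! Jacobi elliptic functions, for a modulus `0 < k < 1`. -/

/-- The incomplete elliptic integral of the first kind. -/
noncomputable def ellipticF (k θ : ℝ) : ℝ :=
  ∫ s in (0 : ℝ)..θ, 1 / Real.sqrt (1 - k ^ 2 * Real.sin s ^ 2)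

/-- The complete elliptic integral of the first kind. -/
noncomputable def ellipticK (k : ℝ) : ℝ := ellipticF k (Real.pi / 2)

/-- The Jacobi amplitude, the inverse function of `ellipticF k`, which for `0 < k < 1` is a
bijection of the real line (its derivative is at least 1). -/
noncomputable def jacobiAm (k : ℝ) : ℝ → ℝ := Function.invFun (ellipticF k)

/-- The Jacobi elliptic function `dn(y; k)`. -/
noncomputable def jacobiDn (k y : ℝ) : ℝ :=
  Real.sqrt (1 - k ^ 2 * Real.sin (jacobiAm k y) ^ 2)

/-- `r₀` and `k` are the amplitude and the modulus of the dnoidal profiles with parameter `a`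
and minimal period `T`. -/
structure IsDnoidalParam (a T r₀ k : ℝ) : Prop where
  amplitude_pos : 0 < r₀
  modulus_pos : 0 < k
  modulus_lt_one : k < 1
  parameter : a = (k ^ 2 - 2) * r₀ ^ 2
  period : T = 2 * ellipticK k / r₀

/-- The travelling wave `e^{iω(x + (3a + ω²)t)} r(x + (a + 3ω²)t)`. -/
noncomputable def travellingWave (a ω : ℝ) (r : ℝ → ℝ) (t x : ℝ) : ℂ :=
  Complex.exp (Complex.I * ((ω * (x + (3 * a + ω ^ 2) * t) : ℝ) : ℂ)) *
    ((r (x + (a + 3 * ω ^ 2) * t) : ℝ) : ℂ)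

end CmKdV

/-!
If `u` solves the equation, `∫ |u|²` and the twisted energies `∫ |u_x - iνu|² - |u|⁴` for all real
`ν` are conserved; the twisted energies are combinations of mass, momentum and energy. The gauge
transformation `v = e^{-iωx} u` keeps the period, because `ωT ∈ 2πℤ`, and turns the twisted energy
with `ν = ω` into `∫ |v'|² - |v|⁴`. At each time it turns the travelling wave into a constant phase
times a translate of the dnoidal profile `r₀ dn(r₀ x; k)`. Since `ω ≠ 0`, the orbit in the distance
of the theorem contains all phases and all translates. So it suffices that these profiles are
exactly the minimisers of `∫ |v'|² - |v|⁴` among the `T`-periodic functions with their mass, and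
that minimising sequences are precompact in `H¹`: a sequence of solutions that starts ever closer
to the orbit without staying close is a minimising sequence, and a subsequence of it converges to
the orbit (`exists_phaseProfile_near`, `exists_orbitDist_lt`).

*Compactness* (`IsEnergyLowerBound.exists_subseq_tendsto`). A minimising sequence is bounded in
`H¹`, so it has a uniformly convergent subsequence. By the parallelogram identity and the lower
bound for the energy of midpoints, the derivatives are then a Cauchy sequence in `L²`.

*Minimisers* (`IsMinimizer.eq_dnProfile`). The modulus of a minimiser is a minimiser, whence a
minimiser is a constant phase times a positive solution of `-w'' = lam w + 2w³`
(`IsMinimizer.exists_pos`). If `w` is not constant, it is a translate of a dnoidal profile of some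
modulus `l`. Reflecting a part of the graph of `w` between two points of equal height yields
another minimiser, which has no kink, so `w` has opposite slopes at the two points
(`IsMinimizer.slope_eq_neg`); hence `T` is the minimal period of `w`, and its mass is
`4 E(l) K(l) / T`. Since `E K` is strictly increasing, this determines `l = k`. If `w` is constant,
the second variation in the direction of `cos (2πx/T)` bounds the mass by `π²/T`, which contradicts
`E(k) K(k) > π²/4`.

*Conservation* (`IsSolution.twistedEnergy_eq`, `two_mul_sqNorm_eq`). For `s > 3/2` the formal
computation is not justified, so the energy of the Fourier truncation of order `N` of the solution
is differentiated instead. Its derivative is small (`abs_energy_rate_le`): it would vanish if the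
nonlinearity were evaluated at the truncation, and the error is of the order
`N^{3-2σ} + N^{1-σ} + N^{-1}` with `σ = min s 2`. The mass is recovered from the twisted energies
with `ν = 0, 1, -1`.

The parameters `r₀` and `k` exist by the intermediate value theorem (`exists_isDnoidalParam`).
-/

namespace CmKdV

open Set MeasureTheory Filter Topology intervalIntegral

/-! ### Jacobi elliptic functions -/

theorem one_sub_sq_mul_sin_sq_pos {k : ℝ} (hk : k ∈ Ioo (0 : ℝ) 1) (θ : ℝ) :
    0 < 1 - k ^ 2 * Real.sin θ ^ 2 := by
  have h1 : k ^ 2 < 1 := by nlinarith [hk.1, hk.2]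
  nlinarith [Real.sin_sq_le_one θ, sq_nonneg (Real.sin θ), sq_nonneg k]

theorem sqrt_one_sub_sq_mul_sin_sq_pos {k : ℝ} (hk : k ∈ Ioo (0 : ℝ) 1) (θ : ℝ) :
    0 < Real.sqrt (1 - k ^ 2 * Real.sin θ ^ 2) :=
  Real.sqrt_pos.2 (one_sub_sq_mul_sin_sq_pos hk θ)

theorem continuous_ellipticF_integrand {k : ℝ} (hk : k ∈ Ioo (0 : ℝ) 1) :
    Continuous fun s => 1 / Real.sqrt (1 - k ^ 2 * Real.sin s ^ 2) :=
  continuous_const.div (by fun_prop) fun s => (sqrt_one_sub_sq_mul_sin_sq_pos hk s).ne'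

theorem hasDerivAt_ellipticF {k : ℝ} (hk : k ∈ Ioo (0 : ℝ) 1) (θ : ℝ) :
    HasDerivAt (ellipticF k) (1 / Real.sqrt (1 - k ^ 2 * Real.sin θ ^ 2)) θ :=
  (continuous_ellipticF_integrand hk).integral_hasStrictDerivAt 0 θ |>.hasDerivAt

theorem one_le_ellipticF_integrand {k : ℝ} (hk : k ∈ Ioo (0 : ℝ) 1) (θ : ℝ) :
    1 ≤ 1 / Real.sqrt (1 - k ^ 2 * Real.sin θ ^ 2) := by
  rw [le_div_iff₀ (sqrt_one_sub_sq_mul_sin_sq_pos hk θ), one_mul]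
  exact Real.sqrt_le_one.2 (by nlinarith [sq_nonneg (k * Real.sin θ)])

theorem ellipticF_strictMono {k : ℝ} (hk : k ∈ Ioo (0 : ℝ) 1) : StrictMono (ellipticF k) :=
  strictMono_of_hasDerivAt_pos (hasDerivAt_ellipticF hk)
    fun θ => one_pos.trans_le (one_le_ellipticF_integrand hk θ)

theorem ellipticF_zero (k : ℝ) : ellipticF k 0 = 0 := by simp [ellipticF]

theorem ellipticF_continuous {k : ℝ} (hk : k ∈ Ioo (0 : ℝ) 1) : Continuous (ellipticF k) :=
  continuous_iff_continuousAt.2 fun θ => (hasDerivAt_ellipticF hk θ).continuousAt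

theorem ellipticF_add_pi {k : ℝ} (hk : k ∈ Ioo (0 : ℝ) 1) (θ : ℝ) :
    ellipticF k (θ + Real.pi) = ellipticF k θ + ellipticF k Real.pi := by
  have hc := continuous_ellipticF_integrand hk
  unfold ellipticF
  rw [← integral_add_adjacent_intervals (hc.intervalIntegrable 0 Real.pi)
    (hc.intervalIntegrable Real.pi (θ + Real.pi)), add_comm]
  congr 1
  have := integral_comp_add_right (a := 0) (b := θ)
    (fun s => 1 / Real.sqrt (1 - k ^ 2 * Real.sin s ^ 2)) Real.pi
  rw [zero_add] at this
  rw [← this]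
  simp [Real.sin_add_pi]

theorem integral_zero_pi_sin_sq (g : ℝ → ℝ) (hg : Continuous fun s => g (Real.sin s ^ 2)) :
    ∫ s in (0 : ℝ)..Real.pi, g (Real.sin s ^ 2) =
      2 * ∫ s in (0 : ℝ)..(Real.pi / 2), g (Real.sin s ^ 2) := by
  rw [← integral_add_adjacent_intervals (hg.intervalIntegrable 0 (Real.pi / 2))
    (hg.intervalIntegrable (Real.pi / 2) Real.pi), two_mul]
  congr 1
  have := integral_comp_sub_left (a := 0) (b := Real.pi / 2)
    (fun s => g (Real.sin s ^ 2)) Real.pi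
  rw [show Real.pi - Real.pi / 2 = Real.pi / 2 by ring, sub_zero] at this
  rw [← this]
  simp [Real.sin_pi_sub]

theorem ellipticF_pi {k : ℝ} (hk : k ∈ Ioo (0 : ℝ) 1) :
    ellipticF k Real.pi = 2 * ellipticK k :=
  integral_zero_pi_sin_sq (fun y => 1 / Real.sqrt (1 - k ^ 2 * y))
    (continuous_ellipticF_integrand hk)

theorem ellipticK_pos {k : ℝ} (hk : k ∈ Ioo (0 : ℝ) 1) : 0 < ellipticK k := by
  have := ellipticF_strictMono hk (a := 0) (b := Real.pi / 2) (by positivity)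
  rwa [ellipticF_zero] at this

theorem ellipticF_add_int_mul_pi {k : ℝ} (hk : k ∈ Ioo (0 : ℝ) 1) (θ : ℝ) (n : ℤ) :
    ellipticF k (θ + n * Real.pi) = ellipticF k θ + n * (2 * ellipticK k) := by
  induction n with
  | zero => simp
  | succ i ih =>
    push_cast at ih ⊢
    rw [add_mul, one_mul, ← add_assoc, ellipticF_add_pi hk, ih, ellipticF_pi hk]; ring
  | pred i ih =>
    have := ellipticF_add_pi hk (θ + ((-(i : ℤ) - 1 : ℤ) : ℝ) * Real.pi)
    push_cast at ih this ⊢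
    rw [show θ + (-(i : ℝ) - 1) * Real.pi + Real.pi = θ + -(i : ℝ) * Real.pi by ring, ih,
      ellipticF_pi hk] at this
    linarith

/-- The integrand of `ellipticF` is at least `1`, so that `ellipticF k θ - θ` is monotone and
`ellipticF k` is unbounded in both directions. -/
theorem ellipticF_surjective {k : ℝ} (hk : k ∈ Ioo (0 : ℝ) 1) :
    Function.Surjective (ellipticF k) := by
  have hmono : Monotone fun θ => ellipticF k θ - θ := by
    apply monotone_of_deriv_nonneg
    · exact fun θ => ((hasDerivAt_ellipticF hk θ).fun_sub (hasDerivAt_id' θ)).differentiableAt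
    · intro θ
      rw [((hasDerivAt_ellipticF hk θ).fun_sub (hasDerivAt_id' θ)).deriv]
      linarith [one_le_ellipticF_integrand hk θ]
  refine (ellipticF_continuous hk).surjective ?_ ?_
  · refine tendsto_atTop_mono' _ ?_ tendsto_id
    filter_upwards [eventually_ge_atTop 0] with θ hθ
    have := hmono hθ
    simp only [ellipticF_zero, sub_zero, id] at this ⊢
    linarith
  · refine tendsto_atBot_mono' _ ?_ tendsto_id
    filter_upwards [eventually_le_atBot 0] with θ hθ
    have := hmono hθ
    simp only [ellipticF_zero, sub_zero, id] at this ⊢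
    linarith

theorem ellipticF_jacobiAm {k : ℝ} (hk : k ∈ Ioo (0 : ℝ) 1) (y : ℝ) :
    ellipticF k (jacobiAm k y) = y :=
  Function.rightInverse_invFun (ellipticF_surjective hk) y

theorem jacobiAm_ellipticF {k : ℝ} (hk : k ∈ Ioo (0 : ℝ) 1) (θ : ℝ) :
    jacobiAm k (ellipticF k θ) = θ :=
  Function.leftInverse_invFun (ellipticF_strictMono hk).injective θ

theorem jacobiAm_zero {k : ℝ} (hk : k ∈ Ioo (0 : ℝ) 1) : jacobiAm k 0 = 0 := by
  simpa [ellipticF_zero] using jacobiAm_ellipticF hk 0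

theorem jacobiAm_continuous {k : ℝ} (hk : k ∈ Ioo (0 : ℝ) 1) : Continuous (jacobiAm k) := by
  have h : jacobiAm k = ((ellipticF_strictMono hk).orderIsoOfSurjective _
      (ellipticF_surjective hk)).symm := by
    funext y
    apply (ellipticF_strictMono hk).injective
    rw [ellipticF_jacobiAm hk]
    exact ((StrictMono.orderIsoOfSurjective (ellipticF k) (ellipticF_strictMono hk)
      (ellipticF_surjective hk)).apply_symm_apply y).symm
  rw [h]
  exact OrderIso.continuous _

theorem jacobiDn_pos {k : ℝ} (hk : k ∈ Ioo (0 : ℝ) 1) (y : ℝ) : 0 < jacobiDn k y :=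
  sqrt_one_sub_sq_mul_sin_sq_pos hk _

theorem jacobiDn_sq {k : ℝ} (hk : k ∈ Ioo (0 : ℝ) 1) (y : ℝ) :
    jacobiDn k y ^ 2 = 1 - k ^ 2 * Real.sin (jacobiAm k y) ^ 2 :=
  Real.sq_sqrt (one_sub_sq_mul_sin_sq_pos hk _).le

theorem hasDerivAt_jacobiAm {k : ℝ} (hk : k ∈ Ioo (0 : ℝ) 1) (y : ℝ) :
    HasDerivAt (jacobiAm k) (jacobiDn k y) y := by
  have h := HasDerivAt.of_local_left_inverse (jacobiAm_continuous hk).continuousAt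
    (hasDerivAt_ellipticF hk (jacobiAm k y))
    (one_pos.trans_le (one_le_ellipticF_integrand hk _)).ne'
    (Eventually.of_forall (ellipticF_jacobiAm hk))
  simpa [jacobiDn] using h

/-- The derivative of `dn`, that is `-k² sn cn`. -/
noncomputable def jacobiDnDeriv (k y : ℝ) : ℝ :=
  -(k ^ 2 * Real.sin (jacobiAm k y) * Real.cos (jacobiAm k y))

theorem hasDerivAt_jacobiDn {k : ℝ} (hk : k ∈ Ioo (0 : ℝ) 1) (y : ℝ) :
    HasDerivAt (jacobiDn k) (jacobiDnDeriv k y) y := by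
  have hs := (hasDerivAt_jacobiAm hk y).sin
  have h := (((hs.pow 2).const_mul (k ^ 2)).const_sub 1).sqrt
    (one_sub_sq_mul_sin_sq_pos hk (jacobiAm k y)).ne'
  have hne := (jacobiDn_pos hk y).ne'
  refine h.congr_deriv ?_
  change _ / (2 * jacobiDn k y) = _
  rw [jacobiDnDeriv]
  field_simp
  push_cast
  ring

theorem hasDerivAt_jacobiDnDeriv {k : ℝ} (hk : k ∈ Ioo (0 : ℝ) 1) (y : ℝ) :
    HasDerivAt (jacobiDnDeriv k) ((2 - k ^ 2) * jacobiDn k y - 2 * jacobiDn k y ^ 3) y := by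
  have ha := hasDerivAt_jacobiAm hk y
  have h := ((ha.sin.const_mul (k ^ 2)).mul ha.cos).neg
  refine h.congr_deriv ?_
  have h2 := jacobiDn_sq hk y
  have h3 := Real.sin_sq_add_cos_sq (jacobiAm k y)
  linear_combination (2 * jacobiDn k y) * h2 + (-k ^ 2 * jacobiDn k y) * h3

theorem jacobiDn_zero {k : ℝ} (hk : k ∈ Ioo (0 : ℝ) 1) : jacobiDn k 0 = 1 := by
  simp [jacobiDn, jacobiAm_zero hk]

theorem jacobiDnDeriv_zero {k : ℝ} (hk : k ∈ Ioo (0 : ℝ) 1) : jacobiDnDeriv k 0 = 0 := by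
  simp [jacobiDnDeriv, jacobiAm_zero hk]

theorem jacobiAm_add_int_mul {k : ℝ} (hk : k ∈ Ioo (0 : ℝ) 1) (y : ℝ) (n : ℤ) :
    jacobiAm k (y + n * (2 * ellipticK k)) = jacobiAm k y + n * Real.pi := by
  apply (ellipticF_strictMono hk).injective
  rw [ellipticF_jacobiAm hk, ellipticF_add_int_mul_pi hk, ellipticF_jacobiAm hk]

theorem jacobiDn_periodic {k : ℝ} (hk : k ∈ Ioo (0 : ℝ) 1) :
    Function.Periodic (jacobiDn k) (2 * ellipticK k) := by
  intro y
  have := jacobiAm_add_int_mul hk y 1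
  simp only [Int.cast_one, one_mul] at this
  simp [jacobiDn, this, Real.sin_add_pi]

theorem jacobiDn_eq_one_iff {k : ℝ} (hk : k ∈ Ioo (0 : ℝ) 1) (y : ℝ) :
    jacobiDn k y = 1 ↔ ∃ n : ℤ, y = n * (2 * ellipticK k) := by
  constructor
  · intro h
    have h2 := jacobiDn_sq hk y
    rw [h] at h2
    have h3 : Real.sin (jacobiAm k y) = 0 := by
      have : k ^ 2 * Real.sin (jacobiAm k y) ^ 2 = 0 := by linarith
      have hk2 : k ^ 2 ≠ 0 := pow_ne_zero 2 hk.1.ne'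
      exact pow_eq_zero_iff (two_ne_zero) |>.1 ((mul_eq_zero.1 this).resolve_left hk2)
    obtain ⟨n, hn⟩ := Real.sin_eq_zero_iff.1 h3
    refine ⟨n, ?_⟩
    rw [← ellipticF_jacobiAm hk y, ← hn]
    simpa [ellipticF_zero] using ellipticF_add_int_mul_pi hk 0 n
  · rintro ⟨n, rfl⟩
    have := jacobiAm_add_int_mul hk 0 n
    rw [zero_add, jacobiAm_zero hk, zero_add] at this
    simp [jacobiDn, this, Real.sin_int_mul_pi]

theorem continuous_jacobiDn {k : ℝ} (hk : k ∈ Ioo (0 : ℝ) 1) : Continuous (jacobiDn k) :=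
  continuous_iff_continuousAt.2 fun y => (hasDerivAt_jacobiDn hk y).continuousAt

/-- The complete elliptic integral of the second kind. -/
noncomputable def ellipticE (k : ℝ) : ℝ :=
  ∫ s in (0 : ℝ)..(Real.pi / 2), Real.sqrt (1 - k ^ 2 * Real.sin s ^ 2)

theorem integral_jacobiDn_sq {k : ℝ} (hk : k ∈ Ioo (0 : ℝ) 1) :
    ∫ y in (0 : ℝ)..(2 * ellipticK k), jacobiDn k y ^ 2 = 2 * ellipticE k := by
  have hc : Continuous fun s => Real.sqrt (1 - k ^ 2 * Real.sin s ^ 2) := by fun_prop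
  have hd : ∀ y, HasDerivAt
      (fun y => ∫ s in (0 : ℝ)..(jacobiAm k y), Real.sqrt (1 - k ^ 2 * Real.sin s ^ 2))
      (jacobiDn k y ^ 2) y := by
    intro y
    have h1 := (hc.integral_hasStrictDerivAt 0 (jacobiAm k y)).hasDerivAt
    have := h1.comp y (hasDerivAt_jacobiAm hk y)
    rwa [show Real.sqrt (1 - k ^ 2 * Real.sin (jacobiAm k y) ^ 2) * jacobiDn k y
      = jacobiDn k y ^ 2 from (sq (jacobiDn k y)).symm] at this
  rw [integral_eq_sub_of_hasDerivAt (fun y _ => hd y)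
    (((continuous_jacobiDn hk).pow 2).intervalIntegrable _ _)]
  have := jacobiAm_add_int_mul hk 0 1
  simp only [Int.cast_one, one_mul, zero_add, jacobiAm_zero hk] at this
  rw [this, jacobiAm_zero hk, integral_same, sub_zero]
  exact integral_zero_pi_sin_sq (fun y => Real.sqrt (1 - k ^ 2 * y)) hc

/-- The symmetrised integrand `p(θ)/p(φ) + p(φ)/p(θ)`, `p(θ) = √(1 - k² sin² θ)`, of the double
integral `2 E(k) K(k)`. -/
noncomputable def ellipticKernel (k θ φ : ℝ) : ℝ :=
  Real.sqrt (1 - k ^ 2 * Real.sin θ ^ 2) * (1 / Real.sqrt (1 - k ^ 2 * Real.sin φ ^ 2)) +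
    1 / Real.sqrt (1 - k ^ 2 * Real.sin θ ^ 2) * Real.sqrt (1 - k ^ 2 * Real.sin φ ^ 2)

theorem one_sub_sq_mul_sin_sq_pos' {k : ℝ} (h0 : 0 ≤ k) (h1 : k < 1) (θ : ℝ) :
    0 < 1 - k ^ 2 * Real.sin θ ^ 2 := by
  have h1 : k ^ 2 < 1 := by nlinarith
  nlinarith [Real.sin_sq_le_one θ, sq_nonneg (Real.sin θ), sq_nonneg k]

theorem ellipticKernel_sq {k : ℝ} (h0 : 0 ≤ k) (h1 : k < 1) (θ φ : ℝ) :
    ellipticKernel k θ φ ^ 2 = 4 + (k ^ 2) ^ 2 * (Real.sin θ ^ 2 - Real.sin φ ^ 2) ^ 2 /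
      ((1 - k ^ 2 * Real.sin θ ^ 2) * (1 - k ^ 2 * Real.sin φ ^ 2)) := by
  have hx := one_sub_sq_mul_sin_sq_pos' h0 h1 θ
  have hy := one_sub_sq_mul_sin_sq_pos' h0 h1 φ
  have hx' := Real.sqrt_pos.2 hx
  have hy' := Real.sqrt_pos.2 hy
  have ex := Real.sq_sqrt hx.le
  have ey := Real.sq_sqrt hy.le
  have key : ellipticKernel k θ φ ^ 2 = ((1 - k ^ 2 * Real.sin θ ^ 2) +
      (1 - k ^ 2 * Real.sin φ ^ 2)) ^ 2 /
      ((1 - k ^ 2 * Real.sin θ ^ 2) * (1 - k ^ 2 * Real.sin φ ^ 2)) := by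
    rw [ellipticKernel]
    generalize Real.sqrt (1 - k ^ 2 * Real.sin θ ^ 2) = p at *
    generalize Real.sqrt (1 - k ^ 2 * Real.sin φ ^ 2) = q at *
    rw [← ex, ← ey]
    field_simp
  rw [key]
  field_simp
  ring

theorem ellipticKernel_nonneg (k θ φ : ℝ) : 0 ≤ ellipticKernel k θ φ := by
  unfold ellipticKernel; positivity

theorem ellipticKernel_le {k l : ℝ} (h0 : 0 ≤ k) (hkl : k < l) (h1 : l < 1) (θ φ : ℝ) :
    ellipticKernel k θ φ ≤ ellipticKernel l θ φ := by
  refine le_of_sq_le_sq ?_ (ellipticKernel_nonneg _ _ _)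
  rw [ellipticKernel_sq h0 (hkl.trans h1), ellipticKernel_sq (h0.trans hkl.le) h1]
  have hx := one_sub_sq_mul_sin_sq_pos' (h0.trans hkl.le) h1 θ
  have hy := one_sub_sq_mul_sin_sq_pos' (h0.trans hkl.le) h1 φ
  have hx' := one_sub_sq_mul_sin_sq_pos' h0 (hkl.trans h1) θ
  have h3 : (1 - l ^ 2 * Real.sin θ ^ 2) * (1 - l ^ 2 * Real.sin φ ^ 2) ≤
      (1 - k ^ 2 * Real.sin θ ^ 2) * (1 - k ^ 2 * Real.sin φ ^ 2) :=
    mul_le_mul (by gcongr) (by gcongr) hy.le hx'.le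
  gcongr

theorem ellipticKernel_lt {k l : ℝ} (h0 : 0 ≤ k) (hkl : k < l) (h1 : l < 1) {θ φ : ℝ}
    (h : Real.sin θ ^ 2 ≠ Real.sin φ ^ 2) :
    ellipticKernel k θ φ < ellipticKernel l θ φ := by
  refine lt_of_pow_lt_pow_left₀ 2 (ellipticKernel_nonneg _ _ _) ?_
  rw [ellipticKernel_sq h0 (hkl.trans h1), ellipticKernel_sq (h0.trans hkl.le) h1]
  have hx := one_sub_sq_mul_sin_sq_pos' (h0.trans hkl.le) h1 θ
  have hy := one_sub_sq_mul_sin_sq_pos' (h0.trans hkl.le) h1 φ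
  have hd : 0 < (Real.sin θ ^ 2 - Real.sin φ ^ 2) ^ 2 := by
    have := sub_ne_zero.2 h
    positivity
  have hk2 : k ^ 2 < l ^ 2 := by gcongr
  have hk4 : (k ^ 2) ^ 2 < (l ^ 2) ^ 2 := by gcongr
  have h3 : (1 - l ^ 2 * Real.sin θ ^ 2) * (1 - l ^ 2 * Real.sin φ ^ 2) ≤
      (1 - k ^ 2 * Real.sin θ ^ 2) * (1 - k ^ 2 * Real.sin φ ^ 2) := by
    have := one_sub_sq_mul_sin_sq_pos' h0 (hkl.trans h1) θ
    exact mul_le_mul (by gcongr) (by gcongr) hy.le this.le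
  have h4 : (k ^ 2) ^ 2 * (Real.sin θ ^ 2 - Real.sin φ ^ 2) ^ 2 <
      (l ^ 2) ^ 2 * (Real.sin θ ^ 2 - Real.sin φ ^ 2) ^ 2 := by gcongr
  have h5 := div_lt_div₀ h4 h3 (by positivity) (by positivity)
  linarith

theorem continuous_ellipticKernel {k : ℝ} (h0 : 0 ≤ k) (h1 : k < 1) (θ : ℝ) :
    Continuous (ellipticKernel k θ) := by
  unfold ellipticKernel
  have : Continuous fun φ => 1 / Real.sqrt (1 - k ^ 2 * Real.sin φ ^ 2) :=
    continuous_const.div (by fun_prop)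
      fun s => (Real.sqrt_pos.2 (one_sub_sq_mul_sin_sq_pos' h0 h1 s)).ne'
  fun_prop

theorem integral_ellipticKernel {k : ℝ} (h0 : 0 ≤ k) (h1 : k < 1) (θ : ℝ) :
    ∫ φ in (0 : ℝ)..(Real.pi / 2), ellipticKernel k θ φ =
      Real.sqrt (1 - k ^ 2 * Real.sin θ ^ 2) * ellipticK k +
        1 / Real.sqrt (1 - k ^ 2 * Real.sin θ ^ 2) * ellipticE k := by
  unfold ellipticKernel
  have : Continuous fun φ => 1 / Real.sqrt (1 - k ^ 2 * Real.sin φ ^ 2) :=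
    continuous_const.div (by fun_prop)
      fun s => (Real.sqrt_pos.2 (one_sub_sq_mul_sin_sq_pos' h0 h1 s)).ne'
  rw [intervalIntegral.integral_add, intervalIntegral.integral_const_mul,
    intervalIntegral.integral_const_mul]
  · rfl
  · exact (this.const_mul _).intervalIntegrable _ _
  · exact Continuous.intervalIntegrable (by fun_prop) _ _

theorem continuous_integral_ellipticKernel {k : ℝ} (h0 : 0 ≤ k) (h1 : k < 1) :
    Continuous fun θ => ∫ φ in (0 : ℝ)..(Real.pi / 2), ellipticKernel k θ φ := by
  simp only [integral_ellipticKernel h0 h1]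
  have : Continuous fun φ => 1 / Real.sqrt (1 - k ^ 2 * Real.sin φ ^ 2) :=
    continuous_const.div (by fun_prop)
      fun s => (Real.sqrt_pos.2 (one_sub_sq_mul_sin_sq_pos' h0 h1 s)).ne'
  fun_prop

theorem integral_integral_ellipticKernel {k : ℝ} (h0 : 0 ≤ k) (h1 : k < 1) :
    ∫ θ in (0 : ℝ)..(Real.pi / 2), ∫ φ in (0 : ℝ)..(Real.pi / 2), ellipticKernel k θ φ =
      2 * (ellipticE k * ellipticK k) := by
  simp only [integral_ellipticKernel h0 h1]
  have : Continuous fun φ => 1 / Real.sqrt (1 - k ^ 2 * Real.sin φ ^ 2) :=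
    continuous_const.div (by fun_prop)
      fun s => (Real.sqrt_pos.2 (one_sub_sq_mul_sin_sq_pos' h0 h1 s)).ne'
  rw [intervalIntegral.integral_add, intervalIntegral.integral_mul_const,
    intervalIntegral.integral_mul_const]
  · change ellipticE k * ellipticK k + ellipticK k * ellipticE k = _
    ring
  · exact Continuous.intervalIntegrable (by fun_prop) _ _
  · exact (this.mul_const _).intervalIntegrable _ _

/-- `E(k) K(k)` is strictly increasing in the modulus: the kernel `x + 1/x`, `x = p(θ)/p(φ)`, of
its symmetrised double integral is. -/
theorem ellipticE_mul_ellipticK_lt {k l : ℝ} (h0 : 0 ≤ k) (hkl : k < l) (h1 : l < 1) :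
    ellipticE k * ellipticK k < ellipticE l * ellipticK l := by
  have hl0 := h0.trans hkl.le
  have hk1 := hkl.trans h1
  suffices 2 * (ellipticE k * ellipticK k) < 2 * (ellipticE l * ellipticK l) by linarith
  rw [← integral_integral_ellipticKernel h0 hk1, ← integral_integral_ellipticKernel hl0 h1]
  have hpi : (0 : ℝ) < Real.pi / 2 := by positivity
  have inner : ∀ θ ∈ Icc (0 : ℝ) (Real.pi / 2),
      ∫ φ in (0 : ℝ)..(Real.pi / 2), ellipticKernel k θ φ <
        ∫ φ in (0 : ℝ)..(Real.pi / 2), ellipticKernel l θ φ := by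
    intro θ hθ
    refine integral_lt_integral_of_continuousOn_of_le_of_exists_lt hpi
      (continuous_ellipticKernel h0 hk1 θ).continuousOn
      (continuous_ellipticKernel hl0 h1 θ).continuousOn
      (fun φ _ => ellipticKernel_le h0 hkl h1 θ φ) ?_
    -- the kernels differ wherever `sin² θ ≠ sin² φ`, and `φ` may be one of the two end points
    by_cases hs : Real.sin θ ^ 2 = 0
    · exact ⟨Real.pi / 2, ⟨hpi.le, le_rfl⟩, ellipticKernel_lt h0 hkl h1 (by simp [hs])⟩
    · exact ⟨0, ⟨le_rfl, hpi.le⟩, ellipticKernel_lt h0 hkl h1 (by simpa using hs)⟩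
  exact integral_lt_integral_of_continuousOn_of_le_of_exists_lt hpi
    (continuous_integral_ellipticKernel h0 hk1).continuousOn
    (continuous_integral_ellipticKernel hl0 h1).continuousOn
    (fun θ hθ => (inner θ (Ioc_subset_Icc_self hθ)).le) ⟨0, ⟨le_rfl, hpi.le⟩, inner 0 ⟨le_rfl, hpi.le⟩⟩

theorem ellipticE_mul_ellipticK_zero : ellipticE 0 * ellipticK 0 = Real.pi ^ 2 / 4 := by
  simp [ellipticE, ellipticK, ellipticF]
  ring

theorem sq_pi_div_four_lt {k : ℝ} (hk : k ∈ Ioo (0 : ℝ) 1) :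
    Real.pi ^ 2 / 4 < ellipticE k * ellipticK k := by
  rw [← ellipticE_mul_ellipticK_zero]
  exact ellipticE_mul_ellipticK_lt le_rfl hk.1 hk.2

theorem eq_of_ellipticE_mul_ellipticK_eq {k l : ℝ} (hk : k ∈ Ioo (0 : ℝ) 1)
    (hl : l ∈ Ioo (0 : ℝ) 1) (h : ellipticE k * ellipticK k = ellipticE l * ellipticK l) :
    k = l := by
  rcases lt_trichotomy k l with hlt | heq | hlt
  · exact absurd h (ellipticE_mul_ellipticK_lt hk.1.le hlt hl.2).ne
  · exact heq
  · exact absurd h (ellipticE_mul_ellipticK_lt hl.1.le hlt hk.2).ne'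

/-- `K(√(1 - e^{-2c})) ≥ c`: substitute `θ = π/2 - x` and bound the radicand
`k'² + k² sin² x` by `(k' + x)²`, where `k' = e^{-c}`. -/
theorem le_ellipticK_sqrt {c : ℝ} (hc : 0 < c) :
    c ≤ ellipticK (Real.sqrt (1 - Real.exp (-c) ^ 2)) := by
  set e := Real.exp (-c) with he
  have he0 : 0 < e := Real.exp_pos _
  have he1 : e < 1 := Real.exp_lt_one_iff.2 (by linarith)
  have he2 : 0 ≤ 1 - e ^ 2 := by nlinarith
  have hk2 : Real.sqrt (1 - e ^ 2) ^ 2 = 1 - e ^ 2 := Real.sq_sqrt he2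
  have hk1 : Real.sqrt (1 - e ^ 2) < 1 := by
    rw [Real.sqrt_lt' one_pos]; nlinarith
  have hpi : (0 : ℝ) ≤ Real.pi / 2 := by positivity
  -- the integral is `log ((e + π/2) / e)`, and `(e + π/2) / e ≥ 1 / e = exp c`
  have hlog : c ≤ ∫ x in (0 : ℝ)..(Real.pi / 2), 1 / (e + x) := by
    have h := integral_comp_add_left (a := 0) (b := Real.pi / 2) (fun x : ℝ => 1 / x) e
    rw [h, integral_one_div_of_pos (by linarith) (by positivity), add_zero,
      Real.le_log_iff_exp_le (by positivity), le_div_iff₀ he0, he, ← Real.exp_add,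
      add_neg_cancel, Real.exp_zero]
    linarith [Real.pi_gt_three, Real.exp_pos (-c)]
  have hsub := integral_comp_sub_left (a := 0) (b := Real.pi / 2)
    (fun s => 1 / Real.sqrt (1 - Real.sqrt (1 - e ^ 2) ^ 2 * Real.sin s ^ 2)) (Real.pi / 2)
  rw [sub_self, sub_zero] at hsub
  rw [ellipticK, ellipticF, ← hsub]
  refine hlog.trans (integral_mono_on hpi ?_ ?_ ?_)
  · apply ContinuousOn.intervalIntegrable
    rw [uIcc_of_le hpi]
    exact continuousOn_const.div (by fun_prop) fun x hx => by linarith [hx.1]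
  · apply Continuous.intervalIntegrable
    exact continuous_const.div (by fun_prop)
      fun s => (Real.sqrt_pos.2 (one_sub_sq_mul_sin_sq_pos' (Real.sqrt_nonneg _) hk1 _)).ne'
  · intro x hx
    have hpos := one_sub_sq_mul_sin_sq_pos' (Real.sqrt_nonneg _) hk1 (Real.pi / 2 - x)
    apply one_div_le_one_div_of_le (Real.sqrt_pos.2 hpos)
    rw [Real.sqrt_le_left (by linarith [hx.1]), hk2, Real.sin_pi_div_two_sub]
    have h1 := Real.sin_le hx.1
    have h2 := Real.sin_nonneg_of_nonneg_of_le_pi hx.1 (by linarith [hx.2])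
    have h3 := Real.sin_sq_add_cos_sq x
    have h4 : Real.sin x ^ 2 ≤ x ^ 2 := by gcongr
    nlinarith [mul_nonneg he0.le hx.1, sq_nonneg (e * Real.sin x)]

/-- Eliminating `r₀` leaves the equation `K(k) √(2 - k²) = T √(-a) / 2` for the modulus. It is
solved by the intermediate value theorem: the left-hand side is `π/√2` at `k = 0`, which the
hypothesis on `T` puts below the right-hand side, and it is unbounded as `k → 1`. -/
theorem exists_isDnoidalParam {a T : ℝ} (ha : a < 0)
    (hT : 2 * Real.pi / Real.sqrt (-2 * a) < T) : ∃ r₀ k : ℝ, IsDnoidalParam a T r₀ k := by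
  have hs : 0 < Real.sqrt (-a) := Real.sqrt_pos.2 (by linarith)
  have h2 : Real.sqrt (-2 * a) = Real.sqrt 2 * Real.sqrt (-a) := by
    rw [← Real.sqrt_mul (by norm_num)]; ring_nf
  have hs2 : 0 < Real.sqrt 2 := by positivity
  have hs22 : Real.sqrt 2 ^ 2 = 2 := Real.sq_sqrt (by norm_num)
  set c := T * Real.sqrt (-a) / 2 with hcdef
  have hc : Real.pi / 2 * Real.sqrt 2 < c := by
    rw [h2, div_lt_iff₀ (by positivity)] at hT
    rw [hcdef]
    have h3 := mul_lt_mul_of_pos_right hT hs2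
    have h4 : T * (Real.sqrt 2 * Real.sqrt (-a)) * Real.sqrt 2 = 2 * (T * Real.sqrt (-a)) := by
      linear_combination (T * Real.sqrt (-a)) * hs22
    linarith
  have hc0 : 0 < c := lt_trans (by positivity) hc
  set l := Real.sqrt (1 - Real.exp (-c) ^ 2) with hl
  have hl0 : 0 ≤ l := Real.sqrt_nonneg _
  have he0 : 0 < Real.exp (-c) := Real.exp_pos _
  have hl1 : l < 1 := by
    rw [hl, Real.sqrt_lt' one_pos]; nlinarith
  -- cutting the radicand off below makes the integrand jointly continuous in `k` and `θ`
  let f : ℝ → ℝ := fun k => (∫ s in (0 : ℝ)..(Real.pi / 2),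
    1 / Real.sqrt (max (1 - k ^ 2 * Real.sin s ^ 2) (1 - l ^ 2))) * Real.sqrt (2 - k ^ 2)
  have hl2 : 0 < 1 - l ^ 2 := by nlinarith
  have hf : Continuous f := by
    refine Continuous.mul ?_ (by fun_prop)
    refine intervalIntegral.continuous_parametric_intervalIntegral_of_continuous'
      (f := fun k s => 1 / Real.sqrt (max (1 - k ^ 2 * Real.sin s ^ 2) (1 - l ^ 2))) ?_ _ _
    refine continuous_const.div (by fun_prop) fun s => ?_
    exact (Real.sqrt_pos.2 (hl2.trans_le (le_max_right _ _))).ne'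
  have hfK : ∀ k ∈ Icc (0 : ℝ) l, f k = ellipticK k * Real.sqrt (2 - k ^ 2) := by
    intro k hk
    simp only [f, ellipticK, ellipticF]
    congr 2
    funext s
    rw [max_eq_left]
    have : k ^ 2 ≤ l ^ 2 := by gcongr; exacts [hk.1, hk.2]
    nlinarith [Real.sin_sq_le_one s, sq_nonneg (Real.sin s), sq_nonneg k]
  have hf0 : f 0 < c := by
    rw [hfK 0 ⟨le_rfl, hl0⟩]
    simpa [ellipticK, ellipticF] using hc
  have hfl : c ≤ f l := by
    rw [hfK l ⟨hl0, le_rfl⟩]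
    have h1 : c ≤ ellipticK l := le_ellipticK_sqrt hc0
    have h2 : 1 ≤ Real.sqrt (2 - l ^ 2) := Real.one_le_sqrt.2 (by linarith)
    nlinarith
  obtain ⟨k, hk, hkc⟩ := intermediate_value_Icc hl0 hf.continuousOn ⟨hf0.le, hfl⟩
  rw [hfK k hk] at hkc
  have hk0 : 0 < k := by
    rcases hk.1.eq_or_lt with h | h
    · subst h
      rw [← hfK 0 hk] at hkc
      exact absurd hkc hf0.ne
    · exact h
  have hk1 : k < 1 := hk.2.trans_lt hl1
  have hk2 : 0 < 2 - k ^ 2 := by nlinarith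
  have hq := Real.sqrt_pos.2 hk2
  refine ⟨Real.sqrt (-a) / Real.sqrt (2 - k ^ 2), k, by positivity, hk0, hk1, ?_, ?_⟩
  · rw [div_pow, Real.sq_sqrt (by linarith), Real.sq_sqrt hk2.le]
    field_simp
    ring
  · rw [hcdef] at hkc
    field_simp
    linarith

end CmKdV

namespace CmKdV

open Set MeasureTheory Filter Topology intervalIntegral

/-! ### Periodic functions of class `H¹` -/

/-- The squared `L²(0,T)` norm. -/
noncomputable def sqNorm (T : ℝ) (f : ℝ → ℂ) : ℝ := ∫ x in (0 : ℝ)..T, ‖f x‖ ^ 2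

/-- The fourth power of the `L⁴(0,T)` norm. -/
noncomputable def quartic (T : ℝ) (f : ℝ → ℂ) : ℝ := ∫ x in (0 : ℝ)..T, ‖f x‖ ^ 4

/-- `f`, restricted to `[0,T]`, is of class `H¹` with `f T = f 0`, and `g ∈ L²(0,T)` is its weak
derivative. No condition is put on `f` and `g` outside `[0,T]`. -/
structure IsH1 (T : ℝ) (f g : ℝ → ℂ) : Prop where
  memLp : MemLp g 2 (volume.restrict (Ioc 0 T))
  eq_integral : ∀ x ∈ Icc 0 T, f x = f 0 + ∫ y in (0 : ℝ)..x, g y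
  periodic : f T = f 0

variable {T : ℝ} {f g h k : ℝ → ℂ}

theorem intervalIntegrable_of_memLp (hT : 0 < T) (hg : MemLp g 2 (volume.restrict (Ioc 0 T)))
    {a b : ℝ} (ha : a ∈ Icc 0 T) (hb : b ∈ Icc 0 T) : IntervalIntegrable g volume a b := by
  have h : IntervalIntegrable g volume 0 T :=
    (intervalIntegrable_iff_integrableOn_Ioc_of_le hT.le).2 (hg.integrable one_le_two)
  apply h.mono_set
  rw [uIcc_of_le hT.le]
  exact uIcc_subset_Icc ha hb

theorem intervalIntegrable_sq_of_memLp (hT : 0 < T) (hg : MemLp g 2 (volume.restrict (Ioc 0 T)))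
    {a b : ℝ} (ha : a ∈ Icc 0 T) (hb : b ∈ Icc 0 T) :
    IntervalIntegrable (fun x => ‖g x‖ ^ 2) volume a b := by
  have h : IntervalIntegrable (fun x => ‖g x‖ ^ 2) volume 0 T :=
    (intervalIntegrable_iff_integrableOn_Ioc_of_le hT.le).2 (hg.integrable_norm_pow two_ne_zero)
  apply h.mono_set
  rw [uIcc_of_le hT.le]
  exact uIcc_subset_Icc ha hb

theorem sqNorm_nonneg (hT : 0 < T) (f : ℝ → ℂ) : 0 ≤ sqNorm T f :=
  integral_nonneg hT.le fun _ _ => by positivity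

theorem quartic_nonneg (hT : 0 < T) (f : ℝ → ℂ) : 0 ≤ quartic T f :=
  integral_nonneg hT.le fun _ _ => by positivity

theorem norm_integral_sq_le {a b : ℝ} (hab : a ≤ b) (hg : IntervalIntegrable g volume a b)
    (hg2 : IntervalIntegrable (fun x => ‖g x‖ ^ 2) volume a b) :
    ‖∫ x in a..b, g x‖ ^ 2 ≤ (b - a) * ∫ x in a..b, ‖g x‖ ^ 2 := by
  rcases hab.eq_or_lt with rfl | hlt
  · simp
  have h1 : ‖∫ x in a..b, g x‖ ≤ ∫ x in a..b, ‖g x‖ := norm_integral_le_integral_norm hab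
  set s := ∫ x in a..b, ‖g x‖ with hs
  have h2 : 0 ≤ ∫ x in a..b, (‖g x‖ ^ 2 - 2 * (s / (b - a)) * ‖g x‖ + (s / (b - a)) ^ 2) :=
    integral_nonneg hab fun x _ => by
      nlinarith [sq_nonneg (‖g x‖ - s / (b - a))]
  rw [intervalIntegral.integral_add (hg2.sub (hg.norm.const_mul _)) (by simp),
    intervalIntegral.integral_sub hg2 (hg.norm.const_mul _), intervalIntegral.integral_const_mul,
    ← hs, intervalIntegral.integral_const, smul_eq_mul] at h2
  have hba : 0 < b - a := by linarith
  have h3 : s ^ 2 ≤ (b - a) * ∫ x in a..b, ‖g x‖ ^ 2 := by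
    have e : (b - a) * ((∫ x in a..b, ‖g x‖ ^ 2) - 2 * (s / (b - a)) * s +
      (b - a) * (s / (b - a)) ^ 2) = (b - a) * (∫ x in a..b, ‖g x‖ ^ 2) - s ^ 2 := by
      field_simp; ring
    have := mul_nonneg hba.le h2
    linarith
  refine le_trans ?_ h3
  gcongr

namespace IsH1

theorem continuousOn (hT : 0 < T) (hf : IsH1 T f g) : ContinuousOn f (Icc 0 T) := by
  have h := continuousOn_primitive_interval
    (((intervalIntegrable_iff_integrableOn_Icc_of_le hT.le).1
      (intervalIntegrable_of_memLp hT hf.memLp ⟨le_rfl, hT.le⟩ ⟨hT.le, le_rfl⟩)).mono_set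
        (uIcc_of_le hT.le).le)
  rw [uIcc_of_le hT.le] at h
  exact (continuousOn_const.add h).congr hf.eq_integral

theorem sub_eq_integral (hT : 0 < T) (hf : IsH1 T f g) {x y : ℝ} (hx : x ∈ Icc 0 T)
    (hy : y ∈ Icc 0 T) : f y - f x = ∫ z in x..y, g z := by
  have h0 : (0 : ℝ) ∈ Icc 0 T := ⟨le_rfl, hT.le⟩
  rw [hf.eq_integral x hx, hf.eq_integral y hy, add_sub_add_left_eq_sub,
    integral_interval_sub_left (intervalIntegrable_of_memLp hT hf.memLp h0 hy)
      (intervalIntegrable_of_memLp hT hf.memLp h0 hx)]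

theorem norm_sub_sq_le (hT : 0 < T) (hf : IsH1 T f g) {x y : ℝ} (hx : x ∈ Icc 0 T)
    (hy : y ∈ Icc 0 T) : ‖f y - f x‖ ^ 2 ≤ |y - x| * sqNorm T g := by
  wlog hxy : x ≤ y generalizing x y
  · rw [norm_sub_rev, abs_sub_comm]
    exact this hy hx (le_of_not_ge hxy)
  rw [hf.sub_eq_integral hT hx hy, abs_of_nonneg (sub_nonneg.2 hxy)]
  refine (norm_integral_sq_le hxy (intervalIntegrable_of_memLp hT hf.memLp hx hy)
    (intervalIntegrable_sq_of_memLp hT hf.memLp hx hy)).trans ?_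
  gcongr
  exact integral_mono_interval hx.1 hxy hy.2 (Eventually.of_forall fun x => by positivity)
    (intervalIntegrable_sq_of_memLp hT hf.memLp ⟨le_rfl, hT.le⟩ ⟨hT.le, le_rfl⟩)

/-- The Gagliardo–Nirenberg inequality in additive form: averaging over an interval of length `ℓ`
costs `ℓ` times the Dirichlet integral, and `ℓ` is at one's disposal. -/
theorem norm_sq_le (hT : 0 < T) (hf : IsH1 T f g) {l : ℝ} (hl : 0 < l) (hlT : l ≤ T) {x : ℝ}
    (hx : x ∈ Icc 0 T) : ‖f x‖ ^ 2 ≤ 2 / l * sqNorm T f + 2 * l * sqNorm T g := by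
  -- an interval of length `l` in `[0,T]` that contains `x`
  obtain ⟨c, hc0, hcT, hcx, hxc⟩ : ∃ c, 0 ≤ c ∧ c + l ≤ T ∧ c ≤ x ∧ x ≤ c + l := by
    by_cases h : x + l ≤ T
    · exact ⟨x, hx.1, h, le_rfl, by linarith⟩
    · exact ⟨T - l, by linarith, by linarith, by linarith, by linarith [hx.2]⟩
  have hsub : Icc c (c + l) ⊆ Icc 0 T := Icc_subset_Icc hc0 hcT
  have hcon := hf.continuousOn hT
  have hcl : c ≤ c + l := by linarith
  have hI : IntervalIntegrable (fun y => ‖f y‖ ^ 2) volume c (c + l) := by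
    apply ContinuousOn.intervalIntegrable
    rw [uIcc_of_le hcl]
    exact ((hcon.mono hsub).norm.pow 2)
  have h1 : ∫ y in c..(c + l), ‖f x‖ ^ 2 ≤
      ∫ y in c..(c + l), (2 * ‖f y‖ ^ 2 + 2 * (l * sqNorm T g)) := by
    refine integral_mono_on hcl (by simp) ((hI.const_mul 2).add (by simp)) fun y hy => ?_
    have h2 := hf.norm_sub_sq_le hT (hsub hy) hx
    have h3 : |x - y| ≤ l := abs_le.2 ⟨by linarith [hy.2], by linarith [hy.1]⟩
    have h4 := mul_le_mul_of_nonneg_right h3 (sqNorm_nonneg hT g)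
    have h5 : ‖f x‖ ≤ ‖f y‖ + ‖f x - f y‖ := by
      simpa using norm_add_le (f y) (f x - f y)
    have h6 : ‖f x‖ ^ 2 ≤ (‖f y‖ + ‖f x - f y‖) ^ 2 := by gcongr
    nlinarith [sq_nonneg (‖f y‖ - ‖f x - f y‖)]
  rw [intervalIntegral.integral_add (hI.const_mul 2) (by simp),
    intervalIntegral.integral_const_mul, intervalIntegral.integral_const,
    intervalIntegral.integral_const] at h1
  have h7 : ∫ y in c..(c + l), ‖f y‖ ^ 2 ≤ sqNorm T f := by
    refine integral_mono_interval hc0 hcl hcT (Eventually.of_forall fun x => by positivity) ?_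
    apply ContinuousOn.intervalIntegrable
    rw [uIcc_of_le hT.le]
    exact hcon.norm.pow 2
  simp only [add_sub_cancel_left, smul_eq_mul] at h1
  have h8 : l * ‖f x‖ ^ 2 ≤ l * (2 / l * sqNorm T f + 2 * l * sqNorm T g) := by
    have : l * (2 / l * sqNorm T f + 2 * l * sqNorm T g) =
      2 * sqNorm T f + l * (2 * (l * sqNorm T g)) := by field_simp
    rw [this]; linarith
  exact le_of_mul_le_mul_left h8 hl

theorem add (hT : 0 < T) (hf : IsH1 T f g) (hh : IsH1 T h k) :
    IsH1 T (fun x => f x + h x) (fun x => g x + k x) where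
  memLp := hf.memLp.add hh.memLp
  eq_integral x hx := by
    rw [intervalIntegral.integral_add
      (intervalIntegrable_of_memLp hT hf.memLp ⟨le_rfl, hT.le⟩ hx)
      (intervalIntegrable_of_memLp hT hh.memLp ⟨le_rfl, hT.le⟩ hx), hf.eq_integral x hx,
      hh.eq_integral x hx]
    ring
  periodic := by rw [hf.periodic, hh.periodic]

theorem const_mul (hf : IsH1 T f g) (c : ℂ) : IsH1 T (fun x => c * f x) (fun x => c * g x) where
  memLp := hf.memLp.const_mul c
  eq_integral x hx := by
    rw [intervalIntegral.integral_const_mul, hf.eq_integral x hx]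
    ring
  periodic := by rw [hf.periodic]

theorem sub (hT : 0 < T) (hf : IsH1 T f g) (hh : IsH1 T h k) :
    IsH1 T (fun x => f x - h x) (fun x => g x - k x) := by
  simpa [sub_eq_add_neg] using hf.add hT (hh.const_mul (-1))

theorem congr (hf : IsH1 T f g) (hfh : EqOn f h (Icc 0 T)) (hT : 0 < T) : IsH1 T h g where
  memLp := hf.memLp
  eq_integral x hx := by
    rw [← hfh hx, ← hfh ⟨le_rfl, hT.le⟩, hf.eq_integral x hx]
  periodic := by rw [← hfh ⟨hT.le, le_rfl⟩, ← hfh ⟨le_rfl, hT.le⟩, hf.periodic]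

end IsH1

theorem memLp_of_continuousOn (hg : ContinuousOn g (Icc 0 T)) :
    MemLp g 2 (volume.restrict (Ioc 0 T)) := by
  obtain ⟨C, hC⟩ := isCompact_Icc.exists_bound_of_continuousOn hg
  refine MemLp.of_bound ((hg.mono Ioc_subset_Icc_self).aestronglyMeasurable measurableSet_Ioc) C ?_
  exact (ae_restrict_iff' measurableSet_Ioc).2
    (Eventually.of_forall fun x hx => hC x (Ioc_subset_Icc_self hx))

theorem isH1_of_hasDerivWithinAt (hg : ContinuousOn g (Icc 0 T))
    (hf : ∀ x ∈ Icc 0 T, HasDerivWithinAt f (g x) (Icc 0 T) x) (hp : f T = f 0) : IsH1 T f g where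
  memLp := memLp_of_continuousOn hg
  eq_integral x hx := by
    have hsub : Icc 0 x ⊆ Icc 0 T := Icc_subset_Icc_right hx.2
    rw [integral_eq_sub_of_hasDeriv_right_of_le hx.1
      (fun y hy => (hf y (hsub hy)).continuousWithinAt.mono hsub)
      (fun y hy => ((hf y (hsub (Ioo_subset_Icc_self hy))).hasDerivAt
        (Icc_mem_nhds hy.1 (hy.2.trans_le hx.2))).hasDerivWithinAt)]
    · ring
    · apply ContinuousOn.intervalIntegrable
      rw [uIcc_of_le hx.1]
      exact hg.mono hsub
  periodic := hp

theorem isH1_of_hasDerivAt (hg : ContinuousOn g (Icc 0 T))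
    (hf : ∀ x, HasDerivAt f (g x) x) (hp : f T = f 0) : IsH1 T f g :=
  isH1_of_hasDerivWithinAt hg (fun x _ => (hf x).hasDerivWithinAt) hp

theorem quartic_le (hT : 0 < T) (hf : IsH1 T f g) {s : ℝ} (hs : ∀ x ∈ Icc 0 T, ‖f x‖ ^ 2 ≤ s) :
    quartic T f ≤ s * sqNorm T f := by
  have hcon := hf.continuousOn hT
  rw [quartic, sqNorm, ← intervalIntegral.integral_const_mul]
  refine integral_mono_on hT.le ?_ ?_ fun x hx => ?_
  · apply ContinuousOn.intervalIntegrable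
    rw [uIcc_of_le hT.le]; exact hcon.norm.pow 4
  · apply ContinuousOn.intervalIntegrable
    rw [uIcc_of_le hT.le]; exact continuousOn_const.mul (hcon.norm.pow 2)
  · nlinarith [hs x hx, sq_nonneg ‖f x‖]

/-- The quartic term is controlled by half of the Dirichlet integral and by the mass. -/
theorem quartic_le_half (hT : 0 < T) (hf : IsH1 T f g) {M : ℝ} (hM : 0 < M)
    (hfM : sqNorm T f ≤ M) :
    quartic T f ≤ sqNorm T g / 2 + 2 / min T (1 / (4 * M)) * M ^ 2 := by
  set l := min T (1 / (4 * M)) with hl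
  have hl0 : 0 < l := lt_min hT (by positivity)
  have hlM : l * (4 * M) ≤ 1 := by
    have : l ≤ 1 / (4 * M) := min_le_right _ _
    rwa [le_div_iff₀ (by positivity)] at this
  have h := quartic_le hT hf fun x hx => hf.norm_sq_le hT hl0 (min_le_left _ _) hx
  refine h.trans ?_
  have hf0 := sqNorm_nonneg hT f
  have hg0 := sqNorm_nonneg hT g
  have h1 : 2 / l * sqNorm T f * sqNorm T f ≤ 2 / l * M ^ 2 := by
    rw [mul_assoc, ← sq]; gcongr
  have h2 : 2 * l * sqNorm T g * sqNorm T f ≤ sqNorm T g / 2 := by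
    have : 2 * l * sqNorm T g * sqNorm T f ≤ 2 * l * sqNorm T g * M := by gcongr
    nlinarith [mul_le_mul_of_nonneg_right hlM hg0]
  rw [add_mul]
  linarith

theorem sqNorm_const_mul (c : ℂ) (f : ℝ → ℂ) :
    sqNorm T (fun x => c * f x) = ‖c‖ ^ 2 * sqNorm T f := by
  simp [sqNorm, mul_pow]

theorem quartic_const_mul (c : ℂ) (f : ℝ → ℂ) :
    quartic T (fun x => c * f x) = ‖c‖ ^ 4 * quartic T f := by
  simp [quartic, mul_pow]

theorem sqNorm_add_add_sqNorm_sub (hT : 0 < T) (hf : MemLp f 2 (volume.restrict (Ioc 0 T)))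
    (hg : MemLp g 2 (volume.restrict (Ioc 0 T))) :
    sqNorm T (fun x => f x + g x) + sqNorm T (fun x => f x - g x) =
      2 * sqNorm T f + 2 * sqNorm T g := by
  have h0 : (0 : ℝ) ∈ Icc 0 T := ⟨le_rfl, hT.le⟩
  have h1 : T ∈ Icc 0 T := ⟨hT.le, le_rfl⟩
  have i1 : IntervalIntegrable (fun x => ‖f x + g x‖ ^ 2) volume 0 T :=
    intervalIntegrable_sq_of_memLp hT (hf.add hg) h0 h1
  have i2 : IntervalIntegrable (fun x => ‖f x - g x‖ ^ 2) volume 0 T :=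
    intervalIntegrable_sq_of_memLp hT (hf.sub hg) h0 h1
  rw [sqNorm, sqNorm, ← intervalIntegral.integral_add i1 i2, sqNorm, sqNorm,
    ← intervalIntegral.integral_const_mul, ← intervalIntegral.integral_const_mul,
    ← intervalIntegral.integral_add
    ((intervalIntegrable_sq_of_memLp hT hf h0 h1).const_mul 2)
    ((intervalIntegrable_sq_of_memLp hT hg h0 h1).const_mul 2)]
  congr 1
  funext x
  have := parallelogram_law_with_norm ℝ (f x) (g x)
  nlinarith

/-! ### Compactness of minimising sequences -/

/-- `I` is a lower bound of the energy `∫ |f'|² - |f|⁴` on the functions of mass `m`. -/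
def IsEnergyLowerBound (T m I : ℝ) : Prop :=
  ∀ f g : ℝ → ℂ, IsH1 T f g → sqNorm T f = m → I ≤ sqNorm T g - quartic T f

/-- The consequence of the lower bound, by scaling, for functions of arbitrary mass. -/
theorem IsEnergyLowerBound.scaled {m I : ℝ} (hI : IsEnergyLowerBound T m I) (hT : 0 < T)
    (hm : 0 < m) (hf : IsH1 T f g) :
    I * sqNorm T f ^ 2 + m ^ 2 * quartic T f ≤ m * sqNorm T g * sqNorm T f := by
  have hf0 := sqNorm_nonneg hT f
  rcases hf0.eq_or_lt with h0 | hpos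
  -- for vanishing mass both sides are zero; otherwise `f` is scaled to the mass `m`
  · have hb : quartic T f ≤ 0 := by
      have := quartic_le hT hf fun x hx => hf.norm_sq_le hT hT le_rfl hx
      rwa [← h0, mul_zero] at this
    rw [← h0, le_antisymm hb (quartic_nonneg hT f)]
    simp
  · have hd : 0 < m / sqNorm T f := by positivity
    have hc : ‖((Real.sqrt (m / sqNorm T f) : ℝ) : ℂ)‖ ^ 2 = m / sqNorm T f := by
      rw [Complex.norm_real, Real.norm_eq_abs, sq_abs, Real.sq_sqrt hd.le]
    have hc4 : ‖((Real.sqrt (m / sqNorm T f) : ℝ) : ℂ)‖ ^ 4 = (m / sqNorm T f) ^ 2 := by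
      rw [show 4 = 2 * 2 from rfl, pow_mul, hc]
    have := hI _ _ (hf.const_mul ((Real.sqrt (m / sqNorm T f) : ℝ) : ℂ)) (by
      rw [sqNorm_const_mul, hc]; field_simp)
    rw [sqNorm_const_mul, quartic_const_mul, hc, hc4] at this
    have h2 := mul_le_mul_of_nonneg_right this (sq_nonneg (sqNorm T f))
    have e : (m / sqNorm T f * sqNorm T g - (m / sqNorm T f) ^ 2 * quartic T f) * sqNorm T f ^ 2
      = m * sqNorm T g * sqNorm T f - m ^ 2 * quartic T f := by field_simp
    linarith

theorem sqNorm_eq_norm_toLp (hT : 0 < T) (hg : MemLp g 2 (volume.restrict (Ioc 0 T))) :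
    sqNorm T g = ‖hg.toLp g‖ ^ 2 := by
  rw [Lp.norm_toLp, hg.eLpNorm_eq_integral_rpow_norm two_ne_zero ENNReal.ofNat_ne_top,
    ENNReal.toReal_ofReal (by positivity), sqNorm, integral_of_le hT.le]
  simp only [ENNReal.toReal_ofNat, Real.rpow_ofNat]
  rw [← Real.rpow_natCast, ← Real.rpow_mul (by positivity)]
  norm_num

theorem tendsto_integral_norm_pow {ι : Type*} {l : Filter ι} [l.IsCountablyGenerated]
    (hT : 0 < T) {F : ι → ℝ → ℂ} (hF : ∀ i, ContinuousOn (F i) (Icc 0 T))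
    (hf : ContinuousOn f (Icc 0 T)) (h : TendstoUniformlyOn F f l (Icc 0 T)) (p : ℕ) :
    Tendsto (fun i => ∫ x in (0 : ℝ)..T, ‖F i x‖ ^ p) l (𝓝 (∫ x in (0 : ℝ)..T, ‖f x‖ ^ p)) := by
  have hu : uIoc 0 T ⊆ Icc 0 T := by rw [uIoc_of_le hT.le]; exact Ioc_subset_Icc_self
  refine intervalIntegral.tendsto_integral_filter_of_dominated_convergence
    (fun x => (‖f x‖ + 1) ^ p) ?_ ?_ ?_ ?_
  · exact Eventually.of_forall fun i =>
      (((hF i).norm.pow p).mono hu).aestronglyMeasurable measurableSet_uIoc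
  · filter_upwards [Metric.tendstoUniformlyOn_iff.1 h 1 one_pos] with i hi
    refine Eventually.of_forall fun x hx => ?_
    have h1 := hi x (hu hx)
    rw [dist_comm, dist_eq_norm] at h1
    rw [Real.norm_of_nonneg (by positivity)]
    gcongr
    have := norm_le_norm_add_norm_sub' (F i x) (f x)
    linarith
  · apply ContinuousOn.intervalIntegrable
    rw [uIcc_of_le hT.le]
    exact (hf.norm.add continuousOn_const).pow p
  · exact Eventually.of_forall fun x hx => ((h.tendsto_at (hu hx)).norm.pow p)

/-- A bounded sequence of `H¹` has a uniformly convergent subsequence (Arzelà–Ascoli). -/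
theorem exists_subseq_tendstoUniformlyOn (hT : 0 < T) {f g : ℕ → ℝ → ℂ}
    (hfg : ∀ n, IsH1 T (f n) (g n)) {M A : ℝ} (hM : ∀ n, sqNorm T (f n) ≤ M)
    (hA : ∀ n, sqNorm T (g n) ≤ A) :
    ∃ F : ℝ → ℂ, Continuous F ∧ ∃ φ : ℕ → ℕ, StrictMono φ ∧
      TendstoUniformlyOn (fun n => f (φ n)) F atTop (Icc 0 T) := by
  let u : ℕ → BoundedContinuousFunction (Icc (0 : ℝ) T) ℂ := fun n =>
    BoundedContinuousFunction.mkOfCompact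
      ⟨fun x => f n x, continuousOn_iff_continuous_domRestrict.1 ((hfg n).continuousOn hT)⟩
  have hu : ∀ n x, u n x = f n x := fun n x => rfl
  have hA0 : 0 ≤ A := (sqNorm_nonneg hT _).trans (hA 0)
  have hcomp : IsCompact (closure (range u)) := by
    refine BoundedContinuousFunction.arzela_ascoli
      (Metric.closedBall (0 : ℂ) (Real.sqrt (2 / T * M + 2 * T * A)))
      (isCompact_closedBall _ _) _ ?_ ?_
    · rintro _ x ⟨n, rfl⟩
      rw [mem_closedBall_zero_iff]
      apply Real.le_sqrt_of_sq_le
      refine ((hfg n).norm_sq_le hT hT le_rfl x.2).trans ?_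
      gcongr
      · exact hM n
      · exact hA n
    · apply Metric.equicontinuous_of_continuity_modulus (fun r => Real.sqrt (r * A))
      · have : Continuous fun r : ℝ => Real.sqrt (r * A) := by fun_prop
        simpa using this.tendsto 0
      · rintro x y ⟨_, n, rfl⟩
        change dist (f n x) (f n y) ≤ Real.sqrt (|(x : ℝ) - y| * A)
        rw [dist_eq_norm]
        apply Real.le_sqrt_of_sq_le
        refine ((hfg n).norm_sub_sq_le hT y.2 x.2).trans ?_
        exact mul_le_mul_of_nonneg_left (hA n) (abs_nonneg _)
  obtain ⟨v, -, φ, hφ, hlim⟩ := hcomp.tendsto_subseq fun n => subset_closure (mem_range_self n)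
  refine ⟨fun x => v (projIcc 0 T hT.le x), by fun_prop, φ, hφ, ?_⟩
  rw [Metric.tendstoUniformlyOn_iff]
  intro ε hε
  filter_upwards [(Metric.tendsto_nhds.1 hlim) ε hε] with n hn x hx
  rw [projIcc_of_mem hT.le hx, dist_comm]
  exact (BoundedContinuousFunction.dist_coe_le_dist (f := u (φ n)) (g := v) ⟨x, hx⟩).trans_lt hn

/-- An `H¹` sequence converging uniformly, whose derivatives form an `L²` Cauchy sequence,
converges in `H¹`. -/
theorem exists_isH1_of_cauchy (hT : 0 < T) {f g : ℕ → ℝ → ℂ} {F : ℝ → ℂ}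
    (hfg : ∀ n, IsH1 T (f n) (g n)) (hF : TendstoUniformlyOn f F atTop (Icc 0 T))
    (hg : Tendsto (fun p : ℕ × ℕ => sqNorm T (fun x => g p.1 x - g p.2 x))
      (atTop ×ˢ atTop) (𝓝 0)) :
    ∃ G : ℝ → ℂ, IsH1 T F G ∧ Tendsto (fun n => sqNorm T (fun x => g n x - G x)) atTop (𝓝 0) ∧
      Tendsto (fun n => sqNorm T (g n)) atTop (𝓝 (sqNorm T G)) := by
  have h0 : (0 : ℝ) ∈ Icc 0 T := ⟨le_rfl, hT.le⟩
  have h1 : T ∈ Icc 0 T := ⟨hT.le, le_rfl⟩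
  let u : ℕ → Lp ℂ 2 (volume.restrict (Ioc 0 T)) := fun n => (hfg n).memLp.toLp (g n)
  have hdist : ∀ n k, sqNorm T (fun x => g n x - g k x) = dist (u n) (u k) ^ 2 := by
    intro n k
    rw [dist_eq_norm]
    have : u n - u k = ((hfg n).memLp.sub (hfg k).memLp).toLp (g n - g k) := rfl
    rw [this, ← sqNorm_eq_norm_toLp hT]
    rfl
  have hc : CauchySeq u := by
    rw [Metric.cauchySeq_iff]
    intro ε hε
    have h2 := (tendsto_order.1 hg).2 (ε ^ 2) (by positivity)
    rw [prod_atTop_atTop_eq, eventually_atTop] at h2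
    obtain ⟨⟨a, b⟩, hab⟩ := h2
    refine ⟨max a b, fun n hn k hk => ?_⟩
    have := hab (n, k) ⟨(le_max_left _ _).trans hn, (le_max_right _ _).trans hk⟩
    rw [hdist] at this
    exact lt_of_pow_lt_pow_left₀ 2 hε.le this
  obtain ⟨G, hG⟩ := cauchySeq_tendsto_of_complete hc
  have hGm : MemLp (G : ℝ → ℂ) 2 (volume.restrict (Ioc 0 T)) := Lp.memLp G
  have hGG : hGm.toLp (G : ℝ → ℂ) = G := Lp.toLp_coeFn G hGm
  have hd : ∀ n, sqNorm T (fun x => g n x - G x) = dist (u n) G ^ 2 := by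
    intro n
    rw [dist_eq_norm]
    have : u n - G = ((hfg n).memLp.sub hGm).toLp (g n - (G : ℝ → ℂ)) := by
      rw [MemLp.toLp_sub (hfg n).memLp hGm, hGG]
    rw [this, ← sqNorm_eq_norm_toLp hT]
    rfl
  have hlim : Tendsto (fun n => sqNorm T (fun x => g n x - G x)) atTop (𝓝 0) := by
    simp only [hd]
    simpa using (tendsto_iff_dist_tendsto_zero.1 hG).pow 2
  have hint : ∀ x ∈ Icc 0 T, Tendsto (fun n => ∫ y in (0 : ℝ)..x, g n y) atTop
      (𝓝 (∫ y in (0 : ℝ)..x, G y)) := by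
    intro x hx
    rw [tendsto_iff_norm_sub_tendsto_zero]
    have hb : ∀ n, ‖(∫ y in (0 : ℝ)..x, g n y) - ∫ y in (0 : ℝ)..x, G y‖ ≤
        Real.sqrt (T * sqNorm T (fun x => g n x - G x)) := by
      intro n
      have hm := (hfg n).memLp.sub hGm
      rw [← intervalIntegral.integral_sub (intervalIntegrable_of_memLp hT (hfg n).memLp h0 hx)
        (intervalIntegrable_of_memLp hT hGm h0 hx)]
      apply Real.le_sqrt_of_sq_le
      have i1 : IntervalIntegrable (fun y => g n y - G y) volume 0 x :=
        intervalIntegrable_of_memLp hT hm h0 hx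
      have i2 : ∀ x ∈ Icc 0 T, IntervalIntegrable (fun y => ‖g n y - G y‖ ^ 2) volume 0 x :=
        fun x hx => intervalIntegrable_sq_of_memLp hT hm h0 hx
      refine (norm_integral_sq_le hx.1 i1 (i2 x hx)).trans ?_
      rw [sub_zero]
      have : ∫ y in (0 : ℝ)..x, ‖g n y - G y‖ ^ 2 ≤ sqNorm T (fun x => g n x - G x) :=
        integral_mono_interval le_rfl hx.1 hx.2 (Eventually.of_forall fun x => by positivity)
          (i2 T h1)
      exact mul_le_mul hx.2 this (integral_nonneg hx.1 fun _ _ => by positivity) hT.le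
    refine squeeze_zero (fun n => norm_nonneg _) hb ?_
    have := (hlim.const_mul T).sqrt
    simpa using this
  refine ⟨G, ⟨hGm, fun x hx => ?_, ?_⟩, hlim, ?_⟩
  · refine tendsto_nhds_unique (hF.tendsto_at hx) ?_
    have := (hF.tendsto_at h0).add (hint x hx)
    exact this.congr fun n => ((hfg n).eq_integral x hx).symm
  · refine tendsto_nhds_unique (hF.tendsto_at h1) ?_
    exact (hF.tendsto_at h0).congr fun n => ((hfg n).periodic).symm
  · have := hG.norm.pow 2
    rw [← hGG, ← sqNorm_eq_norm_toLp hT] at this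
    exact this.congr fun n => (sqNorm_eq_norm_toLp hT (hfg n).memLp).symm

/-- Minimising sequences for the energy at fixed mass are precompact in `H¹`. After passage to a
uniformly convergent subsequence, the parallelogram identity turns the lower bound for the energy
of the midpoint of two members into an upper bound for the `L²` distance of their derivatives. -/
theorem IsEnergyLowerBound.exists_subseq_tendsto {m I : ℝ} (hI : IsEnergyLowerBound T m I)
    (hT : 0 < T) (hm : 0 < m) {f g : ℕ → ℝ → ℂ} (hfg : ∀ n, IsH1 T (f n) (g n))
    (hM : Tendsto (fun n => sqNorm T (f n)) atTop (𝓝 m))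
    (hE : Tendsto (fun n => sqNorm T (g n) - quartic T (f n)) atTop (𝓝 I)) :
    ∃ F G : ℝ → ℂ, IsH1 T F G ∧ sqNorm T F = m ∧ sqNorm T G - quartic T F = I ∧
      ∃ φ : ℕ → ℕ, StrictMono φ ∧
        Tendsto (fun n => sqNorm T (fun x => f (φ n) x - F x)) atTop (𝓝 0) ∧
        Tendsto (fun n => sqNorm T (fun x => g (φ n) x - G x)) atTop (𝓝 0) := by
  obtain ⟨M, hMb⟩ := hM.bddAbove_range
  obtain ⟨E, hEb⟩ := hE.bddAbove_range
  replace hMb : ∀ n, sqNorm T (f n) ≤ max M 1 := fun n =>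
    (hMb (mem_range_self n)).trans (le_max_left _ _)
  replace hEb : ∀ n, sqNorm T (g n) - quartic T (f n) ≤ E := fun n => hEb (mem_range_self n)
  have hM0 : 0 < max M 1 := lt_max_of_lt_right one_pos
  -- the energy bounds the Dirichlet integral, since the quartic term takes at most half of it
  have hAb : ∀ n, sqNorm T (g n) ≤ 2 * (E + 2 / min T (1 / (4 * max M 1)) * max M 1 ^ 2) := by
    intro n
    have := quartic_le_half hT (hfg n) hM0 (hMb n)
    linarith [hEb n]
  obtain ⟨F, hFc, φ, hφ, hunif⟩ := exists_subseq_tendstoUniformlyOn hT hfg hMb hAb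
  have hφt := hφ.tendsto_atTop
  have hcont : ∀ n, ContinuousOn (f (φ n)) (Icc 0 T) := fun n => (hfg _).continuousOn hT
  have hMF : sqNorm T F = m := tendsto_nhds_unique
    (tendsto_integral_norm_pow hT hcont hFc.continuousOn hunif 2) (hM.comp hφt)
  have hBlim : Tendsto (fun n => quartic T (f (φ n))) atTop (𝓝 (quartic T F)) :=
    tendsto_integral_norm_pow hT hcont hFc.continuousOn hunif 4
  have hAlim : Tendsto (fun n => sqNorm T (g (φ n))) atTop (𝓝 (I + quartic T F)) := by
    have := (hE.comp hφt).add hBlim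
    simpa using this
  -- the midpoints converge uniformly to `F`; their mass need not be `m`, so the scaled form of the
  -- lower bound is applied to them
  let mid : ℕ × ℕ → ℝ → ℂ := fun p x => (1 / 2 : ℂ) * (f (φ p.1) x + f (φ p.2) x)
  have hmidH : ∀ p : ℕ × ℕ, IsH1 T (mid p)
      (fun x => (1 / 2 : ℂ) * (g (φ p.1) x + g (φ p.2) x)) := fun p =>
    ((hfg _).add hT (hfg _)).const_mul _
  have hmidu : TendstoUniformlyOn mid F (atTop ×ˢ atTop) (Icc 0 T) := by
    rw [Metric.tendstoUniformlyOn_iff] at hunif ⊢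
    intro ε hε
    filter_upwards [(hunif ε hε).prod_mk (hunif ε hε)] with p hp x hx
    have h1 := hp.1 x hx
    have h2 := hp.2 x hx
    rw [dist_eq_norm] at h1 h2 ⊢
    have : F x - mid p x = (1 / 2 : ℂ) * ((F x - f (φ p.1) x) + (F x - f (φ p.2) x)) := by
      simp only [mid]; ring
    rw [this, norm_mul]
    have h3 := norm_add_le (F x - f (φ p.1) x) (F x - f (φ p.2) x)
    have h4 : ‖(1 / 2 : ℂ)‖ = 1 / 2 := by simp
    rw [h4]
    linarith
  have hMmid : Tendsto (fun p => sqNorm T (mid p)) (atTop ×ˢ atTop) (𝓝 m) := by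
    rw [← hMF]
    exact tendsto_integral_norm_pow hT (fun p => (hmidH p).continuousOn hT)
      hFc.continuousOn hmidu 2
  have hBmid : Tendsto (fun p => quartic T (mid p)) (atTop ×ˢ atTop) (𝓝 (quartic T F)) :=
    tendsto_integral_norm_pow hT (fun p => (hmidH p).continuousOn hT) hFc.continuousOn hmidu 4
  have hcauchy : Tendsto (fun p : ℕ × ℕ => sqNorm T (fun x => g (φ p.1) x - g (φ p.2) x))
      (atTop ×ˢ atTop) (𝓝 0) := by
    have hup : Tendsto (fun p : ℕ × ℕ => 2 * sqNorm T (g (φ p.1)) + 2 * sqNorm T (g (φ p.2)) -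
        4 * ((I * sqNorm T (mid p) ^ 2 + m ^ 2 * quartic T (mid p)) / (m * sqNorm T (mid p))))
        (atTop ×ˢ atTop) (𝓝 0) := by
      have h1 := ((hAlim.comp tendsto_fst).const_mul 2).add
        ((hAlim.comp (tendsto_snd (f := atTop) (g := atTop))).const_mul 2)
      have h2 := (((hMmid.pow 2).const_mul I).add (hBmid.const_mul (m ^ 2))).div
        (hMmid.const_mul m) (by positivity)
      have h3 := h1.sub (h2.const_mul 4)
      have e : 2 * (I + quartic T F) + 2 * (I + quartic T F) -
          4 * ((I * m ^ 2 + m ^ 2 * quartic T F) / (m * m)) = 0 := by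
        field_simp; ring
      rw [e] at h3
      exact h3
    refine tendsto_of_tendsto_of_tendsto_of_le_of_le' tendsto_const_nhds hup
      (Eventually.of_forall fun p => sqNorm_nonneg hT _) ?_
    filter_upwards [(tendsto_order.1 hMmid).1 0 hm] with p hp
    have h1 := sqNorm_add_add_sqNorm_sub hT (hfg (φ p.1)).memLp (hfg (φ p.2)).memLp
    have h2 := hI.scaled hT hm (hmidH p)
    have h4 : ‖(1 / 2 : ℂ)‖ ^ 2 = 1 / 4 := by simp; norm_num
    rw [sqNorm_const_mul (T := T) (1 / 2 : ℂ) fun x => g (φ p.1) x + g (φ p.2) x, h4] at h2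
    have h5 : (I * sqNorm T (mid p) ^ 2 + m ^ 2 * quartic T (mid p)) / (m * sqNorm T (mid p)) ≤
        1 / 4 * sqNorm T (fun x => g (φ p.1) x + g (φ p.2) x) := by
      rw [div_le_iff₀ (by positivity)]
      linarith
    linarith
  obtain ⟨G, hFG, hGlim, hGA⟩ := exists_isH1_of_cauchy hT (fun n => hfg (φ n)) hunif hcauchy
  refine ⟨F, G, hFG, hMF, ?_, φ, hφ, ?_, hGlim⟩
  · rw [tendsto_nhds_unique hGA hAlim]; ring
  · have hu0 : TendstoUniformlyOn (fun n x => f (φ n) x - F x) (fun _ => 0) atTop (Icc 0 T) := by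
      rw [Metric.tendstoUniformlyOn_iff] at hunif ⊢
      intro ε hε
      filter_upwards [hunif ε hε] with n hn x hx
      simpa [dist_eq_norm, norm_sub_rev] using hn x hx
    have := tendsto_integral_norm_pow hT (fun n => (hcont n).sub hFc.continuousOn)
      continuousOn_const hu0 2
    simpa [sqNorm] using this

end CmKdV

namespace CmKdV

open Set MeasureTheory Filter Topology intervalIntegral

variable {T : ℝ} {f g h k : ℝ → ℂ}

/-! ### The Euler–Lagrange equation -/

/-- `f`, with weak derivative `g`, minimises the energy among the functions of mass `m`. -/
structure IsMinimizer (T m : ℝ) (f g : ℝ → ℂ) : Prop where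
  isH1 : IsH1 T f g
  mass : sqNorm T f = m
  lowerBound : IsEnergyLowerBound T m (sqNorm T g - quartic T f)

theorem norm_add_ofReal_mul_sq (z w : ℂ) (ε : ℝ) :
    ‖z + (ε : ℂ) * w‖ ^ 2 = ‖z‖ ^ 2 + 2 * ε * inner ℝ z w + ε ^ 2 * ‖w‖ ^ 2 := by
  have := norm_add_sq_real z ((ε : ℂ) * w)
  rw [this, ← Complex.real_smul, inner_smul_right, norm_smul, mul_pow, Real.norm_eq_abs, sq_abs]
  ring

theorem intervalIntegrable_inner (hT : 0 < T) (hf : MemLp f 2 (volume.restrict (Ioc 0 T)))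
    (hg : MemLp g 2 (volume.restrict (Ioc 0 T))) :
    IntervalIntegrable (fun x => inner ℝ (f x) (g x)) volume 0 T := by
  have h0 : (0 : ℝ) ∈ Icc 0 T := ⟨le_rfl, hT.le⟩
  have h1 : T ∈ Icc 0 T := ⟨hT.le, le_rfl⟩
  have i1 : IntervalIntegrable (fun x => ‖f x + g x‖ ^ 2) volume 0 T :=
    intervalIntegrable_sq_of_memLp hT (hf.add hg) h0 h1
  have i2 : IntervalIntegrable (fun x => ‖f x - g x‖ ^ 2) volume 0 T :=
    intervalIntegrable_sq_of_memLp hT (hf.sub hg) h0 h1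
  refine ((i1.sub i2).const_mul (1 / 4)).congr ?_
  intro x _
  simp only [norm_add_sq_real, norm_sub_sq_real]
  ring

theorem sqNorm_add_mul (hT : 0 < T) (hf : MemLp f 2 (volume.restrict (Ioc 0 T)))
    (hh : MemLp h 2 (volume.restrict (Ioc 0 T))) (ε : ℝ) :
    sqNorm T (fun x => f x + (ε : ℂ) * h x) =
      sqNorm T f + 2 * ε * (∫ x in (0 : ℝ)..T, inner ℝ (f x) (h x)) + ε ^ 2 * sqNorm T h := by
  have h0 : (0 : ℝ) ∈ Icc 0 T := ⟨le_rfl, hT.le⟩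
  have h1 : T ∈ Icc 0 T := ⟨hT.le, le_rfl⟩
  have i1 := intervalIntegrable_sq_of_memLp hT hf h0 h1
  have i2 := intervalIntegrable_sq_of_memLp hT hh h0 h1
  have i3 := intervalIntegrable_inner hT hf hh
  simp only [sqNorm, norm_add_ofReal_mul_sq]
  rw [intervalIntegral.integral_add (i1.add (i3.const_mul _)) (i2.const_mul _),
    intervalIntegral.integral_add i1 (i3.const_mul _), intervalIntegral.integral_const_mul,
    intervalIntegral.integral_const_mul]

theorem quartic_add_mul (hT : 0 < T) (hf : ContinuousOn f (Icc 0 T))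
    (hh : ContinuousOn h (Icc 0 T)) (ε : ℝ) :
    quartic T (fun x => f x + (ε : ℂ) * h x) =
      quartic T f + 4 * ε * (∫ x in (0 : ℝ)..T, ‖f x‖ ^ 2 * inner ℝ (f x) (h x)) +
        ε ^ 2 * (∫ x in (0 : ℝ)..T, (4 * inner ℝ (f x) (h x) ^ 2 + 2 * (‖f x‖ ^ 2 * ‖h x‖ ^ 2))) +
        ε ^ 3 * (4 * ∫ x in (0 : ℝ)..T, inner ℝ (f x) (h x) * ‖h x‖ ^ 2) + ε ^ 4 * quartic T h := by
  have hi : ContinuousOn (fun x => inner ℝ (f x) (h x)) (Icc 0 T) := ContinuousOn.inner (𝕜 := ℝ) hf hh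
  have key : ∀ {u : ℝ → ℝ}, ContinuousOn u (Icc 0 T) → IntervalIntegrable u volume 0 T := by
    intro u hu
    apply ContinuousOn.intervalIntegrable
    rwa [uIcc_of_le hT.le]
  have i1 : IntervalIntegrable (fun x => ‖f x‖ ^ 4) volume 0 T := key (hf.norm.pow 4)
  have i2 : IntervalIntegrable (fun x => ‖f x‖ ^ 2 * inner ℝ (f x) (h x)) volume 0 T :=
    key ((hf.norm.pow 2).mul hi)
  have i3 : IntervalIntegrable (fun x => 4 * inner ℝ (f x) (h x) ^ 2 + 2 * (‖f x‖ ^ 2 * ‖h x‖ ^ 2))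
      volume 0 T := key ((continuousOn_const.mul (hi.pow 2)).add
        (continuousOn_const.mul ((hf.norm.pow 2).mul (hh.norm.pow 2))))
  have i4 : IntervalIntegrable (fun x => inner ℝ (f x) (h x) * ‖h x‖ ^ 2) volume 0 T :=
    key (hi.mul (hh.norm.pow 2))
  have i5 : IntervalIntegrable (fun x => ‖h x‖ ^ 4) volume 0 T := key (hh.norm.pow 4)
  have e : ∀ x, ‖f x + (ε : ℂ) * h x‖ ^ 4 = ‖f x‖ ^ 4 + 4 * ε * (‖f x‖ ^ 2 * inner ℝ (f x) (h x)) +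
      ε ^ 2 * (4 * inner ℝ (f x) (h x) ^ 2 + 2 * (‖f x‖ ^ 2 * ‖h x‖ ^ 2)) +
      ε ^ 3 * (4 * (inner ℝ (f x) (h x) * ‖h x‖ ^ 2)) + ε ^ 4 * ‖h x‖ ^ 4 := by
    intro x
    rw [show 4 = 2 * 2 from rfl, pow_mul, norm_add_ofReal_mul_sq]
    ring
  simp only [quartic, e]
  rw [intervalIntegral.integral_add
      (((i1.add (i2.const_mul _)).add (i3.const_mul _)).add ((i4.const_mul 4).const_mul _))
      (i5.const_mul _),
    intervalIntegral.integral_add ((i1.add (i2.const_mul _)).add (i3.const_mul _))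
      ((i4.const_mul 4).const_mul _),
    intervalIntegral.integral_add (i1.add (i2.const_mul _)) (i3.const_mul _),
    intervalIntegral.integral_add i1 (i2.const_mul _)]
  simp only [intervalIntegral.integral_const_mul]

/-- The energy defect `m A M - m² B - I M²` of `f + ε h`, expanded in powers of `ε`. It is
nonnegative by the scaled lower bound and vanishes at `ε = 0`. -/
theorem IsMinimizer.variation_nonneg {m : ℝ} (hf : IsMinimizer T m f g) (hT : 0 < T) (hm : 0 < m)
    (hh : IsH1 T h k) (ε : ℝ) :
    0 ≤ m * (sqNorm T g + 2 * ε * (∫ x in (0 : ℝ)..T, inner ℝ (g x) (k x)) + ε ^ 2 * sqNorm T k) *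
        (m + 2 * ε * (∫ x in (0 : ℝ)..T, inner ℝ (f x) (h x)) + ε ^ 2 * sqNorm T h) -
      m ^ 2 * (quartic T f + 4 * ε * (∫ x in (0 : ℝ)..T, ‖f x‖ ^ 2 * inner ℝ (f x) (h x)) +
        ε ^ 2 * (∫ x in (0 : ℝ)..T, (4 * inner ℝ (f x) (h x) ^ 2 + 2 * (‖f x‖ ^ 2 * ‖h x‖ ^ 2))) +
        ε ^ 3 * (4 * ∫ x in (0 : ℝ)..T, inner ℝ (f x) (h x) * ‖h x‖ ^ 2) + ε ^ 4 * quartic T h) -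
      (sqNorm T g - quartic T f) *
        (m + 2 * ε * (∫ x in (0 : ℝ)..T, inner ℝ (f x) (h x)) + ε ^ 2 * sqNorm T h) ^ 2 := by
  have hfc := hf.isH1.continuousOn hT
  have hhc := hh.continuousOn hT
  have := hf.lowerBound.scaled hT hm (hf.isH1.add hT (hh.const_mul (ε : ℂ)))
  rw [sqNorm_add_mul hT (memLp_of_continuousOn hfc) (memLp_of_continuousOn hhc),
    sqNorm_add_mul hT hf.isH1.memLp hh.memLp, quartic_add_mul hT hfc hhc, hf.mass] at this
  linarith

/-- The Euler–Lagrange equation in weak form: the linear coefficient in `ε` of the nonnegative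
polynomial of `IsMinimizer.variation_nonneg` vanishes. -/
theorem IsMinimizer.weak_equation {m : ℝ} (hf : IsMinimizer T m f g) (hT : 0 < T) (hm : 0 < m)
    (hh : IsH1 T h k) :
    ∫ x in (0 : ℝ)..T, inner ℝ (g x) (k x) = 2 * (∫ x in (0 : ℝ)..T, ‖f x‖ ^ 2 * inner ℝ (f x) (h x)) +
      (sqNorm T g - 2 * quartic T f) / m * ∫ x in (0 : ℝ)..T, inner ℝ (f x) (h x) := by
  have hv := hf.variation_nonneg hT hm hh
  set a0 := sqNorm T g
  set a1 := ∫ x in (0 : ℝ)..T, inner ℝ (g x) (k x)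
  set a2 := sqNorm T k
  set m1 := ∫ x in (0 : ℝ)..T, inner ℝ (f x) (h x)
  set m2 := sqNorm T h
  set b0 := quartic T f
  set b1 := ∫ x in (0 : ℝ)..T, ‖f x‖ ^ 2 * inner ℝ (f x) (h x)
  set b2 := ∫ x in (0 : ℝ)..T, (4 * inner ℝ (f x) (h x) ^ 2 + 2 * (‖f x‖ ^ 2 * ‖h x‖ ^ 2))
  set b3 := 4 * ∫ x in (0 : ℝ)..T, inner ℝ (f x) (h x) * ‖h x‖ ^ 2
  set b4 := quartic T h
  let p : ℝ → ℝ := fun ε => m * (a0 + 2 * ε * a1 + ε ^ 2 * a2) * (m + 2 * ε * m1 + ε ^ 2 * m2) -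
      m ^ 2 * (b0 + 4 * ε * b1 + ε ^ 2 * b2 + ε ^ 3 * b3 + ε ^ 4 * b4) -
      (a0 - b0) * (m + 2 * ε * m1 + ε ^ 2 * m2) ^ 2
  have hmin : IsLocalMin p 0 := by
    refine Filter.Eventually.of_forall fun ε => ?_
    have e : p 0 = 0 := by simp only [p]; ring
    rw [e]
    exact hv ε
  have hA : HasDerivAt (fun ε : ℝ => m * (a0 + 2 * ε * a1 + ε ^ 2 * a2)) (m * (2 * a1)) 0 := by
    have := (((((hasDerivAt_id' (0 : ℝ)).const_mul 2).mul_const a1).const_add a0).fun_add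
      (((hasDerivAt_id' (0 : ℝ)).fun_pow 2).mul_const a2)).const_mul m
    simpa using this
  have hM : HasDerivAt (fun ε : ℝ => m + 2 * ε * m1 + ε ^ 2 * m2) (2 * m1) 0 := by
    have := ((((hasDerivAt_id' (0 : ℝ)).const_mul 2).mul_const m1).const_add m).fun_add
      (((hasDerivAt_id' (0 : ℝ)).fun_pow 2).mul_const m2)
    simpa using this
  have hB : HasDerivAt (fun ε : ℝ => m ^ 2 * (b0 + 4 * ε * b1 + ε ^ 2 * b2 + ε ^ 3 * b3 +
      ε ^ 4 * b4)) (m ^ 2 * (4 * b1)) 0 := by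
    have := (((((((hasDerivAt_id' (0 : ℝ)).const_mul 4).mul_const b1).const_add b0).fun_add
      (((hasDerivAt_id' (0 : ℝ)).fun_pow 2).mul_const b2)).fun_add
      (((hasDerivAt_id' (0 : ℝ)).fun_pow 3).mul_const b3)).fun_add
      (((hasDerivAt_id' (0 : ℝ)).fun_pow 4).mul_const b4)).const_mul (m ^ 2)
    simpa using this
  have hp : HasDerivAt p _ 0 := ((hA.fun_mul hM).fun_sub hB).fun_sub ((hM.fun_pow 2).const_mul _)
  have h0 := hmin.hasDerivAt_eq_zero hp
  simp only [mul_zero, zero_mul, add_zero, ne_eq, OfNat.ofNat_ne_zero, not_false_eq_true,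
    zero_pow, Nat.cast_ofNat, Nat.add_one_sub_one, pow_one] at h0
  have h2 : m * (m * a1 + a0 * m1 - 2 * m * b1 - 2 * (a0 - b0) * m1) = 0 := by linarith
  have h3 := (mul_eq_zero.1 h2).resolve_left hm.ne'
  field_simp
  linarith

/-- The weak equation against `h = ∫ φ`, with `φ` real of mean zero, in complex form; `N` is a
continuous extension of `(2|f|² + λ) f`. -/
theorem IsMinimizer.integral_smul_eq {m : ℝ} (hf : IsMinimizer T m f g) (hT : 0 < T) (hm : 0 < m)
    {N : ℝ → ℂ} (hN : Continuous N)
    (hNf : ∀ x ∈ Icc 0 T, N x = ((2 * ‖f x‖ ^ 2 + (sqNorm T g - 2 * quartic T f) / m : ℝ) : ℂ) * f x)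
    {φ H : ℝ → ℝ} (hφ : Continuous φ) (hH : ∀ x, HasDerivAt H (φ x) x) (hHT : H T = H 0) :
    ∫ x in (0 : ℝ)..T, φ x • g x = ∫ x in (0 : ℝ)..T, H x • N x := by
  have hHc : Continuous H := continuous_iff_continuousAt.2 fun x => (hH x).continuousAt
  have hfc := hf.isH1.continuousOn hT
  have h0 : (0 : ℝ) ∈ Icc 0 T := ⟨le_rfl, hT.le⟩
  have h1 : T ∈ Icc 0 T := ⟨hT.le, le_rfl⟩
  have hgi := intervalIntegrable_of_memLp hT hf.isH1.memLp h0 h1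
  have igφ : IntervalIntegrable (fun x => φ x • g x) volume 0 T :=
    hgi.continuousOn_smul hφ.continuousOn
  have iNH : IntervalIntegrable (fun x => H x • N x) volume 0 T :=
    (hHc.smul hN).intervalIntegrable _ _
  have key : ∀ z : ℂ, inner ℝ (∫ x in (0 : ℝ)..T, φ x • g x) z =
      inner ℝ (∫ x in (0 : ℝ)..T, H x • N x) z := by
    intro z
    have hw := hf.weak_equation hT hm (h := fun x => (H x : ℂ) * z) (k := fun x => (φ x : ℂ) * z)
      (isH1_of_hasDerivAt (by fun_prop) (fun x => (hH x).ofReal_comp.mul_const z) (by rw [hHT]))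
    have e1 : ∀ x, inner ℝ (g x) ((φ x : ℂ) * z) = inner ℝ z (φ x • g x) := by
      intro x
      rw [← Complex.real_smul, inner_smul_right, inner_smul_right, real_inner_comm]
    have c1 : ContinuousOn (fun x => inner ℝ (f x) ((H x : ℂ) * z)) (uIcc 0 T) := by
      rw [uIcc_of_le hT.le]
      exact ContinuousOn.inner (𝕜 := ℝ) hfc (by fun_prop)
    have c2 : ContinuousOn (fun x => ‖f x‖ ^ 2) (uIcc 0 T) := by
      rw [uIcc_of_le hT.le]
      exact hfc.norm.pow 2
    simp only [e1] at hw
    rw [← intervalIntegral.integral_const_mul, ← intervalIntegral.integral_const_mul,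
      ← intervalIntegral.integral_add ((c2.fun_mul c1).intervalIntegrable.const_mul _)
      (c1.intervalIntegrable.const_mul _)] at hw
    have e2 : ∫ x in (0 : ℝ)..T, (2 * (‖f x‖ ^ 2 * inner ℝ (f x) ((H x : ℂ) * z)) +
        (sqNorm T g - 2 * quartic T f) / m * inner ℝ (f x) ((H x : ℂ) * z)) =
        ∫ x in (0 : ℝ)..T, inner ℝ z (H x • N x) := by
      apply integral_congr
      intro x hx
      rw [uIcc_of_le hT.le] at hx
      simp only
      rw [hNf x hx, ← Complex.real_smul, ← Complex.real_smul, inner_smul_right, inner_smul_right,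
        inner_smul_right, real_inner_comm]
      ring
    rw [e2] at hw
    have e3 := (innerSL ℝ z).intervalIntegral_comp_comm igφ
    have e4 := (innerSL ℝ z).intervalIntegral_comp_comm iNH
    simp only [innerSL_apply_apply] at e3 e4
    rw [real_inner_comm, real_inner_comm z, ← e3, ← e4, hw]
  exact ext_inner_right ℝ key

/-- A function whose integral against every real continuous function of mean zero vanishes is
almost everywhere constant. -/
theorem ae_eq_const_of_integral_smul_eq_zero (hT : 0 < T) {w : ℝ → ℂ}
    (hw : IntervalIntegrable w volume 0 T)
    (h : ∀ φ : ℝ → ℝ, Continuous φ → ∫ x in (0 : ℝ)..T, φ x = 0 →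
      ∫ x in (0 : ℝ)..T, φ x • w x = 0) :
    ∃ c : ℂ, ∀ᵐ x, x ∈ Ioo 0 T → w x = c := by
  refine ⟨((T⁻¹ : ℝ) : ℂ) * ∫ x in (0 : ℝ)..T, w x, ?_⟩
  set c := ((T⁻¹ : ℝ) : ℂ) * ∫ x in (0 : ℝ)..T, w x with hc
  have hwo : IntegrableOn (fun x => w x - c) (Ioo 0 T) := by
    have := (intervalIntegrable_iff_integrableOn_Ioo_of_le hT.le).1
      (hw.sub (intervalIntegrable_const (c := c)))
    exact this
  have := isOpen_Ioo.ae_eq_zero_of_integral_contDiff_smul_eq_zero hwo.locallyIntegrableOn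
    (fun φ hφ _ hsupp => ?_)
  · filter_upwards [this] with x hx hxT
    exact sub_eq_zero.1 (hx hxT)
  · have hφc := hφ.continuous
    have e1 : ∫ x, φ x • (w x - c) = ∫ x in (0 : ℝ)..T, φ x • (w x - c) := by
      rw [integral_of_le hT.le, setIntegral_eq_integral_of_forall_compl_eq_zero]
      intro x hx
      have : φ x = 0 := by
        by_contra hne
        exact hx (Ioo_subset_Ioc_self (hsupp (subset_tsupport φ hne)))
      simp [this]
    set μ := T⁻¹ * ∫ x in (0 : ℝ)..T, φ x with hμ
    have hφi : IntervalIntegrable φ volume 0 T := hφc.intervalIntegrable _ _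
    have h2 := h (fun x => φ x - μ) (by fun_prop) (by
      rw [intervalIntegral.integral_sub hφi (by simp), intervalIntegral.integral_const, hμ,
        smul_eq_mul]
      field_simp; ring)
    have i1 : IntervalIntegrable (fun x => φ x • w x) volume 0 T :=
      hw.continuousOn_smul hφc.continuousOn
    have i2 : IntervalIntegrable (fun x => μ • w x) volume 0 T := hw.smul μ
    have i3 : IntervalIntegrable (fun x => φ x • c) volume 0 T :=
      (hφc.smul continuous_const).intervalIntegrable _ _
    simp only [sub_smul] at h2
    rw [intervalIntegral.integral_sub i1 i2, intervalIntegral.integral_smul] at h2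
    rw [e1]
    simp only [smul_sub]
    rw [intervalIntegral.integral_sub i1 i3, intervalIntegral.integral_smul_const, ← h2, hc, hμ]
    congr 1
    rw [Complex.real_smul, Complex.real_smul]
    push_cast
    ring

/-- Minimisers are classical solutions of `f'' = -(2|f|² + λ) f` with periodic boundary
conditions. -/
theorem IsMinimizer.exists_ode {m : ℝ} (hf : IsMinimizer T m f g) (hT : 0 < T) (hm : 0 < m) :
    ∃ G : ℝ → ℂ, (∀ x ∈ Icc 0 T, HasDerivWithinAt f (G x) (Icc 0 T) x) ∧
      (∀ x ∈ Icc 0 T, HasDerivWithinAt G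
        (-(((2 * ‖f x‖ ^ 2 + (sqNorm T g - 2 * quartic T f) / m : ℝ) : ℂ) * f x)) (Icc 0 T) x) ∧
      G T = G 0 ∧ ∀ᵐ x, x ∈ Ioo 0 T → g x = G x := by
  set lam := (sqNorm T g - 2 * quartic T f) / m with hlam
  have hfc := hf.isH1.continuousOn hT
  have h0 : (0 : ℝ) ∈ Icc 0 T := ⟨le_rfl, hT.le⟩
  have h1 : T ∈ Icc 0 T := ⟨hT.le, le_rfl⟩
  have hgi := intervalIntegrable_of_memLp hT hf.isH1.memLp h0 h1
  -- `IsH1` says nothing about `f` outside `[0,T]`: the right-hand side of the equation is extended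
  -- continuously by constants
  let fe : ℝ → ℂ := fun x => f (projIcc 0 T hT.le x)
  have hfe : Continuous fe := (continuousOn_iff_continuous_domRestrict.1 hfc).comp continuous_projIcc
  have hfef : ∀ x ∈ Icc 0 T, fe x = f x := fun x hx => by simp [fe, projIcc_of_mem hT.le hx]
  let N : ℝ → ℂ := fun x => ((2 * ‖fe x‖ ^ 2 + lam : ℝ) : ℂ) * fe x
  have hN : Continuous N := by fun_prop
  have hNf : ∀ x ∈ Icc 0 T, N x = ((2 * ‖f x‖ ^ 2 + lam : ℝ) : ℂ) * f x := fun x hx => by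
    simp only [N]; rw [hfef x hx]
  let P : ℝ → ℂ := fun x => ∫ y in (0 : ℝ)..x, N y
  have hP : ∀ x, HasDerivAt P (N x) x := fun x =>
    (hN.integral_hasStrictDerivAt 0 x).hasDerivAt
  have hPc : Continuous P := continuous_iff_continuousAt.2 fun x => (hP x).continuousAt
  have hP0 : P 0 = 0 := integral_same
  -- the test function `1` gives the solvability condition `∫ N = 0`
  have hPT : P T = 0 := by
    have := hf.integral_smul_eq hT hm hN hNf (φ := fun _ => 0) (H := fun _ => 1)
      continuous_const (fun x => hasDerivAt_const _ _) rfl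
    simpa using this.symm
  -- the lemma of du Bois-Reymond: `g + P` is orthogonal to the functions of mean zero
  obtain ⟨c, hc⟩ := ae_eq_const_of_integral_smul_eq_zero hT
    (w := fun x => g x + P x) (hgi.add (hPc.intervalIntegrable _ _)) (by
      intro φ hφ hφ0
      let H : ℝ → ℝ := fun x => ∫ y in (0 : ℝ)..x, φ y
      have hH : ∀ x, HasDerivAt H (φ x) x := fun x =>
        (hφ.integral_hasStrictDerivAt 0 x).hasDerivAt
      have hHc : Continuous H := continuous_iff_continuousAt.2 fun x => (hH x).continuousAt
      have hHT : H T = H 0 := by simpa [H] using hφ0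
      have e := hf.integral_smul_eq hT hm hN hNf hφ hH hHT
      have e2 := integral_smul_deriv_eq_deriv_smul_of_hasDerivAt (a := 0) (b := T)
        hHc.continuousOn hPc.continuousOn (fun x _ => hH x) (fun x _ => hP x)
        (hφ.intervalIntegrable _ _) (hN.intervalIntegrable _ _)
      rw [hPT, hP0, smul_zero, smul_zero, sub_zero, zero_sub] at e2
      simp only [smul_add]
      rw [intervalIntegral.integral_add (hgi.continuousOn_smul hφ.continuousOn)
        ((hφ.fun_smul hPc).intervalIntegrable _ _), e, e2]
      ring)
  refine ⟨fun x => c - P x, ?_, ?_, ?_, ?_⟩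
  · intro x hx
    have hG : Continuous fun x => c - P x := by fun_prop
    have hd := ((hG.integral_hasStrictDerivAt 0 x).hasDerivAt.const_add (f 0)).hasDerivWithinAt
      (s := Icc 0 T)
    refine hd.congr_of_mem (fun y hy => ?_) hx
    rw [hf.isH1.eq_integral y hy]
    congr 1
    apply intervalIntegral.integral_congr_ae
    have hne : ∀ᵐ x : ℝ, x ≠ T := by simp [ae_iff]
    filter_upwards [hc, hne] with z hz hzT hzy
    rw [uIoc_of_le hy.1] at hzy
    rw [← hz ⟨hzy.1, lt_of_le_of_ne (hzy.2.trans hy.2) hzT⟩]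
    ring
  · intro x hx
    rw [← hNf x hx]
    exact ((hP x).const_sub c).hasDerivWithinAt
  · simp only [hPT, hP0]
  · filter_upwards [hc] with x hx hxT
    rw [← hx hxT]; ring

end CmKdV

namespace CmKdV

open Set MeasureTheory Filter Topology intervalIntegral

variable {T : ℝ} {f g h k : ℝ → ℂ}

/-! ### Positivity and constancy of the phase of minimisers -/

/-- `w` solves `w'' = -(2w² + λ) w` on `[0,T]` with periodic boundary conditions; `w'` is passed
as the function `v`. -/
structure IsPeriodicSol (T lam : ℝ) (w v : ℝ → ℝ) : Prop where
  hasDeriv : ∀ x ∈ Icc 0 T, HasDerivWithinAt w (v x) (Icc 0 T) x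
  hasDeriv₂ : ∀ x ∈ Icc 0 T, HasDerivWithinAt v (-((2 * w x ^ 2 + lam) * w x)) (Icc 0 T) x
  periodic : w T = w 0
  periodic₂ : v T = v 0

theorem IsPeriodicSol.continuousOn {lam : ℝ} {w v : ℝ → ℝ} (hw : IsPeriodicSol T lam w v) :
    ContinuousOn w (Icc 0 T) := fun x hx => (hw.hasDeriv x hx).continuousWithinAt

theorem IsPeriodicSol.continuousOn₂ {lam : ℝ} {w v : ℝ → ℝ} (hw : IsPeriodicSol T lam w v) :
    ContinuousOn v (Icc 0 T) := fun x hx => (hw.hasDeriv₂ x hx).continuousWithinAt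

/-- Gronwall uniqueness to the right for `u' = v`, `|v'| ≤ C |u|`. -/
theorem eq_zero_of_hasDerivWithinAt_right {a b C : ℝ} {u v v' : ℝ → ℝ}
    (hu : ∀ x ∈ Icc a b, HasDerivWithinAt u (v x) (Icc a b) x)
    (hv : ∀ x ∈ Icc a b, HasDerivWithinAt v (v' x) (Icc a b) x)
    (hC : ∀ x ∈ Icc a b, |v' x| ≤ C * |u x|) (h1 : u a = 0) (h2 : v a = 0) :
    ∀ x ∈ Icc a b, u x = 0 ∧ v x = 0 := by
  have key := eq_zero_of_abs_deriv_le_mul_abs_self_of_eq_zero_right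
    (f := fun x => (u x, v x)) (f' := fun x => (v x, v' x)) (K := max C 1) (a := a) (b := b)
    (fun x hx => (hu x hx).continuousWithinAt.prodMk (hv x hx).continuousWithinAt)
    (fun x hx => by
      have hx' : x ∈ Icc a b := Ico_subset_Icc_self hx
      have hmem : Icc a b ∈ 𝓝[Ici x] x := by
        rw [← nhdsWithin_Icc_eq_nhdsGE hx.2]
        exact mem_of_superset self_mem_nhdsWithin (Icc_subset_Icc_left hx.1)
      exact ((hu x hx').prodMk (hv x hx')).mono_of_mem_nhdsWithin hmem)
    (by simp [h1, h2])
    (fun x hx => by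
      have hx' : x ∈ Icc a b := Ico_subset_Icc_self hx
      simp only [Prod.norm_def, Real.norm_eq_abs]
      apply max_le
      · calc |v x| ≤ max |u x| |v x| := le_max_right _ _
          _ = 1 * max |u x| |v x| := (one_mul _).symm
          _ ≤ max C 1 * max |u x| |v x| := by gcongr; exact le_max_right _ _
      · refine (hC x hx').trans ?_
        exact mul_le_mul (le_max_left _ _) (le_max_left _ _) (abs_nonneg _)
          (zero_le_one.trans (le_max_right _ _)))
  intro x hx
  exact Prod.mk.inj (key x hx)

theorem eq_zero_of_hasDerivWithinAt {a b c C : ℝ} {u v v' : ℝ → ℝ}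
    (hu : ∀ x ∈ Icc a b, HasDerivWithinAt u (v x) (Icc a b) x)
    (hv : ∀ x ∈ Icc a b, HasDerivWithinAt v (v' x) (Icc a b) x)
    (hC : ∀ x ∈ Icc a b, |v' x| ≤ C * |u x|) (hc : c ∈ Icc a b) (h1 : u c = 0) (h2 : v c = 0) :
    ∀ x ∈ Icc a b, u x = 0 ∧ v x = 0 := by
  intro x hx
  rcases le_total c x with hcx | hcx
  · have hs : Icc c b ⊆ Icc a b := Icc_subset_Icc_left hc.1
    exact eq_zero_of_hasDerivWithinAt_right (fun y hy => (hu y (hs hy)).mono hs)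
      (fun y hy => (hv y (hs hy)).mono hs) (fun y hy => hC y (hs hy)) h1 h2 x ⟨hcx, hx.2⟩
  · have hm : MapsTo (fun y : ℝ => -y) (Icc (-c) (-a)) (Icc a b) := fun y hy =>
      ⟨by linarith [hy.2], by linarith [hy.1, hc.2]⟩
    have hneg : ∀ y, HasDerivWithinAt (fun y : ℝ => -y) (-1) (Icc (-c) (-a)) y := fun y =>
      (hasDerivAt_neg y).hasDerivWithinAt
    have := eq_zero_of_hasDerivWithinAt_right (a := -c) (b := -a) (C := C)
      (u := fun y => u (-y)) (v := fun y => -v (-y)) (v' := fun y => v' (-y))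
      (fun y hy => ((hu _ (hm hy)).scomp y (hneg y) hm).congr_deriv (by simp))
      (fun y hy => ((hv _ (hm hy)).scomp y (hneg y) hm).neg.congr_deriv (by simp))
      (fun y hy => hC _ (hm hy)) (by simpa using h1) (by simpa using h2) (-x)
      ⟨by linarith, by linarith [hx.1]⟩
    simpa using this

theorem IsPeriodicSol.eqOn {lam : ℝ} {w v w₂ v₂ : ℝ → ℝ} (hw : IsPeriodicSol T lam w v)
    (hd : ∀ x ∈ Icc 0 T, HasDerivWithinAt w₂ (v₂ x) (Icc 0 T) x)
    (hd₂ : ∀ x ∈ Icc 0 T, HasDerivWithinAt v₂ (-((2 * w₂ x ^ 2 + lam) * w₂ x)) (Icc 0 T) x)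
    {c : ℝ} (hc : c ∈ Icc 0 T) (h1 : w c = w₂ c) (h2 : v c = v₂ c) :
    ∀ x ∈ Icc 0 T, w x = w₂ x ∧ v x = v₂ x := by
  have hcont : ContinuousOn (fun x => 2 * (w x ^ 2 + w x * w₂ x + w₂ x ^ 2) + lam) (Icc 0 T) := by
    have h1 := hw.continuousOn
    have h2 : ContinuousOn w₂ (Icc 0 T) := fun x hx => (hd x hx).continuousWithinAt
    fun_prop
  obtain ⟨C, hC⟩ := isCompact_Icc.exists_bound_of_continuousOn hcont
  have := eq_zero_of_hasDerivWithinAt (C := C) (u := fun x => w x - w₂ x) (v := fun x => v x - v₂ x)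
    (fun x hx => (hw.hasDeriv x hx).sub (hd x hx))
    (fun x hx => (hw.hasDeriv₂ x hx).sub (hd₂ x hx))
    (fun x hx => by
      have e : -((2 * w x ^ 2 + lam) * w x) - -((2 * w₂ x ^ 2 + lam) * w₂ x) =
        -((2 * (w x ^ 2 + w x * w₂ x + w₂ x ^ 2) + lam) * (w x - w₂ x)) := by ring
      rw [e, abs_neg, abs_mul]
      exact mul_le_mul_of_nonneg_right (hC x hx) (abs_nonneg _)) hc
    (sub_eq_zero.2 h1) (sub_eq_zero.2 h2)
  exact fun x hx => ⟨sub_eq_zero.1 (this x hx).1, sub_eq_zero.1 (this x hx).2⟩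

/-- At a minimum on `[0,T]` of a `C¹` periodic function the derivative vanishes, also if the
minimum is attained at the end points. -/
theorem deriv_eq_zero_of_isMinOn (hT : 0 < T) {u v : ℝ → ℝ}
    (hu : ∀ x ∈ Icc 0 T, HasDerivWithinAt u (v x) (Icc 0 T) x) (hp : u T = u 0) (hp2 : v T = v 0)
    {c : ℝ} (hc : c ∈ Icc 0 T) (hmin : ∀ x ∈ Icc 0 T, u c ≤ u x) : v c = 0 := by
  have h0 : (0 : ℝ) ∈ Icc 0 T := ⟨le_rfl, hT.le⟩
  have h1 : T ∈ Icc 0 T := ⟨hT.le, le_rfl⟩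
  have hend : (∀ x ∈ Icc 0 T, u 0 ≤ u x) → v 0 = 0 := by
    intro hm
    have hnn : 0 ≤ v 0 := by
      have := (hasDerivWithinAt_iff_tendsto_slope.1 (hu 0 h0))
      have hne : (𝓝[Icc 0 T \ {0}] (0 : ℝ)).NeBot := by
        rw [Icc_sdiff_left]
        exact left_nhdsWithin_Ioc_neBot hT
      refine ge_of_tendsto this ?_
      filter_upwards [self_mem_nhdsWithin] with y hy
      rw [slope_def_field]
      exact div_nonneg (sub_nonneg.2 (hm y hy.1)) (sub_nonneg.2 hy.1.1)
    have hnp : v T ≤ 0 := by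
      have := (hasDerivWithinAt_iff_tendsto_slope.1 (hu T h1))
      have hne : (𝓝[Icc 0 T \ {T}] T).NeBot := by
        rw [Icc_sdiff_right]
        exact right_nhdsWithin_Ico_neBot hT
      refine le_of_tendsto this ?_
      filter_upwards [self_mem_nhdsWithin] with y hy
      rw [slope_def_field]
      exact div_nonpos_of_nonneg_of_nonpos (sub_nonneg.2 (hp ▸ hm y hy.1))
        (sub_nonpos.2 hy.1.2)
    linarith
  rcases hc.1.eq_or_lt with rfl | hc0
  · exact hend hmin
  rcases hc.2.eq_or_lt with rfl | hcT
  · rw [hp2]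
    exact hend fun x hx => hp ▸ hmin x hx
  · have hn := Icc_mem_nhds hc0 hcT
    have hloc : IsLocalMin u c := by
      filter_upwards [hn] with x hx using hmin x hx
    exact hloc.hasDerivAt_eq_zero ((hu c hc).hasDerivAt hn)

theorem deriv_eq_zero_of_isMaxOn (hT : 0 < T) {u v : ℝ → ℝ}
    (hu : ∀ x ∈ Icc 0 T, HasDerivWithinAt u (v x) (Icc 0 T) x) (hp : u T = u 0) (hp2 : v T = v 0)
    {c : ℝ} (hc : c ∈ Icc 0 T) (hmax : ∀ x ∈ Icc 0 T, u x ≤ u c) : v c = 0 := by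
  have := deriv_eq_zero_of_isMinOn hT (u := fun x => -u x) (v := fun x => -v x)
    (fun x hx => (hu x hx).neg) (by simp [hp]) (by simp [hp2]) hc (fun x hx => by
      simpa using hmax x hx)
  simpa using this

/-- The modulus of a `C¹` function is of class `H¹`, with the smaller Dirichlet integral. -/
theorem isH1_norm (hT : 0 < T) {G : ℝ → ℂ} (hG : ContinuousOn G (Icc 0 T))
    (hf : ∀ x ∈ Icc 0 T, HasDerivWithinAt f (G x) (Icc 0 T) x) (hp : f T = f 0) :
    ∃ v : ℝ → ℂ, IsH1 T (fun x => ((‖f x‖ : ℝ) : ℂ)) v ∧ sqNorm T v ≤ sqNorm T G := by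
  have h0 : (0 : ℝ) ∈ Icc 0 T := ⟨le_rfl, hT.le⟩
  have h1 : T ∈ Icc 0 T := ⟨hT.le, le_rfl⟩
  let w : ℝ → ℝ := fun x => ‖f x‖
  obtain ⟨C, hC⟩ := isCompact_Icc.exists_bound_of_continuousOn hG
  have hC0 : 0 ≤ C := (norm_nonneg _).trans (hC 0 h0)
  have hlip : ∀ x ∈ Icc 0 T, ∀ y ∈ Icc 0 T, |w y - w x| ≤ C * |y - x| := fun x hx y hy =>
    (abs_norm_sub_norm_le _ _).trans
      ((convex_Icc 0 T).norm_image_sub_le_of_norm_hasDerivWithin_le hf hC hx hy)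
  -- `‖f‖` need not be differentiable at zeros of `f`, but it is Lipschitz; its weak derivative is
  -- `deriv w`, with the junk value `0` where `w` is not differentiable
  have hac : ∀ x ∈ Icc 0 T, AbsolutelyContinuousOnInterval w 0 x := by
    intro x hx
    refine LipschitzOnWith.absolutelyContinuousOnInterval (K := ⟨C, hC0⟩) ?_
    refine LipschitzOnWith.of_dist_le_mul fun y hy z hz => ?_
    rw [uIcc_of_le hx.1] at hy hz
    rw [Real.dist_eq, Real.dist_eq]
    exact hlip z ⟨hz.1, hz.2.trans hx.2⟩ y ⟨hy.1, hy.2.trans hx.2⟩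
  have hder : ∀ x ∈ Ioo 0 T, |deriv w x| ≤ ‖G x‖ := by
    intro x hx
    by_cases hd : DifferentiableAt ℝ w x
    · have hfx := (hf x (Ioo_subset_Icc_self hx)).hasDerivAt (Icc_mem_nhds hx.1 hx.2)
      have t1 := (hasDerivAt_iff_tendsto_slope.1 hd.hasDerivAt).norm
      have t2 := (hasDerivAt_iff_tendsto_slope.1 hfx).norm
      refine le_of_tendsto_of_tendsto t1 t2 (Eventually.of_forall fun y => ?_)
      simp only [slope, vsub_eq_sub, norm_smul]
      gcongr
      exact abs_norm_sub_norm_le _ _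
    · rw [deriv_zero_of_not_differentiableAt hd]
      simp
  have hae : ∀ᵐ x ∂(volume.restrict (Ioc 0 T)), ‖((deriv w x : ℝ) : ℂ)‖ ≤ ‖G x‖ := by
    rw [ae_restrict_iff' measurableSet_Ioc]
    have hne : ∀ᵐ x : ℝ, x ≠ T := by simp [ae_iff]
    filter_upwards [hne] with x hx hxT
    rw [Complex.norm_real]
    exact hder x ⟨hxT.1, lt_of_le_of_ne hxT.2 hx⟩
  have hGm := memLp_of_continuousOn hG
  have hvm : MemLp (fun x => ((deriv w x : ℝ) : ℂ)) 2 (volume.restrict (Ioc 0 T)) :=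
    hGm.mono (Complex.measurable_ofReal.comp (measurable_deriv w)).aestronglyMeasurable hae
  refine ⟨fun x => ((deriv w x : ℝ) : ℂ), ⟨hvm, fun x hx => ?_, by simp [hp]⟩, ?_⟩
  · rw [intervalIntegral.integral_ofReal, (hac x hx).integral_deriv_eq_sub]
    push_cast
    ring
  · refine intervalIntegral.integral_mono_ae_restrict hT.le
      (intervalIntegrable_sq_of_memLp hT hvm h0 h1) (intervalIntegrable_sq_of_memLp hT hGm h0 h1) ?_
    have hne : ∀ᵐ x : ℝ, x ≠ T := by simp [ae_iff]
    have hne0 : ∀ᵐ x : ℝ, x ≠ 0 := by simp [ae_iff]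
    refine (ae_restrict_iff' measurableSet_Icc).2 ?_
    filter_upwards [hne, hne0] with x hx hx0 hxT
    have := hder x ⟨lt_of_le_of_ne hxT.1 (Ne.symm hx0), lt_of_le_of_ne hxT.2 hx⟩
    simp only [Complex.norm_real, Real.norm_eq_abs]
    gcongr

theorem sqNorm_congr_ae (hT : 0 < T) (hfg : ∀ᵐ x, x ∈ Ioo 0 T → f x = g x) :
    sqNorm T f = sqNorm T g := by
  apply intervalIntegral.integral_congr_ae
  have hne : ∀ᵐ x : ℝ, x ≠ T := by simp [ae_iff]
  filter_upwards [hfg, hne] with x hx hxT hx2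
  rw [uIoc_of_le hT.le] at hx2
  rw [hx ⟨hx2.1, lt_of_le_of_ne hx2.2 hxT⟩]

/-- A minimiser is a positive solution of the profile equation, which is itself a minimiser, times
a constant phase. -/
theorem IsMinimizer.exists_pos {m : ℝ} (hf : IsMinimizer T m f g) (hT : 0 < T) (hm : 0 < m) :
    ∃ (lam : ℝ) (w v : ℝ → ℝ) (z : ℂ), ‖z‖ = 1 ∧ IsPeriodicSol T lam w v ∧
      (∀ x ∈ Icc 0 T, 0 < w x) ∧ IsMinimizer T m (fun x => (w x : ℂ)) (fun x => (v x : ℂ)) ∧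
      (∀ x ∈ Icc 0 T, f x = z * w x) ∧ ∀ᵐ x, x ∈ Ioo 0 T → g x = z * v x := by
  have h0 : (0 : ℝ) ∈ Icc 0 T := ⟨le_rfl, hT.le⟩
  obtain ⟨G, hG1, hG2, hG3, hG4⟩ := hf.exists_ode hT hm
  have hGc : ContinuousOn G (Icc 0 T) := fun x hx => (hG2 x hx).continuousWithinAt
  have hfc := hf.isH1.continuousOn hT
  obtain ⟨v₀, hv₀, hv₀le⟩ := isH1_norm hT hGc hG1 hf.isH1.periodic
  have hsqG : sqNorm T g = sqNorm T G := sqNorm_congr_ae hT hG4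
  let w : ℝ → ℝ := fun x => ‖f x‖
  have hmw : sqNorm T (fun x => (w x : ℂ)) = m := by
    rw [← hf.mass]; simp [sqNorm, w]
  have hqw : quartic T (fun x => (w x : ℂ)) = quartic T f := by simp [quartic, w]
  -- the modulus has the mass and the quartic term of `f`, and no larger Dirichlet integral, so it
  -- is a minimiser too and the Dirichlet integrals are equal
  have hle := hf.lowerBound _ _ hv₀ hmw
  have hsq0 : sqNorm T v₀ = sqNorm T g := by
    change _ ≤ _ - quartic T (fun x => (w x : ℂ)) at hle
    rw [hqw] at hle
    linarith
  have hwmin : IsMinimizer T m (fun x => (w x : ℂ)) v₀ :=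
    ⟨hv₀, hmw, by rw [hsq0, hqw]; exact hf.lowerBound⟩
  obtain ⟨W, hW1, hW2, hW3, hW4⟩ := hwmin.exists_ode hT hm
  set lam := (sqNorm T v₀ - 2 * quartic T (fun x => (w x : ℂ))) / m
  let v : ℝ → ℝ := fun x => (W x).re
  have hre : ∀ {u : ℝ → ℂ} {u' : ℂ} {x : ℝ}, HasDerivWithinAt u u' (Icc 0 T) x →
      HasDerivWithinAt (fun x => (u x).re) u'.re (Icc 0 T) x := fun hu =>
    Complex.reCLM.hasFDerivAt.comp_hasDerivWithinAt _ hu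
  have hsol : IsPeriodicSol T lam w v := by
    refine ⟨fun x hx => by simpa using hre (hW1 x hx), fun x hx => ?_, ?_, ?_⟩
    · have := hre (hW2 x hx)
      refine this.congr_deriv ?_
      rw [← Complex.ofReal_mul, ← Complex.ofReal_neg, Complex.ofReal_re]
      simp
    · simp [w, hf.isH1.periodic]
    · simp [v, hW3]
  have hWv : ∀ x ∈ Icc 0 T, W x = v x := by
    intro x hx
    have hu : UniqueDiffWithinAt ℝ (Icc 0 T) x := uniqueDiffOn_Icc hT x hx
    have h1 : HasDerivWithinAt (fun x => (w x : ℂ)) ((v x : ℝ) : ℂ) (Icc 0 T) x :=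
      (hsol.hasDeriv x hx).ofReal_comp
    exact hu.eq_deriv _ (hW1 x hx) h1
  -- at a zero of the nonnegative function `w` its derivative vanishes as well, and `w ≡ 0` by
  -- uniqueness for the initial value problem
  have hwpos : ∀ x ∈ Icc 0 T, 0 < w x := by
    intro x hx
    by_contra hneg
    have hwx : w x = 0 := le_antisymm (not_lt.1 hneg) (norm_nonneg _)
    have hvx : v x = 0 := deriv_eq_zero_of_isMinOn hT hsol.hasDeriv hsol.periodic hsol.periodic₂ hx
      fun y _ => by rw [hwx]; exact norm_nonneg _
    have hz := hsol.eqOn (w₂ := fun _ => 0) (v₂ := fun _ => 0)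
      (fun x _ => hasDerivWithinAt_const _ _ _)
      (fun x _ => by simpa using hasDerivWithinAt_const x (Icc 0 T) (0 : ℝ)) hx hwx hvx
    have : sqNorm T (fun x => (w x : ℂ)) = 0 := by
      rw [sqNorm, integral_congr (g := fun _ => 0)]
      · simp
      · intro y hy
        rw [uIcc_of_le hT.le] at hy
        simp [(hz y hy).1]
    linarith
  have hvW : ∀ᵐ x, x ∈ Ioo 0 T → v₀ x = ((v x : ℝ) : ℂ) := by
    filter_upwards [hW4] with x hx hxT
    rw [hx hxT, hWv x (Ioo_subset_Icc_self hxT)]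
  have hsqv : sqNorm T (fun x => (v x : ℂ)) = sqNorm T v₀ := (sqNorm_congr_ae hT hvW).symm
  have hvc := hsol.continuousOn₂
  have hwmin' : IsMinimizer T m (fun x => (w x : ℂ)) (fun x => (v x : ℂ)) := by
    refine ⟨isH1_of_hasDerivWithinAt ?_ (fun x hx => (hsol.hasDeriv x hx).ofReal_comp) ?_, hmw, ?_⟩
    · exact Complex.continuous_ofReal.comp_continuousOn hvc
    · simp [hsol.periodic]
    · rw [hsqv]; exact hwmin.lowerBound
  -- the derivative of `‖f‖² = w²`
  have hinner : ∀ x ∈ Icc 0 T, inner ℝ (f x) (G x) = w x * v x := by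
    intro x hx
    have hu : UniqueDiffWithinAt ℝ (Icc 0 T) x := uniqueDiffOn_Icc hT x hx
    have h1 := (hG1 x hx).norm_sq
    have h2 := (hsol.hasDeriv x hx).fun_pow 2
    have := hu.eq_deriv _ h1 h2
    simp only [Nat.cast_ofNat, Nat.add_one_sub_one, pow_one] at this
    linarith
  have hnorm : ∀ x ∈ Icc 0 T, ‖G x * w x - f x * v x‖ ^ 2 =
      w x ^ 2 * (‖G x‖ ^ 2 - v x ^ 2) := by
    intro x hx
    have h1 := norm_sub_sq_real (G x * w x) (f x * v x)
    rw [h1, mul_comm (G x), mul_comm (f x), ← Complex.real_smul, ← Complex.real_smul,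
      inner_smul_left, inner_smul_right, real_inner_comm, hinner x hx, norm_smul, norm_smul,
      mul_pow, mul_pow, Real.norm_eq_abs, Real.norm_eq_abs, sq_abs, sq_abs]
    change _ + v x ^ 2 * w x ^ 2 = _
    simp only [conj_trivial]
    ring
  have hvG : ∀ x ∈ Icc 0 T, v x ^ 2 ≤ ‖G x‖ ^ 2 := by
    intro x hx
    have h1 := sq_nonneg ‖G x * w x - f x * v x‖
    rw [hnorm x hx] at h1
    have := pow_pos (hwpos x hx) 2
    by_contra hlt
    nlinarith
  -- equality of the Dirichlet integrals of `f` and of its modulus forces `|f'| = |w'|` pointwise,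
  -- which makes the derivative of `f / w` vanish
  have hzero : ∀ x ∈ Icc 0 T, ‖G x‖ ^ 2 - v x ^ 2 = 0 := by
    by_contra hne
    push Not at hne
    obtain ⟨x, hx, hxne⟩ := hne
    have hlt : ∫ x in (0 : ℝ)..T, v x ^ 2 < ∫ x in (0 : ℝ)..T, ‖G x‖ ^ 2 :=
      integral_lt_integral_of_continuousOn_of_le_of_exists_lt hT (hvc.pow 2) (hGc.norm.pow 2)
        (fun y hy => hvG y (Ioc_subset_Icc_self hy))
        ⟨x, hx, lt_of_le_of_ne (hvG x hx) fun h => hxne (by rw [h]; ring)⟩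
    have e1 : sqNorm T (fun x => (v x : ℂ)) = ∫ x in (0 : ℝ)..T, v x ^ 2 := by simp [sqNorm]
    rw [← e1, hsqv, hsq0, hsqG] at hlt
    exact lt_irrefl _ hlt
  have hcross : ∀ x ∈ Icc 0 T, G x * w x - f x * v x = 0 := by
    intro x hx
    have := hnorm x hx
    rw [hzero x hx, mul_zero] at this
    exact norm_eq_zero.1 (pow_eq_zero_iff two_ne_zero |>.1 this)
  have hquot : ∀ x ∈ Icc 0 T, f x / (w x : ℂ) = f 0 / (w 0 : ℂ) := by
    have hd : ∀ x ∈ Icc 0 T, HasDerivWithinAt (fun x => f x / (w x : ℂ)) 0 (Icc 0 T) x := by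
      intro x hx
      have hne : (w x : ℂ) ≠ 0 := Complex.ofReal_ne_zero.2 (hwpos x hx).ne'
      have := (hG1 x hx).div (hsol.hasDeriv x hx).ofReal_comp hne
      refine this.congr_deriv ?_
      rw [hcross x hx, zero_div]
    intro x hx
    exact constant_of_derivWithin_zero (fun y hy => (hd y hy).differentiableWithinAt)
      (fun y hy => (hd y (Ico_subset_Icc_self hy)).derivWithin
        (uniqueDiffOn_Icc hT y (Ico_subset_Icc_self hy))) x hx
  have hfz : ∀ x ∈ Icc 0 T, f x = f 0 / (w 0 : ℂ) * w x := by
    intro x hx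
    have hne : (w x : ℂ) ≠ 0 := Complex.ofReal_ne_zero.2 (hwpos x hx).ne'
    rw [← hquot x hx, div_mul_cancel₀ _ hne]
  refine ⟨lam, w, v, f 0 / (w 0 : ℂ), ?_, hsol, hwpos, hwmin', hfz, ?_⟩
  · rw [norm_div, Complex.norm_real, Real.norm_of_nonneg (norm_nonneg _)]
    exact div_self (hwpos 0 h0).ne'
  · filter_upwards [hG4] with x hx hxT
    have hxI := Ioo_subset_Icc_self hxT
    have hne : (w x : ℂ) ≠ 0 := Complex.ofReal_ne_zero.2 (hwpos x hxI).ne'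
    rw [hx hxT]
    apply mul_right_cancel₀ hne
    rw [sub_eq_zero.1 (hcross x hxI), hfz x hxI]
    ring

end CmKdV

namespace CmKdV

open Set MeasureTheory Filter Topology intervalIntegral

variable {T : ℝ}

/-! ### Reflection of a part of a minimiser -/

/-- The reflection of the interval `(a, b]` in its midpoint, extended by the identity. -/
noncomputable def reflectOn (a b x : ℝ) : ℝ := if x ∈ Ioc a b then a + b - x else x

theorem integral_comp_reflectOn {a b : ℝ} (ha : 0 ≤ a) (hab : a ≤ b) (hb : b ≤ T) {u : ℝ → ℝ}
    (hu : ContinuousOn u (Icc 0 T)) :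
    (∫ x in (0 : ℝ)..T, u (reflectOn a b x)) = ∫ x in (0 : ℝ)..T, u x ∧
      IntervalIntegrable (fun x => u (reflectOn a b x)) volume 0 T := by
  have hi : ∀ c ∈ Icc 0 T, ∀ d ∈ Icc 0 T, c ≤ d → IntervalIntegrable u volume c d := by
    intro c hc d hd hcd
    apply ContinuousOn.intervalIntegrable
    rw [uIcc_of_le hcd]
    exact hu.mono (Icc_subset_Icc hc.1 hd.2)
  have h0 : (0 : ℝ) ∈ Icc 0 T := ⟨le_rfl, by linarith⟩
  have h1 : T ∈ Icc 0 T := ⟨by linarith, le_rfl⟩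
  have ha' : a ∈ Icc 0 T := ⟨ha, by linarith⟩
  have hb' : b ∈ Icc 0 T := ⟨by linarith, hb⟩
  have e1 : EqOn u (fun x => u (reflectOn a b x)) (uIoc 0 a) := by
    intro x hx
    rw [uIoc_of_le ha] at hx
    simp only [reflectOn]
    rw [if_neg fun h => absurd h.1 (not_lt.2 hx.2)]
  have e2 : EqOn (fun x => u (a + b - x)) (fun x => u (reflectOn a b x)) (uIoc a b) := by
    intro x hx
    rw [uIoc_of_le hab] at hx
    simp only [reflectOn]
    rw [if_pos hx]
  have e3 : EqOn u (fun x => u (reflectOn a b x)) (uIoc b T) := by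
    intro x hx
    rw [uIoc_of_le hb] at hx
    simp only [reflectOn]
    rw [if_neg fun h => absurd h.2 (not_le.2 hx.1)]
  have i2 : IntervalIntegrable (fun x => u (a + b - x)) volume a b := by
    have := (hi a ha' b hb' hab).comp_sub_left (a + b)
    rw [add_sub_cancel_left, add_sub_cancel_right] at this
    exact this.symm
  have j1 := (hi 0 h0 a ha' ha).congr e1
  have j2 := i2.congr e2
  have j3 := (hi b hb' T h1 hb).congr e3
  refine ⟨?_, (j1.trans j2).trans j3⟩
  rw [← integral_add_adjacent_intervals (j1.trans j2) j3, ← integral_add_adjacent_intervals j1 j2,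
    ← integral_add_adjacent_intervals (hi 0 h0 b hb' (ha.trans hab)) (hi b hb' T h1 hb),
    ← integral_add_adjacent_intervals (hi 0 h0 a ha' ha) (hi a ha' b hb' hab)]
  congr 1
  · congr 1
    · exact (intervalIntegral.integral_congr_ae (Eventually.of_forall fun x hx => e1 hx)).symm
    · rw [← intervalIntegral.integral_congr_ae (Eventually.of_forall fun x hx => e2 hx), integral_comp_sub_left]
      simp
  · exact (intervalIntegral.integral_congr_ae (Eventually.of_forall fun x hx => e3 hx)).symm

/-- If a real minimiser takes the same value at two points that are different modulo `T`, then it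
has opposite slopes there: reflecting the graph between the two points yields another minimiser,
which must not have a kink. -/
theorem IsMinimizer.slope_eq_neg {m lam : ℝ} {w v : ℝ → ℝ} (hT : 0 < T) (hm : 0 < m)
    (hw : IsMinimizer T m (fun x => (w x : ℂ)) (fun x => (v x : ℂ)))
    (hsol : IsPeriodicSol T lam w v) {a b : ℝ} (ha : 0 ≤ a) (hab : a < b) (hb : b < T)
    (heq : w a = w b) : v b = -v a := by
  have hsub : Icc a b ⊆ Icc 0 T := Icc_subset_Icc ha hb.le
  have hsub3 : Icc b T ⊆ Icc 0 T := Icc_subset_Icc_left (ha.trans hab.le)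
  have hmaps : MapsTo (fun x => a + b - x) (Icc a b) (Icc a b) := fun x hx =>
    ⟨by linarith [hx.2], by linarith [hx.1]⟩
  -- the reflected function `q` and its derivative `p`, away from the corners at `a` and `b`
  let q : ℝ → ℝ := fun x => w (reflectOn a b x)
  let p : ℝ → ℝ := fun x => if x ∈ Ioc a b then -v (a + b - x) else v x
  have hq1 : EqOn q w (Icc 0 a) := fun x hx => by
    simp only [q, reflectOn]
    rw [if_neg fun h => absurd h.1 (not_lt.2 hx.2)]
  have hq2 : EqOn q (fun x => w (a + b - x)) (Icc a b) := fun x hx => by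
    simp only [q, reflectOn]
    split_ifs with h
    · rfl
    · have : x = a := by
        by_contra hne
        exact h ⟨lt_of_le_of_ne hx.1 (Ne.symm hne), hx.2⟩
      rw [this, add_sub_cancel_left, heq]
  have hq3 : EqOn q w (Icc b T) := fun x hx => by
    simp only [q, reflectOn]
    split_ifs with h
    · have : x = b := le_antisymm h.2 hx.1
      rw [this, add_sub_cancel_right, heq]
    · rfl
  have hd2 : ∀ x ∈ Icc a b, HasDerivWithinAt (fun x => w (a + b - x)) (-v (a + b - x))
      (Icc a b) x := by
    intro x hx
    have h1 : HasDerivWithinAt w (v (a + b - x)) (Icc a b) (a + b - x) :=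
      (hsol.hasDeriv _ (hsub (hmaps hx))).mono hsub
    have h2 : HasDerivWithinAt (fun x => a + b - x) (-1) (Icc a b) x := by
      simpa using ((hasDerivAt_id' x).const_sub (a + b)).hasDerivWithinAt
    exact (h1.scomp x h2 hmaps).congr_deriv (by simp)
  have hqc : ContinuousOn q (Icc 0 T) := by
    have c1 : ContinuousOn q (Icc 0 a) :=
      (hsol.continuousOn.mono (Icc_subset_Icc_right (hab.le.trans hb.le))).congr hq1
    have c2 : ContinuousOn q (Icc a b) :=
      ContinuousOn.congr (fun x hx => (hd2 x hx).continuousWithinAt) hq2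
    have c3 : ContinuousOn q (Icc b T) := (hsol.continuousOn.mono hsub3).congr hq3
    have := (c1.union_of_isClosed c2 isClosed_Icc isClosed_Icc).union_of_isClosed c3
      (isClosed_Icc.union isClosed_Icc) isClosed_Icc
    rwa [Icc_union_Icc_eq_Icc ha hab.le, Icc_union_Icc_eq_Icc (ha.trans hab.le) hb.le] at this
  have hqd : ∀ x ∈ Ioo 0 T \ {a, b}, HasDerivAt q (p x) x := by
    rintro x ⟨hx, hxab⟩
    simp only [mem_insert_iff, mem_singleton_iff, not_or] at hxab
    have hwx := (hsol.hasDeriv x (Ioo_subset_Icc_self hx)).hasDerivAt (Icc_mem_nhds hx.1 hx.2)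
    rcases lt_or_gt_of_ne hxab.1 with hlt | hgt
    · have : p x = v x := if_neg fun h => absurd h.1 (not_lt.2 hlt.le)
      rw [this]
      exact hwx.congr_of_eventuallyEq (hq1.eventuallyEq_of_mem (Icc_mem_nhds hx.1 hlt))
    rcases lt_or_gt_of_ne hxab.2 with hlt | hgt2
    · have : p x = -v (a + b - x) := if_pos ⟨hgt, hlt.le⟩
      rw [this]
      exact ((hd2 x ⟨hgt.le, hlt.le⟩).hasDerivAt (Icc_mem_nhds hgt hlt)).congr_of_eventuallyEq
        (hq2.eventuallyEq_of_mem (Icc_mem_nhds hgt hlt))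
    · have : p x = v x := if_neg fun h => absurd h.2 (not_le.2 hgt2)
      rw [this]
      exact hwx.congr_of_eventuallyEq (hq3.eventuallyEq_of_mem (Icc_mem_nhds hgt2 hx.2))
  have hvc := hsol.continuousOn₂
  have hpabs : ∀ x, p x ^ 2 = v (reflectOn a b x) ^ 2 := by
    intro x
    simp only [p, reflectOn]
    split_ifs <;> ring
  have hmeas : AEStronglyMeasurable p (volume.restrict (Ioc 0 T)) := by
    -- off a null set, `p` is the derivative of `q`
    have hfin : ∀ᵐ x : ℝ, x ∉ ({a, b, T} : Set ℝ) :=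
      measure_eq_zero_iff_ae_notMem.1 ((Set.toFinite {a, b, T}).measure_zero volume)
    refine ((measurable_deriv q).aestronglyMeasurable).congr ?_
    rw [EventuallyEq, ae_restrict_iff' measurableSet_Ioc]
    filter_upwards [hfin] with x hx hxT
    simp only [mem_insert_iff, mem_singleton_iff, not_or] at hx
    exact (hqd x ⟨⟨hxT.1, lt_of_le_of_ne hxT.2 hx.2.2⟩, by simp [hx.1, hx.2.1]⟩).deriv
  have hpm : MemLp (fun x => (p x : ℂ)) 2 (volume.restrict (Ioc 0 T)) := by
    rw [memLp_two_iff_integrable_sq_norm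
      (Complex.continuous_ofReal.comp_aestronglyMeasurable hmeas)]
    have := (integral_comp_reflectOn ha hab.le hb.le (hvc.pow 2)).2
    rw [intervalIntegrable_iff_integrableOn_Ioc_of_le hT.le] at this
    refine this.congr (Eventually.of_forall fun x => ?_)
    simp [hpabs]
  have hper : q T = q 0 := by
    rw [hq1 ⟨le_rfl, ha⟩, hq3 ⟨hb.le, le_rfl⟩, hsol.periodic]
  have hqp : IsH1 T (fun x => (q x : ℂ)) (fun x => (p x : ℂ)) := by
    refine ⟨hpm, fun x hx => ?_, by rw [hper]⟩
    have h0 : (0 : ℝ) ∈ Icc 0 T := ⟨le_rfl, hT.le⟩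
    rw [MeasureTheory.integral_eq_of_hasDerivAt_off_countable_of_le (fun x => (q x : ℂ))
      (fun x => (p x : ℂ)) hx.1 (s := {a, b}) (Set.toFinite _).countable]
    · ring
    · exact Complex.continuous_ofReal.comp_continuousOn (hqc.mono (Icc_subset_Icc_right hx.2))
    · rintro y ⟨hy, hyab⟩
      exact (hqd y ⟨⟨hy.1, hy.2.trans_le hx.2⟩, hyab⟩).ofReal_comp
    · exact intervalIntegrable_of_memLp hT hpm h0 hx
  have hqmin : IsMinimizer T m (fun x => (q x : ℂ)) (fun x => (p x : ℂ)) := by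
    refine ⟨hqp, ?_, ?_⟩
    · rw [← hw.mass]
      have := (integral_comp_reflectOn ha hab.le hb.le (hsol.continuousOn.pow 2)).1
      simpa [sqNorm, q] using this
    · have h1 : sqNorm T (fun x => (p x : ℂ)) = sqNorm T (fun x => (v x : ℂ)) := by
        have := (integral_comp_reflectOn ha hab.le hb.le (hvc.pow 2)).1
        simpa [sqNorm, hpabs] using this
      have h2 : quartic T (fun x => (q x : ℂ)) = quartic T (fun x => (w x : ℂ)) := by
        have := (integral_comp_reflectOn ha hab.le hb.le (hsol.continuousOn.norm.pow 4)).1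
        simpa [quartic, q] using this
      rw [h1, h2]
      exact hw.lowerBound
  -- `q` is a minimiser, hence of class `C¹`: its one-sided derivatives at `b` agree
  obtain ⟨Q, hQ, -, -, -⟩ := hqmin.exists_ode hT hm
  have hbT : b ∈ Icc 0 T := ⟨ha.trans hab.le, hb.le⟩
  have hleft : Q b = ((-v a : ℝ) : ℂ) := by
    have hu : UniqueDiffWithinAt ℝ (Icc a b) b := uniqueDiffOn_Icc hab b ⟨hab.le, le_rfl⟩
    refine hu.eq_deriv _ ((hQ b hbT).mono hsub) ?_
    have h1 := (hd2 b ⟨hab.le, le_rfl⟩).ofReal_comp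
    rw [add_sub_cancel_right] at h1
    exact h1.congr_of_mem (fun x hx => by simp only [hq2 hx]) ⟨hab.le, le_rfl⟩
  have hright : Q b = ((v b : ℝ) : ℂ) := by
    have hu : UniqueDiffWithinAt ℝ (Icc b T) b := uniqueDiffOn_Icc hb b ⟨le_rfl, hb.le⟩
    refine hu.eq_deriv _ ((hQ b hbT).mono hsub3) ?_
    have h1 := ((hsol.hasDeriv b hbT).mono hsub3).ofReal_comp
    exact h1.congr_of_mem (fun x hx => by simp only [hq3 hx]) ⟨le_rfl, hb.le⟩
  exact_mod_cast hright.symm.trans hleft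

/-! ### Identification of the minimisers -/

/-- The leading coefficient of a nonnegative polynomial without terms of order `0` and `1`. -/
theorem coeff_nonneg_of_forall_le {p₂ p₃ p₄ : ℝ}
    (h : ∀ ε : ℝ, 0 ≤ ε ^ 2 * p₂ + ε ^ 3 * p₃ + ε ^ 4 * p₄) : 0 ≤ p₂ := by
  have hlim : Tendsto (fun ε : ℝ => p₂ + ε * p₃ + ε ^ 2 * p₄) (𝓝[≠] 0) (𝓝 p₂) := by
    have hc : Continuous fun ε : ℝ => p₂ + ε * p₃ + ε ^ 2 * p₄ := by fun_prop
    have := hc.tendsto 0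
    simp only [zero_mul, add_zero, ne_eq, OfNat.ofNat_ne_zero, not_false_eq_true, zero_pow] at this
    exact this.mono_left nhdsWithin_le_nhds
  refine ge_of_tendsto hlim ?_
  filter_upwards [self_mem_nhdsWithin] with ε hε
  have h1 := h ε
  have h2 : 0 < ε ^ 2 := by
    have : ε ≠ 0 := hε
    positivity
  by_contra hneg
  have : ε ^ 2 * (p₂ + ε * p₃ + ε ^ 2 * p₄) < 0 := mul_neg_of_pos_of_neg h2 (not_le.1 hneg)
  nlinarith

theorem integral_cos_period (hT : 0 < T) :
    ∫ x in (0 : ℝ)..T, Real.cos (2 * Real.pi / T * x) = 0 := by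
  have h2 : 2 * Real.pi / T ≠ 0 := by positivity
  rw [integral_comp_mul_left (fun x => Real.cos x) h2, integral_cos]
  have : 2 * Real.pi / T * T = 2 * Real.pi := by field_simp
  simp [this]

theorem integral_cos_sq_period (hT : 0 < T) :
    ∫ x in (0 : ℝ)..T, Real.cos (2 * Real.pi / T * x) ^ 2 = T / 2 := by
  have h2 : 2 * Real.pi / T ≠ 0 := by positivity
  rw [integral_comp_mul_left (fun x => Real.cos x ^ 2) h2, integral_cos_sq]
  have : 2 * Real.pi / T * T = 2 * Real.pi := by field_simp
  rw [this]
  simp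
  field_simp

theorem integral_sin_sq_period (hT : 0 < T) :
    ∫ x in (0 : ℝ)..T, Real.sin (2 * Real.pi / T * x) ^ 2 = T / 2 := by
  have h2 : 2 * Real.pi / T ≠ 0 := by positivity
  rw [integral_comp_mul_left (fun x => Real.sin x ^ 2) h2, integral_sin_sq]
  have : 2 * Real.pi / T * T = 2 * Real.pi := by field_simp
  rw [this]
  simp
  field_simp

/-- A constant can only be a minimiser when its mass is at most `π² / T`: otherwise the variation
in the direction of `cos (2πx/T)` is negative. -/
theorem IsMinimizer.mass_le_of_const {m c : ℝ} {v : ℝ → ℝ} (hT : 0 < T) (hm : 0 < m)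
    (hf : IsMinimizer T m (fun _ => (c : ℂ)) (fun x => (v x : ℂ))) (hv : ∀ x ∈ Icc 0 T, v x = 0) :
    m ≤ Real.pi ^ 2 / T := by
  set κ := 2 * Real.pi / T with hκ
  have hκT : κ * T = 2 * Real.pi := by rw [hκ]; field_simp
  have hh : IsH1 T (fun x => ((Real.cos (κ * x) : ℝ) : ℂ))
      (fun x => ((-Real.sin (κ * x) * κ : ℝ) : ℂ)) := by
    refine isH1_of_hasDerivAt (by fun_prop) (fun x => ?_) (by simp [hκT])
    have := ((hasDerivAt_id' x).const_mul κ).cos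
    rw [mul_one] at this
    exact this.ofReal_comp
  have hvar := hf.variation_nonneg hT hm hh
  have hmc : m = c ^ 2 * T := by
    rw [← hf.mass]; simp [sqNorm]; ring
  have e1 : sqNorm T (fun x => (v x : ℂ)) = 0 := by
    rw [sqNorm, integral_congr (g := fun _ => 0)]
    · simp
    · intro y hy
      rw [uIcc_of_le hT.le] at hy
      simp [hv y hy]
  have e2 : quartic T (fun _ => (c : ℂ)) = c ^ 4 * T := by
    have : |c| ^ 4 = c ^ 4 := by rw [show 4 = 2 * 2 from rfl, pow_mul, sq_abs, pow_mul]
    simp [quartic, this]; ring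
  have e3 : ∫ x in (0 : ℝ)..T, inner ℝ ((v x : ℝ) : ℂ) ((-Real.sin (κ * x) * κ : ℝ) : ℂ) = 0 := by
    rw [integral_congr (g := fun _ => 0)]
    · simp
    · intro y hy
      rw [uIcc_of_le hT.le] at hy
      simp [hv y hy]
  have ein : ∀ x : ℝ, inner ℝ (c : ℂ) ((Real.cos (κ * x) : ℝ) : ℂ) = c * Real.cos (κ * x) := by
    intro x
    rw [Complex.inner]
    simp [-Complex.ofReal_cos]
    ring
  have e4 : sqNorm T (fun x => ((-Real.sin (κ * x) * κ : ℝ) : ℂ)) = κ ^ 2 * (T / 2) := by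
    rw [← integral_sin_sq_period hT, ← intervalIntegral.integral_const_mul, sqNorm]
    congr 1
    funext x
    rw [Complex.norm_real, Real.norm_eq_abs, sq_abs]
    ring
  have e5 : sqNorm T (fun x => ((Real.cos (κ * x) : ℝ) : ℂ)) = T / 2 := by
    rw [← integral_cos_sq_period hT, sqNorm]
    congr 1
    funext x
    rw [Complex.norm_real, Real.norm_eq_abs, sq_abs]
  have e6 : ∫ x in (0 : ℝ)..T, c * Real.cos (κ * x) = 0 := by
    rw [intervalIntegral.integral_const_mul, integral_cos_period hT, mul_zero]
  have e7 : ∫ x in (0 : ℝ)..T, ‖(c : ℂ)‖ ^ 2 * (c * Real.cos (κ * x)) = 0 := by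
    rw [intervalIntegral.integral_const_mul, e6, mul_zero]
  have e8 : ∫ x in (0 : ℝ)..T, (4 * (c * Real.cos (κ * x)) ^ 2 +
      2 * (‖(c : ℂ)‖ ^ 2 * ‖((Real.cos (κ * x) : ℝ) : ℂ)‖ ^ 2)) = 6 * c ^ 2 * (T / 2) := by
    rw [← integral_cos_sq_period hT, ← intervalIntegral.integral_const_mul]
    congr 1
    funext x
    rw [Complex.norm_real, Real.norm_eq_abs, sq_abs, Complex.norm_real, Real.norm_eq_abs, sq_abs]
    ring
  simp only [ein, e1, e2, e3, e4, e5, e6, e7, e8] at hvar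
  -- the terms of order `0` and `1` in `ε` cancel, since a constant is a critical point
  have h2 := coeff_nonneg_of_forall_le (p₂ := m ^ 2 * (κ ^ 2 * (T / 2) - 6 * c ^ 2 * (T / 2)) +
      c ^ 4 * T * (2 * m * (T / 2)))
    (p₃ := -m ^ 2 * (4 * ∫ x in (0 : ℝ)..T, c * Real.cos (κ * x) *
      ‖((Real.cos (κ * x) : ℝ) : ℂ)‖ ^ 2))
    (p₄ := m * (κ ^ 2 * (T / 2)) * (T / 2) - m ^ 2 * quartic T (fun x => ((Real.cos (κ * x) : ℝ) : ℂ))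
      + c ^ 4 * T * (T / 2) ^ 2) (fun ε => by
        refine (hvar ε).trans (le_of_eq ?_)
        ring)
  have hT2 : κ ^ 2 * T ^ 2 = 4 * Real.pi ^ 2 := by rw [← mul_pow, hκT]; ring
  have hc4 : c ^ 4 * T * (2 * m * (T / 2)) = m ^ 2 * (c ^ 2 * T) := by rw [hmc]; ring
  rw [hc4] at h2
  have h3 : 0 ≤ m ^ 2 * (κ ^ 2 * (T / 2) - 2 * c ^ 2 * T) := by
    refine h2.trans (le_of_eq ?_); ring
  have h4 := nonneg_of_mul_nonneg_right h3 (by positivity)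
  rw [le_div_iff₀ hT, hmc]
  have h5 := mul_nonneg h4 hT.le
  nlinarith

/-- The dnoidal profile `x ↦ A dn(A(x - y); k)`. -/
noncomputable def dnProfile (A k y x : ℝ) : ℝ := A * jacobiDn k (A * (x - y))

/-- The derivative of the dnoidal profile. -/
noncomputable def dnProfileDeriv (A k y x : ℝ) : ℝ := A ^ 2 * jacobiDnDeriv k (A * (x - y))

theorem hasDerivAt_dnProfile {A k y : ℝ} (hk : k ∈ Ioo (0 : ℝ) 1) (x : ℝ) :
    HasDerivAt (dnProfile A k y) (dnProfileDeriv A k y x) x := by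
  have h1 : HasDerivAt (fun x => A * (x - y)) A x := by
    simpa using ((hasDerivAt_id' x).sub_const y).const_mul A
  have := ((hasDerivAt_jacobiDn hk (A * (x - y))).scomp x h1).const_mul A
  refine this.congr_deriv ?_
  rw [dnProfileDeriv, smul_eq_mul]; ring

theorem hasDerivAt_dnProfileDeriv {A k y : ℝ} (hk : k ∈ Ioo (0 : ℝ) 1) (x : ℝ) :
    HasDerivAt (dnProfileDeriv A k y)
      (-((2 * dnProfile A k y x ^ 2 + (k ^ 2 - 2) * A ^ 2) * dnProfile A k y x)) x := by
  have h1 : HasDerivAt (fun x => A * (x - y)) A x := by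
    simpa using ((hasDerivAt_id' x).sub_const y).const_mul A
  have := ((hasDerivAt_jacobiDnDeriv hk (A * (x - y))).scomp x h1).const_mul (A ^ 2)
  refine this.congr_deriv ?_
  rw [dnProfile, smul_eq_mul]; ring

theorem continuous_dnProfileDeriv {A k y : ℝ} (hk : k ∈ Ioo (0 : ℝ) 1) :
    Continuous (dnProfileDeriv A k y) :=
  continuous_iff_continuousAt.2 fun x => (hasDerivAt_dnProfileDeriv hk x).continuousAt

theorem dnProfile_periodic {A k y : ℝ} (hA : 0 < A) (hk : k ∈ Ioo (0 : ℝ) 1) :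
    Function.Periodic (dnProfile A k y) (2 * ellipticK k / A) := by
  intro x
  have : A * (x + 2 * ellipticK k / A - y) = A * (x - y) + 2 * ellipticK k := by
    field_simp; ring
  rw [dnProfile, this, jacobiDn_periodic hk, dnProfile]

theorem dnProfileDeriv_periodic {A k y : ℝ} (hA : 0 < A) (hk : k ∈ Ioo (0 : ℝ) 1) :
    Function.Periodic (dnProfileDeriv A k y) (2 * ellipticK k / A) := by
  intro x
  have h1 := hasDerivAt_dnProfile (A := A) (y := y) hk x
  have h2 := (hasDerivAt_dnProfile (A := A) (y := y) hk (x + 2 * ellipticK k / A)).comp_add_const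
    x (2 * ellipticK k / A)
  have h3 : (fun x => dnProfile A k y (x + 2 * ellipticK k / A)) = dnProfile A k y :=
    funext (dnProfile_periodic hA hk)
  rw [h3] at h2
  exact h2.unique h1

theorem integral_dnProfile_sq {A k y : ℝ} (hA : 0 < A) (hk : k ∈ Ioo (0 : ℝ) 1) :
    ∫ x in (0 : ℝ)..(2 * ellipticK k / A), dnProfile A k y x ^ 2 = 2 * A * ellipticE k := by
  have h1 : ∀ x, dnProfile A k y x ^ 2 = A ^ 2 * jacobiDn k (A * x - A * y) ^ 2 := by
    intro x; rw [dnProfile, mul_sub]; ring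
  simp only [h1]
  have h2 := integral_comp_mul_sub (a := 0) (b := 2 * ellipticK k / A)
    (fun x => jacobiDn k x ^ 2) hA.ne' (A * y)
  rw [intervalIntegral.integral_const_mul, h2]
  have hp : Function.Periodic (fun x => jacobiDn k x ^ 2) (2 * ellipticK k) := fun x => by
    simp only [jacobiDn_periodic hk x]
  have h3 := hp.intervalIntegral_add_eq (A * 0 - A * y) 0
  have h4 : A * (2 * ellipticK k / A) - A * y = A * 0 - A * y + 2 * ellipticK k := by
    field_simp; ring
  rw [h4, h3, zero_add, integral_jacobiDn_sq hk, smul_eq_mul]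
  field_simp

/-- A nonconstant positive solution of the profile equation is dnoidal: amplitude and modulus are
read off from its maximum `A` and minimum `B`, by `k² = 1 - B² / A²`. -/
theorem IsPeriodicSol.exists_eq_dnProfile {lam : ℝ} {w v : ℝ → ℝ} (hT : 0 < T)
    (hw : IsPeriodicSol T lam w v) (hpos : ∀ x ∈ Icc 0 T, 0 < w x)
    (hne : ∃ x ∈ Icc 0 T, w x ≠ w 0) :
    ∃ A k, ∃ y ∈ Icc 0 T, 0 < A ∧ k ∈ Ioo (0 : ℝ) 1 ∧ lam = (k ^ 2 - 2) * A ^ 2 ∧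
      ∀ x ∈ Icc 0 T, w x = dnProfile A k y x ∧ v x = dnProfileDeriv A k y x := by
  have h0 : (0 : ℝ) ∈ Icc 0 T := ⟨le_rfl, hT.le⟩
  obtain ⟨xA, hxA, hmax⟩ := isCompact_Icc.exists_isMaxOn ⟨0, h0⟩ hw.continuousOn
  obtain ⟨xB, hxB, hmin⟩ := isCompact_Icc.exists_isMinOn ⟨0, h0⟩ hw.continuousOn
  have hvA : v xA = 0 := deriv_eq_zero_of_isMaxOn hT hw.hasDeriv hw.periodic hw.periodic₂ hxA hmax
  have hvB : v xB = 0 := deriv_eq_zero_of_isMinOn hT hw.hasDeriv hw.periodic hw.periodic₂ hxB hmin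
  have hA0 := hpos xA hxA
  have hB0 := hpos xB hxB
  have hBA : w xB < w xA := by
    obtain ⟨x, hx, hx0⟩ := hne
    have h1 : w x ≤ w xA := hmax hx
    have h2 : w xB ≤ w x := hmin hx
    have h3 : w 0 ≤ w xA := hmax h0
    have h4 : w xB ≤ w 0 := hmin h0
    rcases lt_or_gt_of_ne hx0 with h | h <;> linarith
  -- the first integral `w'² + w⁴ + λ w²`, evaluated at the maximum and at the minimum, gives
  -- `λ = -(A² + B²)`
  have hE : ∀ x ∈ Icc 0 T, v x ^ 2 + w x ^ 4 + lam * w x ^ 2 =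
      v 0 ^ 2 + w 0 ^ 4 + lam * w 0 ^ 2 := by
    have hd : ∀ x ∈ Icc 0 T, HasDerivWithinAt (fun x => v x ^ 2 + w x ^ 4 + lam * w x ^ 2) 0
        (Icc 0 T) x := by
      intro x hx
      have h1 := hw.hasDeriv x hx
      have h2 := hw.hasDeriv₂ x hx
      have := ((h2.fun_pow 2).add (h1.fun_pow 4)).add ((h1.fun_pow 2).const_mul lam)
      refine this.congr_deriv ?_
      norm_num
      ring
    intro x hx
    exact constant_of_derivWithin_zero (fun y hy => (hd y hy).differentiableWithinAt)
      (fun y hy => (hd y (Ico_subset_Icc_self hy)).derivWithin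
        (uniqueDiffOn_Icc hT y (Ico_subset_Icc_self hy))) x hx
  have hAB := (hE xA hxA).trans (hE xB hxB).symm
  rw [hvA, hvB] at hAB
  set A := w xA
  set B := w xB
  have hlam : lam = -(A ^ 2 + B ^ 2) := by
    have h1 : (A ^ 2 - B ^ 2) * (lam + (A ^ 2 + B ^ 2)) = 0 := by linear_combination hAB
    have h2 : A ^ 2 - B ^ 2 ≠ 0 := by
      have : B ^ 2 < A ^ 2 := by gcongr
      linarith
    linarith [(mul_eq_zero.1 h1).resolve_left h2]
  have hq : B ^ 2 / A ^ 2 < 1 := by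
    rw [div_lt_one (by positivity)]
    gcongr
  have hq0 : 0 < B ^ 2 / A ^ 2 := by positivity
  have hk2 : Real.sqrt (1 - B ^ 2 / A ^ 2) ^ 2 = 1 - B ^ 2 / A ^ 2 := Real.sq_sqrt (by linarith)
  set k := Real.sqrt (1 - B ^ 2 / A ^ 2) with hkdef
  have hk : k ∈ Ioo (0 : ℝ) 1 := by
    refine ⟨Real.sqrt_pos.2 (by linarith), ?_⟩
    rw [hkdef, Real.sqrt_lt' one_pos]
    linarith
  have hlk : lam = (k ^ 2 - 2) * A ^ 2 := by
    rw [hk2, hlam]; field_simp; ring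
  refine ⟨A, k, xA, hxA, hA0, hk, hlk, ?_⟩
  refine hw.eqOn (fun x _ => (hasDerivAt_dnProfile hk x).hasDerivWithinAt) (fun x _ => ?_) hxA ?_ ?_
  · rw [hlk]
    exact (hasDerivAt_dnProfileDeriv hk x).hasDerivWithinAt
  · simp [dnProfile, jacobiDn_zero hk, A]
  · simp [dnProfileDeriv, jacobiDnDeriv_zero hk, hvA]

/-- `T` is the minimal period of a dnoidal minimiser: for a smaller period `P`, the slopes at `x`
and `x + P` would have to be opposite. -/
theorem dnProfile_period_eq {m lam A k y : ℝ} {w v : ℝ → ℝ} (hT : 0 < T) (hm : 0 < m)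
    (hw : IsMinimizer T m (fun x => (w x : ℂ)) (fun x => (v x : ℂ)))
    (hsol : IsPeriodicSol T lam w v) (hne : ∃ x ∈ Icc 0 T, w x ≠ w 0) (hy : y ∈ Icc 0 T)
    (hA : 0 < A) (hk : k ∈ Ioo (0 : ℝ) 1) (hlam : lam = (k ^ 2 - 2) * A ^ 2)
    (hD : ∀ x ∈ Icc 0 T, w x = dnProfile A k y x ∧ v x = dnProfileDeriv A k y x) :
    T = 2 * ellipticK k / A := by
  have h0 : (0 : ℝ) ∈ Icc 0 T := ⟨le_rfl, hT.le⟩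
  have h1 : T ∈ Icc 0 T := ⟨hT.le, le_rfl⟩
  have hK := ellipticK_pos hk
  set P := 2 * ellipticK k / A with hP
  have hP0 : 0 < P := by positivity
  -- the translate by `T` solves the same initial value problem
  have htrans := hsol.eqOn (w₂ := fun x => dnProfile A k y (x + T))
    (v₂ := fun x => dnProfileDeriv A k y (x + T))
    (fun x _ => ((hasDerivAt_dnProfile hk (x + T)).comp_add_const x T).hasDerivWithinAt)
    (fun x _ => by
      rw [hlam]
      exact ((hasDerivAt_dnProfileDeriv hk (x + T)).comp_add_const x T).hasDerivWithinAt)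
    h0 (by rw [zero_add, ← (hD T h1).1, hsol.periodic]) (by
      rw [zero_add, ← (hD T h1).2, hsol.periodic₂])
  -- hence `dn(AT) = dn(0) = 1`, and `T` is a multiple of the period `P`
  have hone : jacobiDn k (A * T) = 1 := by
    have h2 := (hD y hy).1.symm.trans (htrans y hy).1
    simp only [dnProfile, sub_self, mul_zero, jacobiDn_zero hk, add_sub_cancel_left] at h2
    exact (mul_left_cancel₀ hA.ne' h2).symm
  obtain ⟨n, hn⟩ := (jacobiDn_eq_one_iff hk _).1 hone
  have hTn : T = n * P := by
    rw [hP]; field_simp; linarith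
  have hn0 : 0 < n := by
    by_contra hneg
    have : (n : ℝ) ≤ 0 := by exact_mod_cast not_lt.1 hneg
    nlinarith
  rcases (show n = 1 ∨ 2 ≤ n by omega) with rfl | hn2
  · simpa using hTn
  exfalso
  have hn2' : (2 : ℝ) ≤ n := by exact_mod_cast hn2
  have hPT : 2 * P ≤ T := by rw [hTn]; gcongr
  -- the slopes at `x` and at `x + P < T` are both equal and opposite
  have hzero : ∀ x ∈ Ico 0 P, dnProfileDeriv A k y x = 0 := by
    intro x hx
    have hxT : x ∈ Icc 0 T := ⟨hx.1, by linarith [hx.2]⟩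
    have hxPT : x + P ∈ Icc 0 T := ⟨by linarith [hx.1], by linarith [hx.2]⟩
    have hs := hw.slope_eq_neg hT hm hsol hx.1 (b := x + P) (by linarith) (by linarith [hx.2])
      (by rw [(hD x hxT).1, (hD _ hxPT).1, hP, dnProfile_periodic hA hk])
    rw [(hD x hxT).2, (hD _ hxPT).2, hP, dnProfileDeriv_periodic hA hk] at hs
    linarith
  have hzero' : ∀ x, dnProfileDeriv A k y x = 0 := by
    intro x
    obtain ⟨x', hx', hxx⟩ := (dnProfileDeriv_periodic (y := y) hA hk).exists_mem_Ico₀ hP0 x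
    rw [hxx, hzero x' hx']
  obtain ⟨x, hx, hx0⟩ := hne
  apply hx0
  rw [(hD x hx).1, (hD 0 h0).1]
  exact is_const_of_deriv_eq_zero (fun z => (hasDerivAt_dnProfile hk z).differentiableAt)
    (fun z => by rw [(hasDerivAt_dnProfile hk z).deriv, hzero' z]) x 0

/-- The minimisers with the mass `4 E(k) K(k) / T` of the dnoidal profile of modulus `k` and minimal
period `T` are exactly its translates, up to a constant phase. -/
theorem IsMinimizer.eq_dnProfile {f g : ℝ → ℂ} {k : ℝ} (hT : 0 < T) (hk : k ∈ Ioo (0 : ℝ) 1)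
    (hf : IsMinimizer T (4 * (ellipticE k * ellipticK k) / T) f g) :
    ∃ (z : ℂ) (y : ℝ), ‖z‖ = 1 ∧
      (∀ x ∈ Icc 0 T, f x = z * dnProfile (2 * ellipticK k / T) k y x) ∧
      ∀ᵐ x, x ∈ Ioo 0 T → g x = z * dnProfileDeriv (2 * ellipticK k / T) k y x := by
  have hEK := sq_pi_div_four_lt hk
  have hpi := Real.pi_pos
  have hm : 0 < 4 * (ellipticE k * ellipticK k) / T := by
    have : 0 < ellipticE k * ellipticK k := lt_trans (by positivity) hEK
    positivity
  obtain ⟨lam, w, v, z, hz, hsol, hpos, hmin, hfw, hgv⟩ := hf.exists_pos hT hm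
  by_cases hne : ∃ x ∈ Icc 0 T, w x ≠ w 0
  · obtain ⟨A, l, y, hy, hA, hl, hlam, hD⟩ := hsol.exists_eq_dnProfile hT hpos hne
    have hper := dnProfile_period_eq hT hm hmin hsol hne hy hA hl hlam hD
    have hKl := ellipticK_pos hl
    have hAT : A = 2 * ellipticK l / T := by rw [hper]; field_simp
    -- the mass determines the modulus, `E K` being strictly increasing
    have hmass : 4 * (ellipticE k * ellipticK k) / T = 4 * (ellipticE l * ellipticK l) / T := by
      have h1 : sqNorm T (fun x => (w x : ℂ)) = 2 * A * ellipticE l := by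
        rw [← integral_dnProfile_sq (y := y) hA hl, ← hper, sqNorm]
        apply integral_congr
        intro x hx
        rw [uIcc_of_le hT.le] at hx
        simp [(hD x hx).1]
      rw [← hmin.mass, h1, hAT]
      ring
    have hkl : k = l := eq_of_ellipticE_mul_ellipticK_eq hk hl (by
      field_simp at hmass
      linarith)
    subst hkl
    rw [← hAT]
    refine ⟨z, y, hz, fun x hx => by rw [hfw x hx, (hD x hx).1], ?_⟩
    filter_upwards [hgv] with x hx hxT
    rw [hx hxT, (hD x (Ioo_subset_Icc_self hxT)).2]
  · exfalso
    push Not at hne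
    have hv0 : ∀ x ∈ Icc 0 T, v x = 0 := by
      intro x hx
      have hu : UniqueDiffWithinAt ℝ (Icc 0 T) x := uniqueDiffOn_Icc hT x hx
      exact hu.eq_deriv _ (hsol.hasDeriv x hx)
        ((hasDerivWithinAt_const x (Icc 0 T) (w 0)).congr_of_mem hne hx)
    have hconst : IsMinimizer T (4 * (ellipticE k * ellipticK k) / T) (fun _ => ((w 0 : ℝ) : ℂ))
        (fun x => (v x : ℂ)) := by
      have he : EqOn (fun x => ((w x : ℝ) : ℂ)) (fun _ => ((w 0 : ℝ) : ℂ)) (Icc 0 T) :=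
        fun x hx => by simp only [hne x hx]
      have he' : EqOn (fun x => ((w x : ℝ) : ℂ)) (fun _ => ((w 0 : ℝ) : ℂ)) (uIcc 0 T) := by
        rwa [uIcc_of_le hT.le]
      have e1 : sqNorm T (fun x => ((w x : ℝ) : ℂ)) = sqNorm T (fun _ => ((w 0 : ℝ) : ℂ)) :=
        integral_congr fun x hx => by simp only [he' hx]
      have e2 : quartic T (fun x => ((w x : ℝ) : ℂ)) = quartic T (fun _ => ((w 0 : ℝ) : ℂ)) :=
        integral_congr fun x hx => by simp only [he' hx]
      exact ⟨hmin.isH1.congr he hT, e1 ▸ hmin.mass, e2 ▸ hmin.lowerBound⟩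
    -- a constant minimiser has mass at most `π² / T`, but `4 E K > π²`
    have hle := hconst.mass_le_of_const hT hm hv0
    have : 4 * (ellipticE k * ellipticK k) ≤ Real.pi ^ 2 := by
      rwa [div_le_div_iff_of_pos_right hT] at hle
    linarith

/-- At fixed mass the energy attains its infimum. -/
theorem exists_isMinimizer {m : ℝ} (hT : 0 < T) (hm : 0 < m) : ∃ f g, IsMinimizer T m f g := by
  let S : Set ℝ := {e | ∃ f g : ℝ → ℂ, IsH1 T f g ∧ sqNorm T f = m ∧ e = sqNorm T g - quartic T f}
  have hne : S.Nonempty := by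
    refine ⟨_, fun _ => ((Real.sqrt (m / T) : ℝ) : ℂ), fun _ => 0, ?_, ?_, rfl⟩
    · exact isH1_of_hasDerivAt continuousOn_const (fun x => hasDerivAt_const _ _) rfl
    · have : Real.sqrt (m / T) ^ 2 = m / T := Real.sq_sqrt (by positivity)
      simp [sqNorm, this]
      field_simp
  have hbdd : BddBelow S := by
    refine ⟨-(2 / min T (1 / (4 * m)) * m ^ 2), ?_⟩
    rintro _ ⟨f, g, hfg, hfm, rfl⟩
    have h1 := quartic_le_half hT hfg hm hfm.le
    have h2 := sqNorm_nonneg hT g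
    linarith
  have hlb : IsEnergyLowerBound T m (sInf S) := fun f g hfg hfm =>
    csInf_le hbdd ⟨f, g, hfg, hfm, rfl⟩
  obtain ⟨e, -, het, heS⟩ := exists_seq_tendsto_sInf hne hbdd
  choose f g hfg hfm hfe using heS
  obtain ⟨F, G, hFG, hF, hE, -⟩ := hlb.exists_subseq_tendsto hT hm hfg
    (by simp only [hfm]; exact tendsto_const_nhds) (by simp only [← hfe]; exact het)
  exact ⟨F, G, hFG, hF, hE ▸ hlb⟩

end CmKdV

namespace CmKdV

open Set MeasureTheory Filter Topology intervalIntegral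

variable {T : ℝ}

/-! ### Stability of the set of minimisers -/

theorem integral_comp_dnProfile {A k y : ℝ} (hA : 0 < A) (hk : k ∈ Ioo (0 : ℝ) 1)
    (hT : T = 2 * ellipticK k / A) (F : ℝ → ℝ) :
    ∫ x in (0 : ℝ)..T, F (dnProfile A k y x) = ∫ x in (0 : ℝ)..T, F (dnProfile A k 0 x) := by
  have h1 : ∀ x, dnProfile A k y x = dnProfile A k 0 (x - y) := fun x => by simp [dnProfile]
  simp only [h1]
  rw [integral_comp_sub_right (fun x => F (dnProfile A k 0 x)) y]
  have hp : Function.Periodic (fun x => F (dnProfile A k 0 x)) T := fun x => by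
    simp only [hT, dnProfile_periodic hA hk x]
  have := hp.intervalIntegral_add_eq (0 - y) 0
  rwa [zero_add, show 0 - y + T = T - y by ring] at this

theorem integral_comp_dnProfileDeriv {A k y : ℝ} (hA : 0 < A) (hk : k ∈ Ioo (0 : ℝ) 1)
    (hT : T = 2 * ellipticK k / A) (F : ℝ → ℝ) :
    ∫ x in (0 : ℝ)..T, F (dnProfileDeriv A k y x) =
      ∫ x in (0 : ℝ)..T, F (dnProfileDeriv A k 0 x) := by
  have h1 : ∀ x, dnProfileDeriv A k y x = dnProfileDeriv A k 0 (x - y) := fun x => by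
    simp [dnProfileDeriv]
  simp only [h1]
  rw [integral_comp_sub_right (fun x => F (dnProfileDeriv A k 0 x)) y]
  have hp : Function.Periodic (fun x => F (dnProfileDeriv A k 0 x)) T := fun x => by
    simp only [hT, dnProfileDeriv_periodic hA hk x]
  have := hp.intervalIntegral_add_eq (0 - y) 0
  rwa [zero_add, show 0 - y + T = T - y by ring] at this

theorem norm_dnProfile_le {A k y x : ℝ} (hA : 0 < A) : |dnProfile A k y x| ≤ A := by
  rw [dnProfile, abs_mul, abs_of_pos hA]
  have h : |jacobiDn k (A * (x - y))| ≤ 1 := by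
    rw [jacobiDn, abs_of_nonneg (Real.sqrt_nonneg _)]
    exact Real.sqrt_le_one.2 (by nlinarith [sq_nonneg (k * Real.sin (jacobiAm k (A * (x - y))))])
  nlinarith

/-- The dnoidal profile of amplitude `A`, centred at `y`, with the phase `z`. -/
noncomputable def phaseProfile (A k : ℝ) (z : ℂ) (y x : ℝ) : ℂ := z * (dnProfile A k y x : ℝ)

/-- The derivative of `phaseProfile`. -/
noncomputable def phaseProfileDeriv (A k : ℝ) (z : ℂ) (y x : ℝ) : ℂ :=
  z * (dnProfileDeriv A k y x : ℝ)

theorem hasDerivAt_phaseProfile {A k : ℝ} (hk : k ∈ Ioo (0 : ℝ) 1) (z : ℂ) (y x : ℝ) :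
    HasDerivAt (phaseProfile A k z y) (phaseProfileDeriv A k z y x) x :=
  (hasDerivAt_dnProfile hk x).ofReal_comp.const_mul z

theorem continuous_phaseProfileDeriv {A k : ℝ} (hk : k ∈ Ioo (0 : ℝ) 1) (z : ℂ) (y : ℝ) :
    Continuous (phaseProfileDeriv A k z y) :=
  continuous_const.mul (Complex.continuous_ofReal.comp (continuous_dnProfileDeriv hk))

theorem isH1_phaseProfile {A k : ℝ} (hA : 0 < A) (hk : k ∈ Ioo (0 : ℝ) 1)
    (hT : T = 2 * ellipticK k / A) (z : ℂ) (y : ℝ) :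
    IsH1 T (phaseProfile A k z y) (phaseProfileDeriv A k z y) :=
  isH1_of_hasDerivAt (continuous_phaseProfileDeriv hk z y).continuousOn
    (hasDerivAt_phaseProfile hk z y) (by
      have := dnProfile_periodic (y := y) hA hk 0
      rw [zero_add, ← hT] at this
      rw [phaseProfile, phaseProfile, this])

theorem sqNorm_phaseProfile {A k : ℝ} (hA : 0 < A) (hk : k ∈ Ioo (0 : ℝ) 1)
    (hT : T = 2 * ellipticK k / A) {z : ℂ} (hz : ‖z‖ = 1) (y : ℝ) :
    sqNorm T (phaseProfile A k z y) = 4 * (ellipticE k * ellipticK k) / T := by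
  have h := integral_dnProfile_sq (y := y) hA hk
  rw [← hT] at h
  have h1 : ∀ x, ‖phaseProfile A k z y x‖ ^ 2 = dnProfile A k y x ^ 2 := fun x => by
    rw [phaseProfile, norm_mul, hz, one_mul, Complex.norm_real, Real.norm_eq_abs, sq_abs]
  have hK := ellipticK_pos hk
  simp only [sqNorm, h1]
  rw [h, hT]
  field_simp
  ring

theorem sqNorm_phaseProfileDeriv {A k : ℝ} (hA : 0 < A) (hk : k ∈ Ioo (0 : ℝ) 1)
    (hT : T = 2 * ellipticK k / A) {z : ℂ} (hz : ‖z‖ = 1) (y : ℝ) :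
    sqNorm T (phaseProfileDeriv A k z y) = sqNorm T (phaseProfileDeriv A k 1 0) := by
  simp only [sqNorm, phaseProfileDeriv, norm_mul, hz, one_mul, Complex.norm_real]
  exact integral_comp_dnProfileDeriv hA hk hT (fun r => ‖r‖ ^ 2)

theorem quartic_phaseProfile {A k : ℝ} (hA : 0 < A) (hk : k ∈ Ioo (0 : ℝ) 1)
    (hT : T = 2 * ellipticK k / A) {z : ℂ} (hz : ‖z‖ = 1) (y : ℝ) :
    quartic T (phaseProfile A k z y) = quartic T (phaseProfile A k 1 0) := by
  simp only [quartic, phaseProfile, norm_mul, hz, one_mul, Complex.norm_real]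
  exact integral_comp_dnProfile hA hk hT (fun r => ‖r‖ ^ 4)

/-- The dnoidal profile minimises the energy at its mass. -/
theorem isEnergyLowerBound_phaseProfile {A k : ℝ} (hA : 0 < A) (hk : k ∈ Ioo (0 : ℝ) 1)
    (hT : T = 2 * ellipticK k / A) :
    IsEnergyLowerBound T (4 * (ellipticE k * ellipticK k) / T)
      (sqNorm T (phaseProfileDeriv A k 1 0) - quartic T (phaseProfile A k 1 0)) := by
  have hK := ellipticK_pos hk
  have hT0 : 0 < T := by rw [hT]; positivity
  have hEK := sq_pi_div_four_lt hk
  have hm : 0 < 4 * (ellipticE k * ellipticK k) / T := by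
    have : 0 < ellipticE k * ellipticK k := lt_trans (by positivity) hEK
    positivity
  obtain ⟨f, g, hfg⟩ := exists_isMinimizer hT0 hm
  obtain ⟨z, y, hz, hf, hg⟩ := hfg.eq_dnProfile hT0 hk
  have hAT : 2 * ellipticK k / T = A := by rw [hT]; field_simp
  rw [hAT] at hf hg
  have e1 : sqNorm T g = sqNorm T (phaseProfileDeriv A k 1 0) := by
    rw [← sqNorm_phaseProfileDeriv hA hk hT hz y]
    exact sqNorm_congr_ae hT0 hg
  have e2 : quartic T f = quartic T (phaseProfile A k 1 0) := by
    rw [← quartic_phaseProfile hA hk hT hz y]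
    apply integral_congr
    intro x hx
    rw [uIcc_of_le hT0.le] at hx
    simp only [hf x hx, phaseProfile]
  rw [← e1, ← e2]
  exact hfg.lowerBound

theorem abs_sqrt_sqNorm_sub_le (hT : 0 < T) {f g : ℝ → ℂ}
    (hf : MemLp f 2 (volume.restrict (Ioc 0 T))) (hg : MemLp g 2 (volume.restrict (Ioc 0 T))) :
    |Real.sqrt (sqNorm T f) - Real.sqrt (sqNorm T g)| ≤
      Real.sqrt (sqNorm T (fun x => f x - g x)) := by
  have e : sqNorm T (fun x => f x - g x) = ‖hf.toLp f - hg.toLp g‖ ^ 2 := by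
    rw [← MemLp.toLp_sub hf hg, ← sqNorm_eq_norm_toLp hT]
    rfl
  rw [sqNorm_eq_norm_toLp hT hf, sqNorm_eq_norm_toLp hT hg, e, Real.sqrt_sq (norm_nonneg _),
    Real.sqrt_sq (norm_nonneg _), Real.sqrt_sq (norm_nonneg _)]
  exact abs_norm_sub_norm_le _ _

theorem tendsto_sqNorm_of_tendsto_sub (hT : 0 < T) {f q : ℕ → ℝ → ℂ} {m : ℝ}
    (hf : ∀ n, MemLp (f n) 2 (volume.restrict (Ioc 0 T)))
    (hq : ∀ n, MemLp (q n) 2 (volume.restrict (Ioc 0 T))) (hm : ∀ n, sqNorm T (q n) = m)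
    (h : Tendsto (fun n => sqNorm T (fun x => f n x - q n x)) atTop (𝓝 0)) :
    Tendsto (fun n => sqNorm T (f n)) atTop (𝓝 m) := by
  have h1 : Tendsto (fun n => Real.sqrt (sqNorm T (f n))) atTop (𝓝 (Real.sqrt m)) := by
    rw [tendsto_iff_norm_sub_tendsto_zero]
    refine squeeze_zero (fun n => norm_nonneg _) (fun n => ?_) (by simpa using h.sqrt)
    have := abs_sqrt_sqNorm_sub_le hT (hf n) (hq n)
    rwa [hm n] at this
  have h2 := h1.pow 2
  have hm0 : 0 ≤ m := hm 0 ▸ sqNorm_nonneg hT _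
  rw [Real.sq_sqrt hm0] at h2
  exact h2.congr fun n => Real.sq_sqrt (sqNorm_nonneg hT _)

theorem tendsto_quartic_of_tendsto_sub (hT : 0 < T) {f f' q q' : ℕ → ℝ → ℂ} {b R : ℝ}
    (hf : ∀ n, IsH1 T (f n) (f' n)) (hq : ∀ n, IsH1 T (q n) (q' n))
    (hb : ∀ n, quartic T (q n) = b) (hR : ∀ n, ∀ x ∈ Icc 0 T, ‖q n x‖ ≤ R)
    (h0 : Tendsto (fun n => sqNorm T (fun x => f n x - q n x)) atTop (𝓝 0))
    (h1 : Tendsto (fun n => sqNorm T (fun x => f' n x - q' n x)) atTop (𝓝 0)) :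
    Tendsto (fun n => quartic T (f n)) atTop (𝓝 b) := by
  let η : ℕ → ℝ := fun n => Real.sqrt (2 / T * sqNorm T (fun x => f n x - q n x) +
    2 * T * sqNorm T (fun x => f' n x - q' n x))
  have hη : Tendsto η atTop (𝓝 0) := by
    have := ((h0.const_mul (2 / T)).add (h1.const_mul (2 * T))).sqrt
    simpa using this
  have hη0 : ∀ n, 0 ≤ η n := fun n => Real.sqrt_nonneg _
  have hR0 : 0 ≤ R := (norm_nonneg _).trans (hR 0 0 ⟨le_rfl, hT.le⟩)
  have hbd : ∀ n, ∀ x ∈ Icc 0 T, ‖f n x - q n x‖ ≤ η n := fun n x hx =>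
    Real.le_sqrt_of_sq_le (((hf n).sub hT (hq n)).norm_sq_le hT hT le_rfl hx)
  rw [tendsto_iff_norm_sub_tendsto_zero]
  refine squeeze_zero (fun n => norm_nonneg _)
    (g := fun n => η n * (2 * R + η n) * ((R + η n) ^ 2 + R ^ 2) * |T - 0|) (fun n => ?_) ?_
  · have i : ∀ {u u' : ℝ → ℂ}, IsH1 T u u' → IntervalIntegrable (fun x => ‖u x‖ ^ 4) volume 0 T := by
      intro u u' hu
      apply ContinuousOn.intervalIntegrable
      rw [uIcc_of_le hT.le]
      exact (hu.continuousOn hT).norm.pow 4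
    rw [← hb n, quartic, quartic, ← intervalIntegral.integral_sub (i (hf n)) (i (hq n))]
    refine intervalIntegral.norm_integral_le_of_norm_le_const fun x hx => ?_
    rw [uIoc_of_le hT.le] at hx
    have hx' := Ioc_subset_Icc_self hx
    have a1 := hbd n x hx'
    have a2 := hR n x hx'
    have a3 : ‖f n x‖ ≤ R + η n := by
      have := norm_le_norm_add_norm_sub' (f n x) (q n x)
      linarith
    have a4 : |‖f n x‖ - ‖q n x‖| ≤ η n := (abs_norm_sub_norm_le _ _).trans a1
    have e : ‖f n x‖ ^ 4 - ‖q n x‖ ^ 4 = (‖f n x‖ - ‖q n x‖) * (‖f n x‖ + ‖q n x‖) *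
      (‖f n x‖ ^ 2 + ‖q n x‖ ^ 2) := by ring
    rw [e, Real.norm_eq_abs, abs_mul, abs_mul, abs_of_nonneg (a := ‖f n x‖ + ‖q n x‖) (by positivity),
      abs_of_nonneg (a := ‖f n x‖ ^ 2 + ‖q n x‖ ^ 2) (by positivity)]
    have := hη0 n
    have a5 : ‖f n x‖ + ‖q n x‖ ≤ 2 * R + η n := by linarith
    gcongr
  · have := ((hη.mul (hη.const_add (2 * R))).mul (((hη.const_add R).pow 2).add_const (R ^ 2))).mul_const
      |T - 0|
    simpa using this

/-- Stability of the set of dnoidal profiles, in terms of the conserved quantities alone: a function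
with the mass and the energy of a function close to a dnoidal profile is close to one. -/
theorem exists_phaseProfile_near {A k : ℝ} (hA : 0 < A) (hk : k ∈ Ioo (0 : ℝ) 1)
    (hT : T = 2 * ellipticK k / A) {ε : ℝ} (hε : 0 < ε) :
    ∃ δ : ℝ, 0 < δ ∧ ∀ f₀ g₀ f g : ℝ → ℂ, IsH1 T f₀ g₀ → IsH1 T f g →
      sqNorm T f = sqNorm T f₀ →
      sqNorm T g - quartic T f = sqNorm T g₀ - quartic T f₀ →
      (∃ (z : ℂ) (y : ℝ), ‖z‖ = 1 ∧ sqNorm T (fun x => f₀ x - phaseProfile A k z y x) < δ ∧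
        sqNorm T (fun x => g₀ x - phaseProfileDeriv A k z y x) < δ) →
      ∃ (z : ℂ) (y : ℝ), ‖z‖ = 1 ∧ sqNorm T (fun x => f x - phaseProfile A k z y x) < ε ∧
        sqNorm T (fun x => g x - phaseProfileDeriv A k z y x) < ε := by
  have hK := ellipticK_pos hk
  have hT0 : 0 < T := by rw [hT]; positivity
  have hEK := sq_pi_div_four_lt hk
  have hm : 0 < 4 * (ellipticE k * ellipticK k) / T := by
    have : 0 < ellipticE k * ellipticK k := lt_trans (by positivity) hEK
    positivity
  have hlb := isEnergyLowerBound_phaseProfile hA hk hT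
  -- otherwise there are initial functions `f₀ n` converging to the set of profiles, and functions
  -- `f n` with the same conserved quantities that stay away from it; the `f n` form a minimising
  -- sequence, and the limit of a subsequence is a profile
  by_contra hcon
  push Not at hcon
  choose f₀ g₀ f g hfg₀ hfg hmass hen hnear hfar using fun n : ℕ =>
    hcon (1 / ((n : ℝ) + 1)) (by positivity)
  choose z y hz hd₀ hd₁ using hnear
  have hlim : ∀ {e : ℕ → ℝ}, (∀ n, 0 ≤ e n) → (∀ n, e n < 1 / ((n : ℝ) + 1)) →
      Tendsto e atTop (𝓝 0) := fun h1 h2 =>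
    squeeze_zero h1 (fun n => (h2 n).le) tendsto_one_div_add_atTop_nhds_zero_nat
  have hl₀ := hlim (fun n => sqNorm_nonneg hT0 _) hd₀
  have hl₁ := hlim (fun n => sqNorm_nonneg hT0 _) hd₁
  have hq : ∀ n, IsH1 T (phaseProfile A k (z n) (y n)) (phaseProfileDeriv A k (z n) (y n)) :=
    fun n => isH1_phaseProfile hA hk hT _ _
  have t1 := tendsto_sqNorm_of_tendsto_sub hT0
    (fun n => memLp_of_continuousOn ((hfg₀ n).continuousOn hT0))
    (fun n => memLp_of_continuousOn ((hq n).continuousOn hT0))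
    (fun n => sqNorm_phaseProfile hA hk hT (hz n) (y n)) hl₀
  have t2 := tendsto_sqNorm_of_tendsto_sub hT0 (fun n => (hfg₀ n).memLp) (fun n => (hq n).memLp)
    (fun n => sqNorm_phaseProfileDeriv hA hk hT (hz n) (y n)) hl₁
  have t3 := tendsto_quartic_of_tendsto_sub hT0 (R := A) hfg₀ hq
    (fun n => quartic_phaseProfile hA hk hT (hz n) (y n)) (fun n x _ => by
      rw [phaseProfile, norm_mul, hz n, one_mul, Complex.norm_real]
      exact norm_dnProfile_le hA) hl₀ hl₁
  obtain ⟨F, G, hFG, hFm, hFe, φ, -, hφ₀, hφ₁⟩ := hlb.exists_subseq_tendsto hT0 hm hfg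
    (by simp only [hmass]; exact t1) (by simp only [hen]; exact t2.sub t3)
  have hmin : IsMinimizer T (4 * (ellipticE k * ellipticK k) / T) F G :=
    ⟨hFG, hFm, hFe ▸ hlb⟩
  obtain ⟨z', y', hz', hF, hG⟩ := hmin.eq_dnProfile hT0 hk
  have hAT : 2 * ellipticK k / T = A := by rw [hT]; field_simp
  rw [hAT] at hF hG
  obtain ⟨n, hn₀, hn₁⟩ := (((tendsto_order.1 hφ₀).2 ε hε).and ((tendsto_order.1 hφ₁).2 ε hε)).exists
  refine absurd (hfar (φ n) z' y' hz' ?_) (not_le.2 ?_)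
  · refine lt_of_eq_of_lt (sqNorm_congr_ae hT0 (Eventually.of_forall fun x hx => ?_)) hn₀
    rw [hF x (Ioo_subset_Icc_self hx), phaseProfile]
  · refine lt_of_eq_of_lt (sqNorm_congr_ae hT0 ?_) hn₁
    filter_upwards [hG] with x hx hxT
    rw [hx hxT, phaseProfileDeriv]

/-! ### The travelling wave and its orbit -/

/-- The energy `∫ |f' - iωf|² - |f|⁴`, which is the energy `∫ |v'|² - |v|⁴` of `v = e^{-iωx} f`. -/
noncomputable def twistedEnergy (T ω : ℝ) (f : ℝ → ℂ) : ℝ :=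
  sqNorm T (fun x => deriv f x - Complex.I * ω * f x) - quartic T f

theorem sqNorm_le_add (hT : 0 < T) {f g h : ℝ → ℂ} (hf : Continuous f) (hg : Continuous g)
    (hh : Continuous h) {c : ℝ} (hfgh : ∀ x, ‖f x‖ ^ 2 ≤ c * ‖g x‖ ^ 2 + 2 * ‖h x‖ ^ 2) :
    sqNorm T f ≤ c * sqNorm T g + 2 * sqNorm T h := by
  have i1 : IntervalIntegrable (fun x => c * ‖g x‖ ^ 2) volume 0 T :=
    Continuous.intervalIntegrable (by fun_prop) _ _
  have i2 : IntervalIntegrable (fun x => 2 * ‖h x‖ ^ 2) volume 0 T :=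
    Continuous.intervalIntegrable (by fun_prop) _ _
  rw [sqNorm, sqNorm, sqNorm, ← intervalIntegral.integral_const_mul,
    ← intervalIntegral.integral_const_mul, ← intervalIntegral.integral_add i1 i2]
  exact integral_mono hT.le (Continuous.intervalIntegrable (by fun_prop) _ _) (i1.add i2) hfgh

/-- The `H¹` norm of `e^{iωx} h` is equivalent to that of `h`. -/
theorem normH1_sq_bounds (hT : 0 < T) (ω : ℝ) {h h' : ℝ → ℂ} (hh : ∀ x, HasDerivAt h (h' x) x)
    (hc : Continuous h') :
    sqNorm T h ≤ normH1 T (fun x => Complex.exp (Complex.I * ω * x) * h x) ^ 2 ∧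
    sqNorm T h' ≤ (2 * ω ^ 2 + 2) * normH1 T (fun x => Complex.exp (Complex.I * ω * x) * h x) ^ 2 ∧
    normH1 T (fun x => Complex.exp (Complex.I * ω * x) * h x) ^ 2 ≤
      (1 + 2 * ω ^ 2) * sqNorm T h + 2 * sqNorm T h' := by
  have hhc : Continuous h := continuous_iff_continuousAt.2 fun x => (hh x).continuousAt
  have hne : ∀ x : ℝ, ‖Complex.exp (Complex.I * ω * x)‖ = 1 := by
    intro x
    rw [show Complex.I * ω * x = ((ω * x : ℝ) : ℂ) * Complex.I by push_cast; ring]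
    exact Complex.norm_exp_ofReal_mul_I _
  let q : ℝ → ℂ := fun x => h' x + Complex.I * ω * h x
  have hqc : Continuous q := by fun_prop
  have hd : ∀ x, deriv (fun x : ℝ => Complex.exp (Complex.I * ω * x) * h x) x =
      Complex.exp (Complex.I * ω * x) * q x := by
    intro x
    have h1 : HasDerivAt (fun x : ℝ => Complex.I * ω * (x : ℂ)) (Complex.I * ω) x := by
      simpa using (Complex.ofRealCLM.hasDerivAt (x := x)).const_mul (Complex.I * ω)
    rw [(h1.cexp.fun_mul (hh x)).deriv]
    simp only [q]
    ring
  have hN : normH1 T (fun x => Complex.exp (Complex.I * ω * x) * h x) ^ 2 =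
      sqNorm T h + sqNorm T q := by
    rw [normH1, Real.sq_sqrt (integral_nonneg hT.le fun x _ => by positivity), sqNorm, sqNorm,
      ← intervalIntegral.integral_add (Continuous.intervalIntegrable (by fun_prop) _ _)
        (Continuous.intervalIntegrable (by fun_prop) _ _)]
    simp only [hd, norm_mul, hne, one_mul]
  have hI : ‖Complex.I * (ω : ℂ)‖ ^ 2 = ω ^ 2 := by
    rw [norm_mul, Complex.norm_I, one_mul, Complex.norm_real, Real.norm_eq_abs, sq_abs]
  have par : ∀ a b : ℂ, ‖a + b‖ ^ 2 ≤ 2 * ‖a‖ ^ 2 + 2 * ‖b‖ ^ 2 := by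
    intro a b
    have := norm_add_le a b
    have : ‖a + b‖ ^ 2 ≤ (‖a‖ + ‖b‖) ^ 2 := by gcongr
    nlinarith [sq_nonneg (‖a‖ - ‖b‖)]
  have b1 : sqNorm T h' ≤ 2 * ω ^ 2 * sqNorm T h + 2 * sqNorm T q := by
    refine sqNorm_le_add hT hc hhc hqc fun x => ?_
    have := par (-(Complex.I * ω * h x)) (q x)
    rw [show -(Complex.I * ω * h x) + q x = h' x by simp only [q]; ring, norm_neg, norm_mul,
      mul_pow, hI] at this
    linarith
  have b2 : sqNorm T q ≤ 2 * ω ^ 2 * sqNorm T h + 2 * sqNorm T h' := by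
    refine sqNorm_le_add hT hqc hhc hc fun x => ?_
    have := par (Complex.I * ω * h x) (h' x)
    rw [show Complex.I * ω * h x + h' x = q x by simp only [q]; ring, norm_mul,
      mul_pow, hI] at this
    linarith
  have n0 := sqNorm_nonneg hT h
  have n1 := sqNorm_nonneg hT q
  rw [hN]
  refine ⟨by linarith, ?_, by linarith⟩
  nlinarith [mul_nonneg (sq_nonneg ω) n1]

theorem exp_mul_travellingWave {a ω σ r₀ k y₀ : ℝ} (t η ξ x : ℝ) :
    Complex.exp (Complex.I * ω * η) *
      travellingWave a ω (fun y => σ * r₀ * jacobiDn k (r₀ * (y - y₀))) t (x - ξ) =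
    Complex.exp (Complex.I * ω * x) * phaseProfile r₀ k
      (σ * Complex.exp (((ω * (η - ξ + (3 * a + ω ^ 2) * t) : ℝ) : ℂ) * Complex.I))
      (y₀ + ξ - (a + 3 * ω ^ 2) * t) x := by
  have e1 : Complex.exp (Complex.I * ω * η) *
      Complex.exp (Complex.I * ((ω * (x - ξ + (3 * a + ω ^ 2) * t) : ℝ) : ℂ)) =
      Complex.exp (Complex.I * ω * x) *
        Complex.exp (((ω * (η - ξ + (3 * a + ω ^ 2) * t) : ℝ) : ℂ) * Complex.I) := by
    rw [← Complex.exp_add, ← Complex.exp_add]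
    congr 1
    push_cast
    ring
  have e2 : x - ξ + (a + 3 * ω ^ 2) * t - y₀ = x - (y₀ + ξ - (a + 3 * ω ^ 2) * t) := by ring
  rw [travellingWave, phaseProfile, dnProfile, e2, ← mul_assoc, e1]
  push_cast
  ring

/-- The orbit of the travelling wave, at every time, consists of the functions
`e^{iωx} z r₀ dn(r₀(x - y); k)` with `|z| = 1` and real `y`. -/
theorem exists_exp_mul_travellingWave {a ω σ r₀ k y₀ : ℝ} (hω : ω ≠ 0) (hσ : σ = 1 ∨ σ = -1)
    (t : ℝ) {z : ℂ} (hz : ‖z‖ = 1) (y : ℝ) :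
    ∃ p : ℝ × ℝ, ∀ x, Complex.exp (Complex.I * ω * p.1) *
      travellingWave a ω (fun y => σ * r₀ * jacobiDn k (r₀ * (y - y₀))) t (x - p.2) =
    Complex.exp (Complex.I * ω * x) * phaseProfile r₀ k z y x := by
  have hσ2 : (σ : ℂ) * σ = 1 := by
    rcases hσ with rfl | rfl <;> simp
  have hσn : ‖(σ : ℂ) * z‖ = 1 := by
    rcases hσ with rfl | rfl <;> simp [hz]
  obtain ⟨θ, hθ⟩ := (Complex.norm_eq_one_iff _).1 hσn
  refine ⟨(θ / ω + (y - y₀ + (a + 3 * ω ^ 2) * t) - (3 * a + ω ^ 2) * t,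
    y - y₀ + (a + 3 * ω ^ 2) * t), fun x => ?_⟩
  rw [exp_mul_travellingWave]
  have e1 : ω * (θ / ω + (y - y₀ + (a + 3 * ω ^ 2) * t) - (3 * a + ω ^ 2) * t -
      (y - y₀ + (a + 3 * ω ^ 2) * t) + (3 * a + ω ^ 2) * t) = θ := by
    field_simp; ring
  simp only [e1]
  rw [hθ, ← mul_assoc, hσ2, one_mul, show y₀ + (y - y₀ + (a + 3 * ω ^ 2) * t) -
    (a + 3 * ω ^ 2) * t = y by ring]

theorem normH1_nonneg (T : ℝ) (f : ℝ → ℂ) : 0 ≤ normH1 T f := Real.sqrt_nonneg _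

theorem exp_mul_period {ω : ℝ} (hωT : ∃ m : ℤ, ω * T / (2 * Real.pi) = (m : ℝ)) :
    Complex.exp (-(Complex.I * ω * T)) = 1 := by
  obtain ⟨m, hm⟩ := hωT
  rw [Complex.exp_eq_one_iff]
  refine ⟨-m, ?_⟩
  have h1 : ω * T = m * (2 * Real.pi) := by
    rw [div_eq_iff (by positivity)] at hm; exact hm
  have h2 : (ω : ℂ) * T = m * (2 * Real.pi) := by exact_mod_cast h1
  push_cast
  linear_combination (-Complex.I) * h2

/-- The gauge transformed function `e^{-iωx} f` and its derivative. -/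
theorem isH1_gauge {ω : ℝ} (hωT : ∃ m : ℤ, ω * T / (2 * Real.pi) = (m : ℝ))
    {f : ℝ → ℂ} (hf : ContDiff ℝ 1 f) (hp : Function.Periodic f T) :
    (∀ x : ℝ, HasDerivAt (fun x : ℝ => Complex.exp (-(Complex.I * ω * x)) * f x)
      (Complex.exp (-(Complex.I * ω * x)) * (deriv f x - Complex.I * ω * f x)) x) ∧
    Continuous (fun x : ℝ => Complex.exp (-(Complex.I * ω * x)) *
      (deriv f x - Complex.I * ω * f x)) ∧
    IsH1 T (fun x => Complex.exp (-(Complex.I * ω * x)) * f x)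
      (fun x => Complex.exp (-(Complex.I * ω * x)) * (deriv f x - Complex.I * ω * f x)) := by
  have hfc : Continuous f := hf.continuous
  have hdc : Continuous (deriv f) := hf.continuous_deriv le_rfl
  have hd : ∀ x : ℝ, HasDerivAt (fun x : ℝ => Complex.exp (-(Complex.I * ω * x)) * f x)
      (Complex.exp (-(Complex.I * ω * x)) * (deriv f x - Complex.I * ω * f x)) x := by
    intro x
    have h1 : HasDerivAt (fun x : ℝ => -(Complex.I * ω * (x : ℂ))) (-(Complex.I * ω)) x := by
      simpa using ((Complex.ofRealCLM.hasDerivAt (x := x)).const_mul (Complex.I * ω)).fun_neg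
    have h2 := (hf.differentiable one_ne_zero x).hasDerivAt
    refine (h1.cexp.fun_mul h2).congr_deriv ?_
    ring
  have hc : Continuous (fun x : ℝ => Complex.exp (-(Complex.I * ω * x)) *
      (deriv f x - Complex.I * ω * f x)) := by fun_prop
  refine ⟨hd, hc, isH1_of_hasDerivAt hc.continuousOn hd ?_⟩
  have h0 := hp 0
  rw [zero_add] at h0
  simp [exp_mul_period hωT, h0]

theorem norm_exp_neg_I_mul (ω x : ℝ) : ‖Complex.exp (-(Complex.I * ω * x))‖ = 1 := by
  rw [show -(Complex.I * ω * x) = ((-(ω * x) : ℝ) : ℂ) * Complex.I by push_cast; ring]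
  exact Complex.norm_exp_ofReal_mul_I _

theorem sqNorm_gauge (ω : ℝ) (f : ℝ → ℂ) :
    sqNorm T (fun x => Complex.exp (-(Complex.I * ω * x)) * f x) = sqNorm T f := by
  simp only [sqNorm, norm_mul, norm_exp_neg_I_mul, one_mul]

theorem quartic_gauge (ω : ℝ) (f : ℝ → ℂ) :
    quartic T (fun x => Complex.exp (-(Complex.I * ω * x)) * f x) = quartic T f := by
  simp only [quartic, norm_mul, norm_exp_neg_I_mul, one_mul]

/-- Comparison of the distance to the orbit with the `H¹` distance of the gauge transformed
functions. -/
theorem sub_eq_exp_mul_gauge (ω : ℝ) (f q : ℝ → ℂ) (x : ℝ) :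
    f x - Complex.exp (Complex.I * ω * x) * q x =
      Complex.exp (Complex.I * ω * x) * (Complex.exp (-(Complex.I * ω * x)) * f x - q x) := by
  rw [mul_sub, ← mul_assoc, ← Complex.exp_add, add_neg_cancel, Complex.exp_zero, one_mul]

/-- Orbital stability, in terms of conserved quantities: a function with the mass and the twisted
energy of a function close to the orbit is close to the orbit. -/
theorem exists_orbitDist_lt {a ω r₀ k : ℝ} (hω : ω ≠ 0)
    (hωT : ∃ m : ℤ, ω * T / (2 * Real.pi) = (m : ℝ)) (hP : IsDnoidalParam a T r₀ k) {σ : ℝ}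
    (hσ : σ = 1 ∨ σ = -1) (y₀ : ℝ) {ε : ℝ} (hε : 0 < ε) :
    ∃ δ : ℝ, 0 < δ ∧ ∀ f₀ f : ℝ → ℂ, ContDiff ℝ 1 f₀ → ContDiff ℝ 1 f →
      Function.Periodic f₀ T → Function.Periodic f T → sqNorm T f = sqNorm T f₀ →
      twistedEnergy T ω f = twistedEnergy T ω f₀ → ∀ t₀ t : ℝ,
      orbitDist T ω f₀
        (travellingWave a ω (fun y => σ * r₀ * jacobiDn k (r₀ * (y - y₀))) t₀) < δ →
      orbitDist T ω f
        (travellingWave a ω (fun y => σ * r₀ * jacobiDn k (r₀ * (y - y₀))) t) < ε := by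
  have hk : k ∈ Ioo (0 : ℝ) 1 := ⟨hP.modulus_pos, hP.modulus_lt_one⟩
  have hA := hP.amplitude_pos
  have hK := ellipticK_pos hk
  have hT0 : 0 < T := by rw [hP.period]; positivity
  have hc : 0 < 2 * ω ^ 2 + 4 := by positivity
  obtain ⟨d, hd, hstab⟩ := exists_phaseProfile_near hA hk hP.period
    (ε := ε ^ 2 / (2 * ω ^ 2 + 4)) (by positivity)
  refine ⟨Real.sqrt (d / (2 * ω ^ 2 + 4)), by positivity, ?_⟩
  intro f₀ f hf₀ hf hp₀ hp hmass hen t₀ t hdist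
  obtain ⟨p, hp'⟩ := exists_lt_of_ciInf_lt hdist
  obtain ⟨D₀, C₀, H₀⟩ := isH1_gauge hωT hf₀ hp₀
  obtain ⟨D, C, H⟩ := isH1_gauge hωT hf hp
  have hnear : ∃ (z : ℂ) (y : ℝ), ‖z‖ = 1 ∧
      sqNorm T (fun x => Complex.exp (-(Complex.I * ω * x)) * f₀ x - phaseProfile r₀ k z y x) < d ∧
      sqNorm T (fun x => Complex.exp (-(Complex.I * ω * x)) * (deriv f₀ x - Complex.I * ω * f₀ x) -
        phaseProfileDeriv r₀ k z y x) < d := by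
    refine ⟨σ * Complex.exp (((ω * (p.1 - p.2 + (3 * a + ω ^ 2) * t₀) : ℝ) : ℂ) * Complex.I),
      y₀ + p.2 - (a + 3 * ω ^ 2) * t₀, ?_, ?_⟩
    rotate_left 1
    · simp only [exp_mul_travellingWave, sub_eq_exp_mul_gauge] at hp'
      obtain ⟨b0, b1, -⟩ := normH1_sq_bounds hT0 ω
        (fun x => (D₀ x).fun_sub (hasDerivAt_phaseProfile (A := r₀) hk
          (σ * Complex.exp (((ω * (p.1 - p.2 + (3 * a + ω ^ 2) * t₀) : ℝ) : ℂ) * Complex.I))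
          (y₀ + p.2 - (a + 3 * ω ^ 2) * t₀) x))
        (C₀.sub (continuous_phaseProfileDeriv hk _ _))
      have hsq : normH1 T (fun x => Complex.exp (Complex.I * ω * x) *
          (Complex.exp (-(Complex.I * ω * x)) * f₀ x - phaseProfile r₀ k
          (σ * Complex.exp (((ω * (p.1 - p.2 + (3 * a + ω ^ 2) * t₀) : ℝ) : ℂ) * Complex.I))
          (y₀ + p.2 - (a + 3 * ω ^ 2) * t₀) x)) ^ 2 < d / (2 * ω ^ 2 + 4) := by
        have := pow_lt_pow_left₀ hp' (normH1_nonneg _ _) two_ne_zero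
        rwa [Real.sq_sqrt (by positivity)] at this
      rw [lt_div_iff₀ hc] at hsq
      have hn := sq_nonneg (normH1 T (fun x => Complex.exp (Complex.I * ω * x) *
          (Complex.exp (-(Complex.I * ω * x)) * f₀ x - phaseProfile r₀ k
          (σ * Complex.exp (((ω * (p.1 - p.2 + (3 * a + ω ^ 2) * t₀) : ℝ) : ℂ) * Complex.I))
          (y₀ + p.2 - (a + 3 * ω ^ 2) * t₀) x)))
      constructor
      · nlinarith [mul_nonneg hn (sq_nonneg ω)]
      · nlinarith [mul_nonneg hn (sq_nonneg ω)]
    · rw [norm_mul, Complex.norm_exp_ofReal_mul_I]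
      rcases hσ with rfl | rfl <;> simp
  obtain ⟨z, y, hz, h0, h1⟩ := hstab _ _ _ _ H₀ H (by rw [sqNorm_gauge, sqNorm_gauge, hmass]) (by
    simp only [twistedEnergy] at hen
    rw [sqNorm_gauge, sqNorm_gauge, quartic_gauge, quartic_gauge]
    exact hen) hnear
  obtain ⟨p₁, hp₁⟩ := exists_exp_mul_travellingWave (a := a) (r₀ := r₀) (k := k) (y₀ := y₀)
    hω hσ t hz y
  refine (ciInf_le ⟨0, by rintro _ ⟨p, rfl⟩; exact normH1_nonneg _ _⟩ p₁).trans_lt ?_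
  simp only [hp₁, sub_eq_exp_mul_gauge]
  obtain ⟨-, -, b2⟩ := normH1_sq_bounds hT0 ω
    (fun x => (D x).fun_sub (hasDerivAt_phaseProfile (A := r₀) hk z y x))
    (C.sub (continuous_phaseProfileDeriv hk _ _))
  refine lt_of_pow_lt_pow_left₀ 2 hε.le (b2.trans_lt ?_)
  rw [lt_div_iff₀ hc] at h0 h1
  have n0 := sqNorm_nonneg hT0
    (fun x => Complex.exp (-(Complex.I * ω * x)) * f x - phaseProfile r₀ k z y x)
  have n1 := sqNorm_nonneg hT0 (fun x => Complex.exp (-(Complex.I * ω * x)) *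
    (deriv f x - Complex.I * ω * f x) - phaseProfileDeriv r₀ k z y x)
  nlinarith [mul_nonneg n0 (sq_nonneg ω), mul_nonneg n1 (sq_nonneg ω)]

/-- The mass is a combination of twisted energies. -/
theorem two_mul_sqNorm_eq {f : ℝ → ℂ} (hf : ContDiff ℝ 1 f) :
    2 * sqNorm T f = twistedEnergy T 1 f + twistedEnergy T (-1) f - 2 * twistedEnergy T 0 f := by
  have hfc : Continuous f := hf.continuous
  have hdc : Continuous (deriv f) := hf.continuous_deriv le_rfl
  have i : ∀ c : ℝ, IntervalIntegrable (fun x => ‖deriv f x - Complex.I * c * f x‖ ^ 2) volume 0 T :=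
    fun c => Continuous.intervalIntegrable (by fun_prop) _ _
  have e : (∫ x in (0 : ℝ)..T, 2 * ‖f x‖ ^ 2) =
      ∫ x in (0 : ℝ)..T, (‖deriv f x - Complex.I * (1 : ℝ) * f x‖ ^ 2 +
        ‖deriv f x - Complex.I * (-1 : ℝ) * f x‖ ^ 2 -
        2 * ‖deriv f x - Complex.I * (0 : ℝ) * f x‖ ^ 2) := by
    congr 1
    funext x
    have := parallelogram_law_with_norm ℝ (deriv f x) (Complex.I * f x)
    rw [norm_mul, Complex.norm_I, one_mul] at this
    have e1 : deriv f x - Complex.I * ((-1 : ℝ) : ℂ) * f x = deriv f x + Complex.I * f x := by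
      push_cast; ring
    have e2 : deriv f x - Complex.I * ((1 : ℝ) : ℂ) * f x = deriv f x - Complex.I * f x := by
      push_cast; ring
    have e3 : deriv f x - Complex.I * ((0 : ℝ) : ℂ) * f x = deriv f x := by simp
    rw [e1, e2, e3]
    nlinarith
  rw [intervalIntegral.integral_sub ((i 1).add (i (-1))) ((i 0).const_mul 2),
    intervalIntegral.integral_add (i 1) (i (-1)), intervalIntegral.integral_const_mul,
    intervalIntegral.integral_const_mul] at e
  simp only [twistedEnergy, sqNorm]
  linarith

end CmKdV

namespace CmKdV

open Set MeasureTheory Filter Topology intervalIntegral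
open scoped ComplexConjugate

variable {T : ℝ} {f g : ℝ → ℂ}

/-! ### Fourier series of periodic functions -/

/-- The wave number `2πn/T` of the `n`-th Fourier mode. -/
noncomputable def waveNumber (T : ℝ) (n : ℤ) : ℝ := 2 * Real.pi * n / T

/-- The `n`-th Fourier mode `e^{2πinx/T}`. -/
noncomputable def wave (T : ℝ) (n : ℤ) (x : ℝ) : ℂ :=
  Complex.exp (((waveNumber T n * x : ℝ) : ℂ) * Complex.I)

theorem norm_wave (n : ℤ) (x : ℝ) : ‖wave T n x‖ = 1 := Complex.norm_exp_ofReal_mul_I _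

theorem hasDerivAt_wave (n : ℤ) (x : ℝ) :
    HasDerivAt (wave T n) (Complex.I * waveNumber T n * wave T n x) x := by
  have h1 : HasDerivAt (fun x : ℝ => ((waveNumber T n * x : ℝ) : ℂ) * Complex.I)
      (waveNumber T n * Complex.I) x := by
    simpa using (((hasDerivAt_id' x).const_mul (waveNumber T n)).ofReal_comp).mul_const Complex.I
  refine h1.cexp.congr_deriv ?_
  simp only [wave]; ring

theorem continuous_wave (n : ℤ) : Continuous (wave T n) :=
  continuous_iff_continuousAt.2 fun x => (hasDerivAt_wave n x).continuousAt

theorem wave_add_period (hT : 0 < T) (n : ℤ) (x : ℝ) : wave T n (x + T) = wave T n x := by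
  have h : waveNumber T n * (x + T) = waveNumber T n * x + n * (2 * Real.pi) := by
    rw [waveNumber]; field_simp
  rw [wave, h, wave]
  push_cast
  rw [show ((waveNumber T n : ℂ) * x + n * (2 * Real.pi)) * Complex.I =
    (waveNumber T n : ℂ) * x * Complex.I + n * (2 * Real.pi * Complex.I) by ring,
    Complex.exp_add, Complex.exp_int_mul_two_pi_mul_I, mul_one]

theorem waveNumber_injective (hT : 0 < T) : Function.Injective (waveNumber T) := by
  intro m n h
  have hpi := Real.pi_pos
  simp only [waveNumber] at h
  have h2 : (m : ℝ) = n := by field_simp at h; exact h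
  exact_mod_cast h2

theorem fourierCoef_eq (n : ℤ) :
    fourierCoef T f n = (T : ℂ)⁻¹ * ∫ x in (0 : ℝ)..T, conj (wave T n x) * f x := by
  rw [fourierCoef, one_div]
  congr 2
  funext x
  rw [wave, ← Complex.exp_conj]
  simp only [waveNumber, map_mul, Complex.conj_ofReal, Complex.conj_I]
  push_cast
  congr 2
  ring

theorem hasSum_sq_fourierCoef (hT : 0 < T) (hf : Continuous f) :
    HasSum (fun n => ‖fourierCoef T f n‖ ^ 2) (T⁻¹ * sqNorm T f) := by
  have h := hasSum_sq_fourierCoeffOn hT (f := f) (memLp_of_continuousOn hf.continuousOn)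
  rw [sub_zero, smul_eq_mul] at h
  suffices hn : ∀ n, fourierCoef T f n = fourierCoeffOn hT f n by
    simp only [hn]
    exact h
  intro n
  rw [fourierCoeffOn_eq_integral, fourierCoef, sub_zero, Complex.real_smul]
  push_cast
  rw [intervalIntegral.integral_congr (μ := volume) (a := 0) (b := T)
    (g := fun x : ℝ => fourier (-n) (x : AddCircle (T - 0)) • f x) fun x _ => ?_]
  simp only [smul_eq_mul, fourier_coe_apply, sub_zero]
  congr 2
  push_cast
  ring

theorem fourierCoef_sub (hf : Continuous f) (hg : Continuous g) (n : ℤ) :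
    fourierCoef T (fun x => f x - g x) n = fourierCoef T f n - fourierCoef T g n := by
  have hw : Continuous fun x => conj (wave T n x) := Complex.continuous_conj.comp (continuous_wave n)
  simp only [fourierCoef_eq]
  rw [← mul_sub, ← intervalIntegral.integral_sub (Continuous.intervalIntegrable (by fun_prop) _ _)
    (Continuous.intervalIntegrable (by fun_prop) _ _)]
  simp only [mul_sub]

theorem fourierCoef_const_mul (c : ℂ) (n : ℤ) :
    fourierCoef T (fun x => c * f x) n = c * fourierCoef T f n := by
  simp only [fourierCoef_eq]
  rw [mul_left_comm c, ← intervalIntegral.integral_const_mul c]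
  simp only [mul_left_comm c]

theorem fourierCoef_sum {ι : Type*} (s : Finset ι) {F : ι → ℝ → ℂ} (hF : ∀ i ∈ s, Continuous (F i))
    (n : ℤ) : fourierCoef T (fun x => ∑ i ∈ s, F i x) n = ∑ i ∈ s, fourierCoef T (F i) n := by
  have hw : Continuous fun x => conj (wave T n x) := Complex.continuous_conj.comp (continuous_wave n)
  simp only [fourierCoef_eq]
  rw [← Finset.mul_sum, ← intervalIntegral.integral_finsetSum]
  · simp only [Finset.mul_sum]
  · exact fun i hi => (hw.mul (hF i hi)).intervalIntegrable _ _

theorem fourierCoef_deriv (hT : 0 < T) (hf : ∀ x, HasDerivAt f (g x) x) (hg : Continuous g)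
    (hp : f T = f 0) (n : ℤ) :
    fourierCoef T g n = Complex.I * waveNumber T n * fourierCoef T f n := by
  have hw : Continuous fun x => conj (wave T n x) := Complex.continuous_conj.comp (continuous_wave n)
  have hfc : Continuous f := continuous_iff_continuousAt.2 fun x => (hf x).continuousAt
  have hd : ∀ x, HasDerivAt (fun x => conj (wave T n x) * f x)
      (-(Complex.I * waveNumber T n) * (conj (wave T n x) * f x) + conj (wave T n x) * g x) x := by
    intro x
    have h1 : HasDerivAt (fun x => conj (wave T n x)) (conj (Complex.I * waveNumber T n * wave T n x)) x :=
      (hasDerivAt_wave n x).star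
    refine (h1.fun_mul (hf x)).congr_deriv ?_
    simp only [map_mul, Complex.conj_I, Complex.conj_ofReal]
    ring
  have h := integral_eq_sub_of_hasDerivAt (a := 0) (b := T) (fun x _ => hd x)
    (Continuous.intervalIntegrable (by fun_prop) _ _)
  have hwT : wave T n T = wave T n 0 := by simpa using wave_add_period hT n 0
  rw [hwT, hp, sub_self, intervalIntegral.integral_add
    (Continuous.intervalIntegrable (by fun_prop) _ _)
    (Continuous.intervalIntegrable (by fun_prop) _ _), intervalIntegral.integral_const_mul] at h
  simp only [fourierCoef_eq]
  linear_combination (T : ℂ)⁻¹ * h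

/-- Orthogonality of the modes: by `fourierCoef_deriv`, the coefficient of index `n` of the mode
`m` is multiplied by both wave numbers under differentiation, and so vanishes unless these agree.
-/
theorem fourierCoef_wave (hT : 0 < T) (m n : ℤ) :
    fourierCoef T (wave T m) n = if n = m then 1 else 0 := by
  split_ifs with h
  · subst h
    have h1 : ∀ x, conj (wave T n x) * wave T n x = 1 := fun x => by
      rw [← Complex.normSq_eq_conj_mul_self, Complex.normSq_eq_norm_sq, norm_wave]; simp
    have hT' : (T : ℂ) ≠ 0 := by exact_mod_cast hT.ne'
    simp [fourierCoef_eq, h1, hT']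
  · have h1 := fourierCoef_deriv hT (fun x => hasDerivAt_wave m x)
      (continuous_const.mul (continuous_wave m))
      (by simpa using wave_add_period hT m 0) n
    rw [fourierCoef_const_mul] at h1
    have h2 : (Complex.I * (waveNumber T m - waveNumber T n)) * fourierCoef T (wave T m) n = 0 := by
      linear_combination h1
    refine (mul_eq_zero.1 h2).resolve_left (mul_ne_zero Complex.I_ne_zero (sub_ne_zero.2 ?_))
    exact fun h3 => h (waveNumber_injective hT (by exact_mod_cast h3)).symm

/-- The trigonometric polynomial with coefficients `a n`, `|n| ≤ N`. -/
noncomputable def trigSum (T : ℝ) (N : ℕ) (a : ℤ → ℂ) (x : ℝ) : ℂ :=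
  ∑ n ∈ Finset.Icc (-(N : ℤ)) N, a n * wave T n x

theorem hasDerivAt_trigSum (N : ℕ) (a : ℤ → ℂ) (x : ℝ) :
    HasDerivAt (trigSum T N a) (trigSum T N (fun n => Complex.I * waveNumber T n * a n) x) x := by
  refine (HasDerivAt.fun_sum fun n _ => (hasDerivAt_wave n x).const_mul (a n)).congr_deriv ?_
  exact Finset.sum_congr rfl fun n _ => by ring

theorem continuous_trigSum (N : ℕ) (a : ℤ → ℂ) : Continuous (trigSum T N a) :=
  continuous_iff_continuousAt.2 fun x => (hasDerivAt_trigSum N a x).continuousAt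

theorem trigSum_period (hT : 0 < T) (N : ℕ) (a : ℤ → ℂ) : trigSum T N a T = trigSum T N a 0 := by
  refine Finset.sum_congr rfl fun n _ => ?_
  rw [show wave T n T = wave T n 0 by simpa using wave_add_period hT n 0]

theorem fourierCoef_trigSum (hT : 0 < T) (N : ℕ) (a : ℤ → ℂ) (n : ℤ) :
    fourierCoef T (trigSum T N a) n = if n ∈ Finset.Icc (-(N : ℤ)) N then a n else 0 := by
  unfold trigSum
  rw [fourierCoef_sum (F := fun m x => a m * wave T m x) _
    fun m _ => continuous_const.mul (continuous_wave m)]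
  simp only [fourierCoef_const_mul, fourierCoef_wave hT, mul_ite, mul_one, mul_zero]
  rw [Finset.sum_ite_eq]

theorem integral_conj_trigSum_mul (hT : 0 < T) (N : ℕ) (a : ℤ → ℂ) (hf : Continuous f) :
    ∫ x in (0 : ℝ)..T, conj (trigSum T N a x) * f x =
      T * ∑ n ∈ Finset.Icc (-(N : ℤ)) N, conj (a n) * fourierCoef T f n := by
  have hT' : (T : ℂ) ≠ 0 := by exact_mod_cast hT.ne'
  simp only [trigSum, map_sum, map_mul, Finset.sum_mul, Finset.mul_sum]
  rw [intervalIntegral.integral_finsetSum]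
  · refine Finset.sum_congr rfl fun n _ => ?_
    simp only [mul_assoc, intervalIntegral.integral_const_mul, fourierCoef_eq]
    field_simp
  · intro n _
    have hw : Continuous fun x => conj (wave T n x) :=
      Complex.continuous_conj.comp (continuous_wave n)
    exact Continuous.intervalIntegrable (by fun_prop) _ _

/-! ### The `L²` norm -/

/-- The norm of `L²[0,T]`. -/
noncomputable def l2Norm (T : ℝ) (f : ℝ → ℂ) : ℝ := Real.sqrt (sqNorm T f)

theorem l2Norm_nonneg (f : ℝ → ℂ) : 0 ≤ l2Norm T f := Real.sqrt_nonneg _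

theorem l2Norm_sq (hT : 0 < T) (f : ℝ → ℂ) : l2Norm T f ^ 2 = sqNorm T f :=
  Real.sq_sqrt (sqNorm_nonneg hT f)

theorem l2Norm_eq_norm_toLp (hT : 0 < T) (hf : MemLp f 2 (volume.restrict (Ioc 0 T))) :
    l2Norm T f = ‖hf.toLp f‖ := by
  rw [l2Norm, sqNorm_eq_norm_toLp hT hf, Real.sqrt_sq (norm_nonneg _)]

theorem l2Norm_add_le (hT : 0 < T) (hf : Continuous f) (hg : Continuous g) :
    l2Norm T (fun x => f x + g x) ≤ l2Norm T f + l2Norm T g := by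
  have hf' := memLp_of_continuousOn (T := T) hf.continuousOn
  have hg' := memLp_of_continuousOn (T := T) hg.continuousOn
  rw [l2Norm_eq_norm_toLp hT hf', l2Norm_eq_norm_toLp hT hg']
  refine (l2Norm_eq_norm_toLp hT (hf'.add hg')).trans_le ?_
  rw [MemLp.toLp_add]
  exact norm_add_le _ _

theorem l2Norm_le_mul (hT : 0 < T) (hf : Continuous f) (hg : Continuous g) {c : ℝ} (hc : 0 ≤ c)
    (h : ∀ x ∈ Icc 0 T, ‖f x‖ ≤ c * ‖g x‖) : l2Norm T f ≤ c * l2Norm T g := by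
  rw [l2Norm, Real.sqrt_le_left (mul_nonneg hc (l2Norm_nonneg g)), mul_pow, l2Norm_sq hT, sqNorm,
    sqNorm, ← intervalIntegral.integral_const_mul]
  refine integral_mono_on hT.le (Continuous.intervalIntegrable (by fun_prop) _ _)
    (Continuous.intervalIntegrable (by fun_prop) _ _) fun x hx => ?_
  rw [← mul_pow]
  exact pow_le_pow_left₀ (norm_nonneg _) (h x hx) 2

/-- The Cauchy–Schwarz inequality. -/
theorem norm_integral_conj_mul_le (hT : 0 < T) (hf : Continuous f) (hg : Continuous g) :
    ‖∫ x in (0 : ℝ)..T, conj (f x) * g x‖ ≤ l2Norm T f * l2Norm T g := by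
  have hf' := memLp_of_continuousOn (T := T) hf.continuousOn
  have hg' := memLp_of_continuousOn (T := T) hg.continuousOn
  rw [l2Norm_eq_norm_toLp hT hf', l2Norm_eq_norm_toLp hT hg']
  refine le_trans (le_of_eq ?_) (norm_inner_le_norm (𝕜 := ℂ) (hf'.toLp f) (hg'.toLp g))
  rw [L2.inner_def, intervalIntegral.integral_of_le hT.le]
  congr 1
  refine integral_congr_ae ?_
  filter_upwards [hf'.coeFn_toLp, hg'.coeFn_toLp] with x h1 h2
  rw [h1, h2, RCLike.inner_apply, mul_comm]

end CmKdV

namespace CmKdV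

open Set MeasureTheory Filter Topology intervalIntegral
open scoped ComplexConjugate

variable {T : ℝ} {f g : ℝ → ℂ}

/-! ### The energy identity for smooth functions -/

/-- For smooth periodic functions `p`, the variational derivative
`-2((∂ - iω)² p + 2 |p|² p)` of the twisted energy is orthogonal to the vector field
`p''' + 6 |p|² p'`: the pairing is the integral of an exact derivative. -/
theorem variational_derivative_pairing_eq_zero {p p₁ p₂ p₃ : ℝ → ℂ} (ω : ℝ)
    (h₀ : ∀ x, HasDerivAt p (p₁ x) x) (h₁ : ∀ x, HasDerivAt p₁ (p₂ x) x)
    (h₂ : ∀ x, HasDerivAt p₂ (p₃ x) x) (h₃ : Continuous p₃)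
    (e₀ : p T = p 0) (e₁ : p₁ T = p₁ 0) (e₂ : p₂ T = p₂ 0) :
    2 * (∫ x in (0 : ℝ)..T, conj (p₂ x - 2 * Complex.I * ω * p₁ x - ω ^ 2 * p x) *
        (6 * ((‖p x‖ ^ 2 : ℝ) : ℂ) * p₁ x)).re +
      4 * (∫ x in (0 : ℝ)..T, conj (((‖p x‖ ^ 2 : ℝ) : ℂ) * p x) *
        (p₃ x + 6 * ((‖p x‖ ^ 2 : ℝ) : ℂ) * p₁ x)).re = 0 := by
  have c₀ : Continuous p := continuous_iff_continuousAt.2 fun x => (h₀ x).continuousAt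
  have c₁ : Continuous p₁ := continuous_iff_continuousAt.2 fun x => (h₁ x).continuousAt
  have c₂ : Continuous p₂ := continuous_iff_continuousAt.2 fun x => (h₂ x).continuousAt
  have hn : ∀ x, ((‖p x‖ ^ 2 : ℝ) : ℂ) = p x * conj (p x) := fun x => by
    rw [Complex.mul_conj, Complex.normSq_eq_norm_sq]
  simp only [hn, map_sub, map_mul, map_pow, Complex.conj_I, Complex.conj_ofReal, Complex.conj_conj,
    map_ofNat]
  set q : ℝ → ℂ := fun x => conj (p x)
  set q₁ : ℝ → ℂ := fun x => conj (p₁ x)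
  set q₂ : ℝ → ℂ := fun x => conj (p₂ x)
  have k₀ : ∀ x, HasDerivAt q (q₁ x) x := fun x => (h₀ x).star
  have k₁ : ∀ x, HasDerivAt q₁ (q₂ x) x := fun x => (h₁ x).star
  have k₂ : ∀ x, HasDerivAt q₂ (conj (p₃ x)) x := fun x => (h₂ x).star
  set F₁ : ℝ → ℂ := fun x => (q₂ x - 2 * -Complex.I * ω * q₁ x - ω ^ 2 * q x) *
    (6 * (p x * q x) * p₁ x) with hF₁
  set F₂ : ℝ → ℂ := fun x => q x * p x * q x * (p₃ x + 6 * (p x * q x) * p₁ x) with hF₂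
  have d₀ : Continuous q := Complex.continuous_conj.comp c₀
  have d₁ : Continuous q₁ := Complex.continuous_conj.comp c₁
  have d₂ : Continuous q₂ := Complex.continuous_conj.comp c₂
  have hc₁ : Continuous F₁ := by fun_prop
  have hc₂ : Continuous F₂ := by fun_prop
  -- with `q = p̄`, twice the real part of `z` is `z + z̄`, and the integrand is the derivative of a
  -- polynomial in `p, p', p''` and their conjugates
  have hJ : ∀ x, HasDerivAt (fun x => 2 * (p x * q x ^ 2 * p₂ x + q x * p x ^ 2 * q₂ x) +
      2 * (p x * q x * (p₁ x * q₁ x)) - (q x ^ 2 * p₁ x ^ 2 + p x ^ 2 * q₁ x ^ 2) +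
      4 * (p x ^ 3 * q x ^ 3) - 3 * (ω : ℂ) ^ 2 * (p x ^ 2 * q x ^ 2))
      ((F₁ x + conj (F₁ x)) + 2 * (F₂ x + conj (F₂ x))) x := by
    intro x
    have a₀ := h₀ x
    have a₁ := h₁ x
    have a₂ := h₂ x
    have b₀ := k₀ x
    have b₁ := k₁ x
    have b₂ := k₂ x
    refine (((((((a₀.fun_mul (b₀.fun_pow 2)).fun_mul a₂).fun_add
      ((b₀.fun_mul (a₀.fun_pow 2)).fun_mul b₂)).const_mul 2).fun_add
      (((a₀.fun_mul b₀).fun_mul (a₁.fun_mul b₁)).const_mul 2)).fun_sub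
      (((b₀.fun_pow 2).fun_mul (a₁.fun_pow 2)).fun_add
        ((a₀.fun_pow 2).fun_mul (b₁.fun_pow 2)))).fun_add
      (((a₀.fun_pow 3).fun_mul (b₀.fun_pow 3)).const_mul 4)).fun_sub
      (((a₀.fun_pow 2).fun_mul (b₀.fun_pow 2)).const_mul (3 * (ω : ℂ) ^ 2)) |>.congr_deriv ?_
    simp only [hF₁, hF₂, map_add, map_sub, map_mul, map_pow, map_neg, Complex.conj_I,
      Complex.conj_ofReal, map_ofNat, q, q₁, q₂, Complex.conj_conj]
    push_cast
    ring
  have hint := integral_eq_sub_of_hasDerivAt (a := 0) (b := T) (fun x _ => hJ x)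
    (Continuous.intervalIntegrable
      ((hc₁.add (Complex.continuous_conj.comp hc₁)).add
        (continuous_const.mul (hc₂.add (Complex.continuous_conj.comp hc₂)))) _ _)
  have q0 : q T = q 0 := by simp only [q, e₀]
  have q1 : q₁ T = q₁ 0 := by simp only [q₁, e₁]
  have q2 : q₂ T = q₂ 0 := by simp only [q₂, e₂]
  rw [e₀, e₁, e₂, q0, q1, q2, sub_self] at hint
  have hre : ∀ {F : ℝ → ℂ}, Continuous F → (∫ x in (0 : ℝ)..T, F x).re = ∫ x in (0 : ℝ)..T, (F x).re :=
    fun hF => (Complex.reCLM.intervalIntegral_comp_comm (hF.intervalIntegrable 0 T)).symm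
  rw [hre hc₁, hre hc₂, ← intervalIntegral.integral_const_mul,
    ← intervalIntegral.integral_const_mul, ← intervalIntegral.integral_add
    (Continuous.intervalIntegrable (by fun_prop) _ _)
    (Continuous.intervalIntegrable (by fun_prop) _ _)]
  have h := congrArg Complex.re hint
  have hcs : Continuous fun x => F₁ x + conj (F₁ x) + 2 * (F₂ x + conj (F₂ x)) :=
    (hc₁.add (Complex.continuous_conj.comp hc₁)).add
      (continuous_const.mul (hc₂.add (Complex.continuous_conj.comp hc₂)))
  rw [hre hcs] at h
  refine Eq.trans ?_ h
  refine intervalIntegral.integral_congr fun x _ => ?_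
  simp
  ring

/-! ### Estimates for truncated Fourier series -/

/-- The partial sum `∑_{|n| ≤ N}` of the Fourier series. -/
noncomputable def fourierPartialSum (T : ℝ) (N : ℕ) (f : ℝ → ℂ) : ℝ → ℂ :=
  trigSum T N (fourierCoef T f)

theorem continuous_fourierPartialSum (N : ℕ) (f : ℝ → ℂ) : Continuous (fourierPartialSum T N f) :=
  continuous_trigSum N _

/-- The sequence `c` of Fourier coefficients has norm at most `R` in the Sobolev space of order
`s`. It is stated through finite sums, which includes the summability. -/
def SobolevBound (s R : ℝ) (c : ℤ → ℂ) : Prop :=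
  ∀ F : Finset ℤ, ∑ n ∈ F, ((1 + (n : ℝ) ^ 2) ^ (s / 2) * ‖c n‖) ^ 2 ≤ R ^ 2

theorem one_le_one_add_sq (n : ℤ) : 1 ≤ 1 + (n : ℝ) ^ 2 := by nlinarith [sq_nonneg (n : ℝ)]

theorem IsSobolev.sobolevBound {s : ℝ} {c : ℤ → ℂ} {U : EllTwo} (h : IsSobolev s c U) {R : ℝ}
    (hR : ‖U‖ ≤ R) {σ : ℝ} (hσ : σ ≤ s) : SobolevBound σ R c := by
  intro F
  have h1 := lp.sum_rpow_le_norm_rpow (p := 2) (by norm_num) U F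
  simp only [ENNReal.toReal_ofNat, Real.rpow_ofNat] at h1
  refine (Finset.sum_le_sum fun n _ => ?_).trans (h1.trans (pow_le_pow_left₀ (norm_nonneg _) hR 2))
  have h0 := one_le_one_add_sq n
  rw [h n, norm_mul, Complex.norm_real, Real.norm_of_nonneg (by positivity)]
  gcongr

/-- A bound of the Fourier coefficients by a weighted sequence in a Sobolev ball bounds the `L²`
norm, by Parseval. -/
theorem l2Norm_le_of_fourierCoef_le (hT : 0 < T) (hg : Continuous g) {s R K : ℝ} {c : ℤ → ℂ}
    (hc : SobolevBound s R c) (hR : 0 ≤ R) (hK : 0 ≤ K)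
    (h : ∀ n : ℤ, ‖fourierCoef T g n‖ ≤ K * ((1 + (n : ℝ) ^ 2) ^ (s / 2) * ‖c n‖)) :
    l2Norm T g ≤ Real.sqrt T * R * K := by
  have h1 : T⁻¹ * sqNorm T g ≤ K ^ 2 * R ^ 2 := by
    refine hasSum_le_of_sum_le (hasSum_sq_fourierCoef hT hg) fun F => ?_
    calc ∑ n ∈ F, ‖fourierCoef T g n‖ ^ 2
        ≤ ∑ n ∈ F, K ^ 2 * ((1 + (n : ℝ) ^ 2) ^ (s / 2) * ‖c n‖) ^ 2 :=
          Finset.sum_le_sum fun n _ => by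
            rw [← mul_pow]; exact pow_le_pow_left₀ (norm_nonneg _) (h n) 2
      _ ≤ K ^ 2 * R ^ 2 := by
          rw [← Finset.mul_sum]; exact mul_le_mul_of_nonneg_left (hc F) (sq_nonneg K)
  rw [l2Norm, Real.sqrt_le_left (by positivity), mul_pow, mul_pow, Real.sq_sqrt hT.le]
  rw [inv_mul_le_iff₀ hT] at h1
  linarith

theorem sqrt_weight_le {s : ℝ} (hs : 1 ≤ s) (n : ℤ) :
    Real.sqrt (1 + (n : ℝ) ^ 2) ≤ (1 + (n : ℝ) ^ 2) ^ (s / 2) := by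
  rw [Real.sqrt_eq_rpow]
  exact Real.rpow_le_rpow_of_exponent_le (one_le_one_add_sq n) (by linarith)

/-- High frequencies: one derivative costs at most order `s`, with the gain `(1 + N²)^{(1-s)/2}`. -/
theorem sqrt_weight_le_of_notMem {s : ℝ} (hs : 1 ≤ s) {N : ℕ} {n : ℤ}
    (hn : n ∉ Finset.Icc (-(N : ℤ)) N) : Real.sqrt (1 + (n : ℝ) ^ 2) ≤
      (1 + (N : ℝ) ^ 2) ^ ((1 - s) / 2) * (1 + (n : ℝ) ^ 2) ^ (s / 2) := by
  have h1 : (0 : ℝ) < 1 + (n : ℝ) ^ 2 := by positivity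
  have hNn : (N : ℝ) ^ 2 ≤ (n : ℝ) ^ 2 := by
    rw [Finset.mem_Icc, ← abs_le, not_le] at hn
    rw [← sq_abs (n : ℝ)]
    have : (N : ℝ) ≤ |(n : ℝ)| := by exact_mod_cast hn.le
    gcongr
  calc Real.sqrt (1 + (n : ℝ) ^ 2)
      = (1 + (n : ℝ) ^ 2) ^ ((1 - s) / 2) * (1 + (n : ℝ) ^ 2) ^ (s / 2) := by
        rw [← Real.rpow_add h1, Real.sqrt_eq_rpow]; congr 1; ring
    _ ≤ _ := by
        gcongr ?_ * _
        exact Real.rpow_le_rpow_of_nonpos (by positivity) (by linarith) (by linarith)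

/-- Low frequencies: two derivatives cost order `s` and the loss `(1 + N²)^{(2-s)/2}`. -/
theorem weight_le_of_mem {s : ℝ} (hs : s ≤ 2) {N : ℕ} {n : ℤ}
    (hn : n ∈ Finset.Icc (-(N : ℤ)) N) : 1 + (n : ℝ) ^ 2 ≤
      (1 + (N : ℝ) ^ 2) ^ ((2 - s) / 2) * (1 + (n : ℝ) ^ 2) ^ (s / 2) := by
  have h1 : (0 : ℝ) < 1 + (n : ℝ) ^ 2 := by positivity
  have hNn : (n : ℝ) ^ 2 ≤ (N : ℝ) ^ 2 := by
    rw [Finset.mem_Icc, ← abs_le] at hn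
    rw [← sq_abs (n : ℝ)]
    have : |(n : ℝ)| ≤ (N : ℝ) := by exact_mod_cast hn
    gcongr
  calc 1 + (n : ℝ) ^ 2
      = (1 + (n : ℝ) ^ 2) ^ ((2 - s) / 2) * (1 + (n : ℝ) ^ 2) ^ (s / 2) := by
        rw [← Real.rpow_add h1, ← add_div, sub_add_cancel, div_self two_ne_zero, Real.rpow_one]
    _ ≤ _ := by
        gcongr ?_ * _
        exact Real.rpow_le_rpow h1.le (by linarith) (by linarith)

theorem abs_waveNumber_le (hT : 0 < T) (n : ℤ) :
    |waveNumber T n| ≤ 2 * Real.pi / T * Real.sqrt (1 + (n : ℝ) ^ 2) := by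
  have hpi := Real.pi_pos
  have h : waveNumber T n = 2 * Real.pi / T * n := by rw [waveNumber]; ring
  rw [h, abs_mul, abs_of_nonneg (by positivity)]
  gcongr
  exact Real.abs_le_sqrt (by linarith)

theorem sqrt_le_abs_waveNumber (hT : 0 < T) {N : ℕ} {n : ℤ} (hn : n ∉ Finset.Icc (-(N : ℤ)) N) :
    2 * Real.pi / T * Real.sqrt (1 + (N : ℝ) ^ 2) ≤ |waveNumber T n| := by
  have hpi := Real.pi_pos
  have h : waveNumber T n = 2 * Real.pi / T * n := by rw [waveNumber]; ring
  rw [h, abs_mul, abs_of_nonneg (by positivity : 0 ≤ 2 * Real.pi / T)]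
  gcongr
  rw [Finset.mem_Icc, ← abs_le, not_le] at hn
  have h2 : (N : ℝ) + 1 ≤ |(n : ℝ)| := by exact_mod_cast hn
  refine le_trans (Real.sqrt_le_iff.2 ⟨by positivity, ?_⟩) h2
  nlinarith [Nat.cast_nonneg (α := ℝ) N]

/-- Truncation commutes with differentiation. -/
theorem fourierPartialSum_deriv (hT : 0 < T) (hf : ∀ x, HasDerivAt f (g x) x) (hg : Continuous g)
    (hp : f T = f 0) (N : ℕ) (x : ℝ) :
    HasDerivAt (fourierPartialSum T N f) (fourierPartialSum T N g x) x := by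
  have h : fourierCoef T g = fun n => Complex.I * waveNumber T n * fourierCoef T f n :=
    funext (fourierCoef_deriv hT hf hg hp)
  rw [fourierPartialSum, fourierPartialSum, h]
  exact hasDerivAt_trigSum N _ x

theorem fourierCoef_sub_fourierPartialSum (hT : 0 < T) (hf : Continuous f) (N : ℕ) (n : ℤ) :
    fourierCoef T (fun x => f x - fourierPartialSum T N f x) n =
      if n ∈ Finset.Icc (-(N : ℤ)) N then 0 else fourierCoef T f n := by
  rw [fourierCoef_sub hf (continuous_fourierPartialSum N f)]
  unfold fourierPartialSum
  rw [fourierCoef_trigSum hT]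
  split_ifs <;> simp

/-- The error of truncation gains one power of `N`, at the cost of one derivative. -/
theorem l2Norm_sub_fourierPartialSum_le (hT : 0 < T) (hf : ∀ x, HasDerivAt f (g x) x)
    (hg : Continuous g) (hp : f T = f 0) (N : ℕ) :
    l2Norm T (fun x => f x - fourierPartialSum T N f x) ≤
      T / (2 * Real.pi) / Real.sqrt (1 + (N : ℝ) ^ 2) * l2Norm T g := by
  have hpi := Real.pi_pos
  have hfc : Continuous f := continuous_iff_continuousAt.2 fun x => (hf x).continuousAt
  set K := T / (2 * Real.pi) / Real.sqrt (1 + (N : ℝ) ^ 2) with hK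
  have hK0 : 0 ≤ K := by positivity
  rw [l2Norm, Real.sqrt_le_left (mul_nonneg hK0 (l2Norm_nonneg g)), mul_pow, l2Norm_sq hT]
  have hcd : Continuous fun x => f x - fourierPartialSum T N f x :=
    hfc.sub (continuous_fourierPartialSum N f)
  have h := hasSum_le (fun n => ?_) (hasSum_sq_fourierCoef hT hcd)
    ((hasSum_sq_fourierCoef hT hg).mul_left (K ^ 2))
  · have := mul_le_mul_of_nonneg_left h hT.le
    rw [mul_inv_cancel_left₀ hT.ne', mul_left_comm, mul_inv_cancel_left₀ hT.ne'] at this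
    exact this
  · rw [fourierCoef_sub_fourierPartialSum hT hfc N n]
    split_ifs with hn
    · simpa using by positivity
    · rw [fourierCoef_deriv hT hf hg hp, ← mul_pow]
      refine pow_le_pow_left₀ (norm_nonneg _) ?_ 2
      rw [norm_mul, norm_mul, Complex.norm_I, one_mul, Complex.norm_real, Real.norm_eq_abs,
        ← mul_assoc]
      refine le_mul_of_one_le_left (norm_nonneg _) ?_
      calc 1 = K * (2 * Real.pi / T * Real.sqrt (1 + (N : ℝ) ^ 2)) := by
            rw [hK]; field_simp
        _ ≤ _ := mul_le_mul_of_nonneg_left (sqrt_le_abs_waveNumber hT hn) hK0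

/-- Truncation is self-adjoint. -/
theorem integral_conj_mul_sub_fourierPartialSum (hT : 0 < T) (hf : Continuous f)
    (hg : Continuous g) (N : ℕ) :
    ∫ x in (0 : ℝ)..T, conj (f x) * (g x - fourierPartialSum T N g x) =
      ∫ x in (0 : ℝ)..T, conj (f x - fourierPartialSum T N f x) * g x := by
  have hpf : Continuous (fourierPartialSum T N f) := continuous_trigSum N _
  have hpg : Continuous (fourierPartialSum T N g) := continuous_trigSum N _
  have cf : Continuous fun x => conj (f x) := Complex.continuous_conj.comp hf
  have cp : Continuous fun x => conj (fourierPartialSum T N f x) := Complex.continuous_conj.comp hpf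
  have h1 : ∫ x in (0 : ℝ)..T, conj (f x) * fourierPartialSum T N g x =
      ∫ x in (0 : ℝ)..T, conj (fourierPartialSum T N f x) * g x := by
    rw [show fourierPartialSum T N f = trigSum T N (fourierCoef T f) from rfl,
      integral_conj_trigSum_mul hT N _ hg]
    have h2 := integral_conj_trigSum_mul hT N (fourierCoef T g) hf
    have h3 := congrArg conj h2
    rw [← intervalIntegral_conj] at h3
    simp only [map_mul, map_sum, Complex.conj_conj, Complex.conj_ofReal] at h3
    simp only [fourierPartialSum, mul_comm (conj (f _))]
    rw [h3]
    simp only [mul_comm]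
  simp only [mul_sub, map_sub, sub_mul]
  rw [intervalIntegral.integral_sub (Continuous.intervalIntegrable (by fun_prop) _ _)
    (Continuous.intervalIntegrable (by fun_prop) _ _),
    intervalIntegral.integral_sub (Continuous.intervalIntegrable (by fun_prop) _ _)
    (Continuous.intervalIntegrable (by fun_prop) _ _), h1]

end CmKdV

namespace CmKdV

open Set MeasureTheory Filter Topology intervalIntegral
open scoped ComplexConjugate

variable {T : ℝ} {f g : ℝ → ℂ}

/-! ### The truncation error in the energy identity -/

/-- The Sobolev embedding of `H¹` into the bounded functions. -/
theorem norm_le_of_l2Norm_le (hT : 0 < T) (hf : ∀ x, HasDerivAt f (g x) x) (hg : Continuous g)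
    (hp : f T = f 0) {D : ℝ} (h₀ : l2Norm T f ≤ D) (h₁ : l2Norm T g ≤ D) :
    ∀ x ∈ Icc 0 T, ‖f x‖ ≤ Real.sqrt (2 / T + 2 * T) * D := by
  intro x hx
  have hD : 0 ≤ D := (l2Norm_nonneg f).trans h₀
  refine le_of_sq_le_sq ?_ (by positivity)
  rw [mul_pow, Real.sq_sqrt (by positivity)]
  have h := (isH1_of_hasDerivAt hg.continuousOn hf hp).norm_sq_le hT hT le_rfl hx
  rw [← l2Norm_sq hT, ← l2Norm_sq hT] at h
  have h2 := pow_le_pow_left₀ (l2Norm_nonneg f) h₀ 2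
  have h3 := pow_le_pow_left₀ (l2Norm_nonneg g) h₁ 2
  have h4 : 0 ≤ 2 / T := by positivity
  nlinarith [mul_le_mul_of_nonneg_left h2 h4, mul_le_mul_of_nonneg_left h3 hT.le]

/-- The real part of a weighted pairing is bounded by the product of the norms. -/
theorem abs_mul_re_integral_le (hT : 0 < T) (hf : Continuous f) (hg : Continuous g) {c a b : ℝ}
    (hc : 0 ≤ c) (ha : l2Norm T f ≤ a) (hb : l2Norm T g ≤ b) :
    |c * (∫ x in (0 : ℝ)..T, conj (f x) * g x).re| ≤ c * (a * b) := by
  rw [abs_mul, abs_of_nonneg hc]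
  refine mul_le_mul_of_nonneg_left ?_ hc
  exact ((Complex.abs_re_le_norm _).trans (norm_integral_conj_mul_le hT hf hg)).trans
    (mul_le_mul ha hb (l2Norm_nonneg g) ((l2Norm_nonneg f).trans ha))

theorem hasDerivAt_norm_sq_mul {p p₁ : ℝ → ℂ} (h : ∀ x, HasDerivAt p (p₁ x) x) (x : ℝ) :
    HasDerivAt (fun x => ((‖p x‖ ^ 2 : ℝ) : ℂ) * p x)
      (2 * (p x * conj (p x)) * p₁ x + p x ^ 2 * conj (p₁ x)) x := by
  have hn : ∀ x, ((‖p x‖ ^ 2 : ℝ) : ℂ) = p x * conj (p x) := fun x => by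
    rw [Complex.mul_conj, Complex.normSq_eq_norm_sq]
  simp only [hn]
  have h2 : HasDerivAt (fun x => conj (p x)) (conj (p₁ x)) x := (h x).star
  exact (((h x).fun_mul h2).fun_mul (h x)).congr_deriv (by ring)

theorem trigSum_combination (N : ℕ) (a b c : ℤ → ℂ) (α β : ℂ) (x : ℝ) :
    trigSum T N a x - α * trigSum T N b x - β * trigSum T N c x =
      trigSum T N (fun n => a n - α * b n - β * c n) x := by
  simp only [trigSum, Finset.mul_sum]
  rw [← Finset.sum_sub_distrib, ← Finset.sum_sub_distrib]
  exact Finset.sum_congr rfl fun n _ => by ring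

/-- The difference of the nonlinearities at a function and at its truncation. -/
theorem l2Norm_nonlinearity_sub_le (hT : 0 < T) {p p₁ : ℝ → ℂ} (cf : Continuous f)
    (cg : Continuous g) (cp : Continuous p) (cp₁ : Continuous p₁) {b d r : ℝ}
    (hb : 0 ≤ b) (hr : 0 ≤ r) (hf : ∀ x ∈ Icc 0 T, ‖f x‖ ≤ b) (hp : ∀ x ∈ Icc 0 T, ‖p x‖ ≤ b)
    (hfp : ∀ x ∈ Icc 0 T, ‖f x - p x‖ ≤ b * r) (hg : l2Norm T g ≤ d)
    (hgp : l2Norm T (fun x => g x - p₁ x) ≤ d * r) :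
    l2Norm T (fun x => 6 * ((‖f x‖ ^ 2 : ℝ) : ℂ) * g x - 6 * ((‖p x‖ ^ 2 : ℝ) : ℂ) * p₁ x) ≤
      18 * b ^ 2 * d * r := by
  have e : (fun x => 6 * ((‖f x‖ ^ 2 : ℝ) : ℂ) * g x - 6 * ((‖p x‖ ^ 2 : ℝ) : ℂ) * p₁ x) =
      fun x => 6 * ((‖f x‖ ^ 2 - ‖p x‖ ^ 2 : ℝ) : ℂ) * g x +
        6 * ((‖p x‖ ^ 2 : ℝ) : ℂ) * (g x - p₁ x) := by
    funext x; push_cast; ring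
  rw [e]
  have h1 : l2Norm T (fun x => 6 * ((‖f x‖ ^ 2 - ‖p x‖ ^ 2 : ℝ) : ℂ) * g x) ≤
      12 * b ^ 2 * r * l2Norm T g := by
    refine l2Norm_le_mul hT (by fun_prop) cg (by positivity) fun x hx => ?_
    rw [norm_mul, norm_mul, Complex.norm_real, Real.norm_eq_abs]
    refine mul_le_mul_of_nonneg_right ?_ (norm_nonneg _)
    have h2 : |‖f x‖ - ‖p x‖| ≤ b * r := (abs_norm_sub_norm_le _ _).trans (hfp x hx)
    have h3 : |‖f x‖ + ‖p x‖| ≤ 2 * b := by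
      rw [abs_of_nonneg (by positivity)]
      linarith [hf x hx, hp x hx]
    rw [show ‖f x‖ ^ 2 - ‖p x‖ ^ 2 = (‖f x‖ + ‖p x‖) * (‖f x‖ - ‖p x‖) by ring, abs_mul]
    have h4 := mul_le_mul h3 h2 (abs_nonneg _) (by positivity)
    norm_num
    linarith
  have h2 : l2Norm T (fun x => 6 * ((‖p x‖ ^ 2 : ℝ) : ℂ) * (g x - p₁ x)) ≤
      6 * b ^ 2 * l2Norm T (fun x => g x - p₁ x) := by
    refine l2Norm_le_mul hT (by fun_prop) (by fun_prop) (by positivity) fun x hx => ?_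
    rw [norm_mul, norm_mul, Complex.norm_real, Real.norm_of_nonneg (by positivity)]
    refine mul_le_mul_of_nonneg_right ?_ (norm_nonneg _)
    have := pow_le_pow_left₀ (norm_nonneg _) (hp x hx) 2
    norm_num
    linarith
  refine (l2Norm_add_le hT (by fun_prop) (by fun_prop)).trans ((add_le_add h1 h2).trans ?_)
  have h3 := mul_le_mul_of_nonneg_left hg (by positivity : 0 ≤ 12 * b ^ 2 * r)
  have h4 := mul_le_mul_of_nonneg_left hgp (by positivity : 0 ≤ 6 * b ^ 2)
  linarith

/-- The bound of `abs_energy_rate_le` for the derivative of the truncated energy on the ball of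
radius `R` of the Sobolev space of order `σ`. Here `D` bounds the `H¹` norms and `b` the supremum
norms of a function and its truncation, `ρ` is the relative truncation error, and the three
summands are of the orders `N^{3-2σ}`, `N^{1-σ}` and `N^{-1}`. -/
noncomputable def truncationError (T ω σ R : ℝ) (N : ℕ) : ℝ :=
  let D := Real.sqrt T * R * (1 + 2 * Real.pi / T)
  let b := Real.sqrt (2 / T + 2 * T) * D
  let ρ := (1 + (N : ℝ) ^ 2) ^ ((1 - σ) / 2)
  2 * ((Real.sqrt T * R * ((2 * (2 * Real.pi / T) ^ 2 + 2 * ω ^ 2) *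
      (1 + (N : ℝ) ^ 2) ^ ((2 - σ) / 2))) * (18 * b ^ 2 * D * ρ)) +
    4 * ((b ^ 2 * D) * (18 * b ^ 2 * D * ρ)) +
    4 * ((T / (2 * Real.pi) / Real.sqrt (1 + (N : ℝ) ^ 2) * (3 * b ^ 2 * D)) * (6 * b ^ 2 * D))

theorem tendsto_truncationError (T ω R : ℝ) {σ : ℝ} (hσ : 3 / 2 < σ) :
    Tendsto (truncationError T ω σ R) atTop (𝓝 0) := by
  have hL : Tendsto (fun N : ℕ => 1 + (N : ℝ) ^ 2) atTop atTop :=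
    tendsto_atTop_add_const_left _ _
      ((tendsto_pow_atTop two_ne_zero).comp tendsto_natCast_atTop_atTop)
  have h1 : Tendsto (fun N : ℕ => (1 + (N : ℝ) ^ 2) ^ ((1 - σ) / 2)) atTop (𝓝 0) := by
    have := (tendsto_rpow_neg_atTop (y := (σ - 1) / 2) (by linarith)).comp hL
    simpa only [Function.comp_def, ← neg_div, neg_sub] using this
  have h2 : Tendsto (fun N : ℕ => (1 + (N : ℝ) ^ 2) ^ ((2 - σ) / 2) *
      (1 + (N : ℝ) ^ 2) ^ ((1 - σ) / 2)) atTop (𝓝 0) := by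
    have := (tendsto_rpow_neg_atTop (y := σ - 3 / 2) (by linarith)).comp hL
    refine this.congr fun N => ?_
    rw [← Real.rpow_add (by positivity), Function.comp_apply]
    congr 1
    ring
  have h3 : Tendsto (fun N : ℕ => (Real.sqrt (1 + (N : ℝ) ^ 2))⁻¹) atTop (𝓝 0) :=
    (Real.tendsto_sqrt_atTop.comp hL).inv_tendsto_atTop
  set D := Real.sqrt T * R * (1 + 2 * Real.pi / T) with hD
  set b := Real.sqrt (2 / T + 2 * T) * D with hb
  have := ((h2.const_mul (2 * (Real.sqrt T * R * (2 * (2 * Real.pi / T) ^ 2 + 2 * ω ^ 2)) *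
    (18 * b ^ 2 * D))).add (h1.const_mul (4 * (b ^ 2 * D) * (18 * b ^ 2 * D)))).add
    (h3.const_mul (4 * (T / (2 * Real.pi) * (3 * b ^ 2 * D)) * (6 * b ^ 2 * D)))
  simp only [mul_zero, add_zero] at this
  refine this.congr fun N => ?_
  simp only [truncationError, ← hD, ← hb]
  ring

/-- The pairing of the variational derivative of the twisted energy at a truncation with the
truncated vector field is small, uniformly on bounded sets of the Sobolev space of order `σ >
3/2`. At the truncation `p` with the vector field of `p` itself it vanishes exactly; the error is
made of the difference `G - G_N` of the nonlinearities at `f` and at `p`, paired with `(∂ - iω)²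
p`, which is of order `N^{2-σ} N^{1-σ}`, and with `|p|² p`, and of the truncation of `G`, which is
moved onto the differentiable function `|p|² p`. -/
theorem abs_energy_rate_le (hT : 0 < T) (ω : ℝ) {σ R : ℝ} (hσ : 3 / 2 < σ) (hσ2 : σ ≤ 2)
    (hR : 0 ≤ R) (hf : ∀ x, HasDerivAt f (g x) x) (hg : Continuous g) (hp : f T = f 0)
    (hc : SobolevBound σ R (fourierCoef T f)) (N : ℕ) :
    |2 * (∫ x in (0 : ℝ)..T, conj (trigSum T N
        (fun n => -((waveNumber T n - ω) ^ 2 : ℝ) * fourierCoef T f n) x) *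
        (6 * ((‖f x‖ ^ 2 : ℝ) : ℂ) * g x)).re +
      4 * (∫ x in (0 : ℝ)..T, conj (((‖fourierPartialSum T N f x‖ ^ 2 : ℝ) : ℂ) *
        fourierPartialSum T N f x) *
        (trigSum T N (fun n => (Complex.I * waveNumber T n) ^ 3 * fourierCoef T f n) x +
          fourierPartialSum T N (fun x => 6 * ((‖f x‖ ^ 2 : ℝ) : ℂ) * g x) x)).re| ≤
      truncationError T ω σ R N := by
  have hpi := Real.pi_pos
  have cf : Continuous f := continuous_iff_continuousAt.2 fun x => (hf x).continuousAt
  have hgc : ∀ n, fourierCoef T g n = Complex.I * waveNumber T n * fourierCoef T f n :=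
    fourierCoef_deriv hT hf hg hp
  set G : ℝ → ℂ := fun x => 6 * ((‖f x‖ ^ 2 : ℝ) : ℂ) * g x with hG
  set p := fourierPartialSum T N f with hpdef
  set p₁ := fourierPartialSum T N g with hp₁def
  set p₂ := trigSum T N (fun n => Complex.I * waveNumber T n * fourierCoef T g n) with hp₂def
  set p₃ := trigSum T N (fun n => Complex.I * waveNumber T n *
    (Complex.I * waveNumber T n * fourierCoef T g n)) with hp₃def
  set W := trigSum T N (fun n => -((waveNumber T n - ω) ^ 2 : ℝ) * fourierCoef T f n) with hWdef
  have e₃ : trigSum T N (fun n => (Complex.I * waveNumber T n) ^ 3 * fourierCoef T f n) = p₃ := by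
    rw [hp₃def]
    congr 1
    funext n
    rw [hgc]
    ring
  have eW : ∀ x, W x = p₂ x - 2 * Complex.I * ω * p₁ x - ω ^ 2 * p x := by
    intro x
    rw [hWdef, hp₂def, hp₁def, hpdef, fourierPartialSum, fourierPartialSum, trigSum_combination]
    congr 1
    funext n
    rw [hgc]
    push_cast
    linear_combination (-(waveNumber T n : ℂ) ^ 2 + 2 * ω * waveNumber T n) *
      fourierCoef T f n * Complex.I_sq
  have cp : Continuous p := continuous_fourierPartialSum N f
  have cp₁ : Continuous p₁ := continuous_fourierPartialSum N g
  have cp₃ : Continuous p₃ := continuous_trigSum N _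
  have cW : Continuous W := continuous_trigSum N _
  have dp : ∀ x, HasDerivAt p (p₁ x) x := fourierPartialSum_deriv hT hf hg hp N
  have hid := variational_derivative_pairing_eq_zero (T := T) ω dp
    (fun x => hasDerivAt_trigSum N _ x) (fun x => hasDerivAt_trigSum N _ x) cp₃
    (trigSum_period hT N _) (trigSum_period hT N _) (trigSum_period hT N _)
  rw [← hp₂def, ← hp₃def] at hid
  simp only [← eW] at hid
  set GN : ℝ → ℂ := fun x => 6 * ((‖p x‖ ^ 2 : ℝ) : ℂ) * p₁ x with hGN
  set q : ℝ → ℂ := fun x => ((‖p x‖ ^ 2 : ℝ) : ℂ) * p x with hq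
  set q₁ : ℝ → ℂ := fun x => 2 * (p x * conj (p x)) * p₁ x + p x ^ 2 * conj (p₁ x) with hq₁
  have cG : Continuous G := by fun_prop
  have cGN : Continuous GN := by fun_prop
  have cq : Continuous q := by fun_prop
  have cq₁ : Continuous q₁ := by
    have h1 : Continuous fun x => conj (p x) := Complex.continuous_conj.comp cp
    have h2 : Continuous fun x => conj (p₁ x) := Complex.continuous_conj.comp cp₁
    fun_prop
  have dq : ∀ x, HasDerivAt q (q₁ x) x := hasDerivAt_norm_sq_mul dp
  have cPG : Continuous (fourierPartialSum T N G) := continuous_fourierPartialSum N G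
  have cPq : Continuous (fourierPartialSum T N q) := continuous_fourierPartialSum N q
  -- the bounds for the function and its truncation
  set D := Real.sqrt T * R * (1 + 2 * Real.pi / T) with hD
  set b := Real.sqrt (2 / T + 2 * T) * D with hb
  set ρ := (1 + (N : ℝ) ^ 2) ^ ((1 - σ) / 2) with hρ
  have hρ0 : 0 ≤ ρ := by positivity
  have hD0 : 0 ≤ D := by positivity
  have hb0 : 0 ≤ b := by positivity
  have hK : 1 ≤ 1 + 2 * Real.pi / T := by
    have : 0 ≤ 2 * Real.pi / T := by positivity
    linarith
  have hK' : 2 * Real.pi / T ≤ 1 + 2 * Real.pi / T := by linarith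
  have w₀ : ∀ n : ℤ, ‖fourierCoef T f n‖ ≤ (1 + 2 * Real.pi / T) *
      (Real.sqrt (1 + (n : ℝ) ^ 2) * ‖fourierCoef T f n‖) := fun n => by
    rw [← mul_assoc]
    exact le_mul_of_one_le_left (norm_nonneg _)
      (one_le_mul_of_one_le_of_one_le hK (Real.one_le_sqrt.2 (one_le_one_add_sq n)))
  have w₁ : ∀ n : ℤ, ‖fourierCoef T g n‖ ≤ (1 + 2 * Real.pi / T) *
      (Real.sqrt (1 + (n : ℝ) ^ 2) * ‖fourierCoef T f n‖) := fun n => by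
    rw [hgc, norm_mul, norm_mul, Complex.norm_I, one_mul, Complex.norm_real, Real.norm_eq_abs,
      ← mul_assoc]
    exact mul_le_mul_of_nonneg_right ((abs_waveNumber_le hT n).trans
      (mul_le_mul_of_nonneg_right hK' (Real.sqrt_nonneg _))) (norm_nonneg _)
  have big : ∀ {n : ℤ} {z : ℂ}, ‖z‖ ≤ (1 + 2 * Real.pi / T) *
      (Real.sqrt (1 + (n : ℝ) ^ 2) * ‖fourierCoef T f n‖) → ‖z‖ ≤ (1 + 2 * Real.pi / T) *
      ((1 + (n : ℝ) ^ 2) ^ (σ / 2) * ‖fourierCoef T f n‖) := fun {n z} h =>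
    h.trans (by gcongr; exact sqrt_weight_le (by linarith) n)
  have small : ∀ {n : ℤ} {z : ℂ}, n ∉ Finset.Icc (-(N : ℤ)) N → ‖z‖ ≤ (1 + 2 * Real.pi / T) *
      (Real.sqrt (1 + (n : ℝ) ^ 2) * ‖fourierCoef T f n‖) → ‖z‖ ≤ (1 + 2 * Real.pi / T) * ρ *
      ((1 + (n : ℝ) ^ 2) ^ (σ / 2) * ‖fourierCoef T f n‖) := fun {n z} hn h => by
    refine h.trans ?_
    rw [mul_assoc, ← mul_assoc ρ]
    gcongr
    exact sqrt_weight_le_of_notMem (by linarith) hn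
  have nf : l2Norm T f ≤ D := l2Norm_le_of_fourierCoef_le hT cf hc hR (by positivity)
    fun n => big (w₀ n)
  have ng : l2Norm T g ≤ D := l2Norm_le_of_fourierCoef_le hT hg hc hR (by positivity)
    fun n => big (w₁ n)
  have np : l2Norm T p ≤ D := l2Norm_le_of_fourierCoef_le hT cp hc hR (by positivity) fun n => by
    rw [hpdef, fourierPartialSum, fourierCoef_trigSum hT]
    split_ifs
    · exact big (w₀ n)
    · simpa using by positivity
  have np₁ : l2Norm T p₁ ≤ D := l2Norm_le_of_fourierCoef_le hT cp₁ hc hR (by positivity) fun n => by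
    rw [hp₁def, fourierPartialSum, fourierCoef_trigSum hT]
    split_ifs
    · exact big (w₁ n)
    · simpa using by positivity
  have nfp : l2Norm T (fun x => f x - p x) ≤ D * ρ := by
    rw [hD, mul_assoc _ _ ρ]
    refine l2Norm_le_of_fourierCoef_le hT (by fun_prop) hc hR (by positivity) fun n => ?_
    rw [fourierCoef_sub_fourierPartialSum hT cf]
    split_ifs with hn
    · simpa using by positivity
    · exact small hn (w₀ n)
  have ngp : l2Norm T (fun x => g x - p₁ x) ≤ D * ρ := by
    rw [hD, mul_assoc _ _ ρ]
    refine l2Norm_le_of_fourierCoef_le hT (by fun_prop) hc hR (by positivity) fun n => ?_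
    rw [fourierCoef_sub_fourierPartialSum hT hg]
    split_ifs with hn
    · simpa using by positivity
    · exact small hn (w₁ n)
  have nW : l2Norm T W ≤ Real.sqrt T * R * ((2 * (2 * Real.pi / T) ^ 2 + 2 * ω ^ 2) *
      (1 + (N : ℝ) ^ 2) ^ ((2 - σ) / 2)) := by
    refine l2Norm_le_of_fourierCoef_le hT cW hc hR (by positivity) fun n => ?_
    rw [hWdef, fourierCoef_trigSum hT]
    split_ifs with hn
    · rw [norm_mul, norm_neg, Complex.norm_real, Real.norm_of_nonneg (by positivity), mul_assoc,
        ← mul_assoc (_ ^ ((2 - σ) / 2)), ← mul_assoc]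
      refine mul_le_mul_of_nonneg_right ?_ (norm_nonneg _)
      refine le_trans ?_ (mul_le_mul_of_nonneg_left (weight_le_of_mem hσ2 hn) (by positivity))
      have h1 := pow_le_pow_left₀ (abs_nonneg _) (abs_waveNumber_le hT n) 2
      rw [sq_abs, mul_pow, Real.sq_sqrt (by positivity)] at h1
      nlinarith [sq_nonneg (waveNumber T n + ω), mul_nonneg (sq_nonneg ω) (sq_nonneg (n : ℝ))]
    · simpa using by positivity
  have sf := norm_le_of_l2Norm_le hT hf hg hp nf ng
  have sp := norm_le_of_l2Norm_le hT dp cp₁ (trigSum_period hT N _) np np₁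
  have sfp : ∀ x ∈ Icc 0 T, ‖f x - p x‖ ≤ b * ρ := by
    have := norm_le_of_l2Norm_le hT (fun x => (hf x).fun_sub (dp x)) (hg.sub cp₁)
      (by rw [hp, show p T = p 0 from trigSum_period hT N _]) nfp ngp
    simpa only [hb, mul_assoc] using this
  have nG := l2Norm_nonlinearity_sub_le hT cf hg cp cp₁ hb0 hρ0 sf sp sfp ng ngp
  have nq : l2Norm T q ≤ b ^ 2 * D := by
    refine (l2Norm_le_mul hT cq cp (sq_nonneg b) fun x hx => ?_).trans
      (mul_le_mul_of_nonneg_left np (sq_nonneg b))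
    rw [hq, norm_mul, Complex.norm_real, Real.norm_of_nonneg (by positivity)]
    exact mul_le_mul_of_nonneg_right (pow_le_pow_left₀ (norm_nonneg _) (sp x hx) 2) (norm_nonneg _)
  have nq₁ : l2Norm T q₁ ≤ 3 * b ^ 2 * D := by
    refine (l2Norm_le_mul hT cq₁ cp₁ (by positivity) fun x hx => ?_).trans
      (mul_le_mul_of_nonneg_left np₁ (by positivity))
    refine (norm_add_le _ _).trans ?_
    simp only [norm_mul, norm_pow, RCLike.norm_conj, Complex.norm_ofNat]
    have := mul_le_mul_of_nonneg_right
      (pow_le_pow_left₀ (norm_nonneg _) (sp x hx) 2) (norm_nonneg (p₁ x))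
    nlinarith
  have nGf : l2Norm T G ≤ 6 * b ^ 2 * D := by
    refine (l2Norm_le_mul hT cG hg (by positivity) fun x hx => ?_).trans
      (mul_le_mul_of_nonneg_left ng (by positivity))
    simp only [hG, norm_mul, Complex.norm_real, Complex.norm_ofNat, norm_pow, norm_norm]
    refine mul_le_mul_of_nonneg_right ?_ (norm_nonneg _)
    have := pow_le_pow_left₀ (norm_nonneg _) (sf x hx) 2
    linarith
  have nqP : l2Norm T (fun x => q x - fourierPartialSum T N q x) ≤
      T / (2 * Real.pi) / Real.sqrt (1 + (N : ℝ) ^ 2) * (3 * b ^ 2 * D) := by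
    refine (l2Norm_sub_fourierPartialSum_le hT dq cq₁ ?_ N).trans
      (mul_le_mul_of_nonneg_left nq₁ (by positivity))
    simp only [hq, show p T = p 0 from trigSum_period hT N _]
  -- the decomposition of the pairing
  have cWc : Continuous fun x => conj (W x) := Complex.continuous_conj.comp cW
  have cqc : Continuous fun x => conj (q x) := Complex.continuous_conj.comp cq
  have i₁ : ∫ x in (0 : ℝ)..T, conj (W x) * G x = (∫ x in (0 : ℝ)..T, conj (W x) * GN x) +
      ∫ x in (0 : ℝ)..T, conj (W x) * (G x - GN x) := by
    rw [← intervalIntegral.integral_add (Continuous.intervalIntegrable (by fun_prop) _ _)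
      (Continuous.intervalIntegrable (by fun_prop) _ _)]
    exact intervalIntegral.integral_congr fun x _ => by ring
  have i₂ : ∫ x in (0 : ℝ)..T, conj (q x) * (p₃ x + fourierPartialSum T N G x) =
      (∫ x in (0 : ℝ)..T, conj (q x) * (p₃ x + GN x)) +
      (∫ x in (0 : ℝ)..T, conj (q x) * (G x - GN x)) -
      ∫ x in (0 : ℝ)..T, conj (q x) * (G x - fourierPartialSum T N G x) := by
    rw [← intervalIntegral.integral_add (Continuous.intervalIntegrable (by fun_prop) _ _)
      (Continuous.intervalIntegrable (by fun_prop) _ _), ← intervalIntegral.integral_sub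
      (Continuous.intervalIntegrable (by fun_prop) _ _)
      (Continuous.intervalIntegrable (by fun_prop) _ _)]
    exact intervalIntegral.integral_congr fun x _ => by ring
  rw [integral_conj_mul_sub_fourierPartialSum hT cq cG] at i₂
  have b₁ := abs_mul_re_integral_le hT cW (cG.sub cGN) (c := 2) (by norm_num) nW nG
  have b₂ := abs_mul_re_integral_le hT cq (cG.sub cGN) (c := 4) (by norm_num) nq nG
  have b₃ := abs_mul_re_integral_le hT (cq.sub cPq) cG (c := 4) (by norm_num) nqP nGf
  rw [e₃, i₁, i₂, Complex.add_re, Complex.sub_re, Complex.add_re]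
  simp only [Pi.sub_apply] at b₁ b₂ b₃
  refine le_trans ?_ (add_le_add (add_le_add b₁ b₂) b₃)
  refine le_trans (le_of_eq (congrArg abs ?_)) ((abs_sub _ _).trans (add_le_add_left (abs_add_le _ _) _))
  linear_combination hid

end CmKdV

namespace CmKdV

open Set MeasureTheory Filter Topology intervalIntegral
open scoped ComplexConjugate

variable {T : ℝ} {f g : ℝ → ℂ}

/-! ### Conservation of the twisted energies -/

/-- The twisted energy of the trigonometric polynomial with coefficients `c n`, `|n| ≤ N`. -/
noncomputable def truncatedEnergy (T ω : ℝ) (N : ℕ) (c : ℤ → ℂ) : ℝ :=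
  T * ∑ n ∈ Finset.Icc (-(N : ℤ)) N, (waveNumber T n - ω) ^ 2 * ‖c n‖ ^ 2 -
    quartic T (trigSum T N c)

/-- The Fourier mode as an element of the Banach algebra of bounded continuous functions. -/
noncomputable def waveBCF (T : ℝ) (n : ℤ) : BoundedContinuousFunction ℝ ℂ :=
  BoundedContinuousFunction.ofNormedAddCommGroup (wave T n) (continuous_wave n) 1
    fun x => (norm_wave n x).le

/-- Integration over a period, as a continuous linear functional. -/
noncomputable def integralCLM (T : ℝ) : BoundedContinuousFunction ℝ ℂ →L[ℝ] ℂ :=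
  LinearMap.mkContinuous
    { toFun := fun F => ∫ x in (0 : ℝ)..T, F x
      map_add' := fun F G => intervalIntegral.integral_add
        (F.continuous.intervalIntegrable _ _) (G.continuous.intervalIntegrable _ _)
      map_smul' := fun c F => intervalIntegral.integral_smul c F }
    |T - 0| fun F => by
      rw [mul_comm]
      exact intervalIntegral.norm_integral_le_of_norm_le_const fun x _ => F.norm_coe_le_norm x

theorem integralCLM_apply (F : BoundedContinuousFunction ℝ ℂ) :
    integralCLM T F = ∫ x in (0 : ℝ)..T, F x := rfl

theorem sum_smul_waveBCF_apply (N : ℕ) (a : ℤ → ℂ) (x : ℝ) :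
    (∑ n ∈ Finset.Icc (-(N : ℤ)) N, a n • waveBCF T n) x = trigSum T N a x := by
  simp [trigSum, waveBCF]

/-- The quartic term along a curve of trigonometric polynomials, differentiated in the Banach
algebra of bounded continuous functions. -/
theorem hasDerivWithinAt_quartic_trigSum {c : ℝ → ℤ → ℂ} {c' : ℤ → ℂ} {S : Set ℝ} {t : ℝ} (N : ℕ)
    (h : ∀ n, HasDerivWithinAt (fun t => c t n) (c' n) S t) :
    HasDerivWithinAt (fun t => quartic T (trigSum T N (c t)))
      (4 * (∫ x in (0 : ℝ)..T, conj (((‖trigSum T N (c t) x‖ ^ 2 : ℝ) : ℂ) * trigSum T N (c t) x) *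
        trigSum T N c' x).re) S t := by
  set P : ℝ → BoundedContinuousFunction ℝ ℂ := fun t =>
    ∑ n ∈ Finset.Icc (-(N : ℤ)) N, c t n • waveBCF T n with hP
  set P' : BoundedContinuousFunction ℝ ℂ :=
    ∑ n ∈ Finset.Icc (-(N : ℤ)) N, c' n • waveBCF T n with hP'
  have hd : HasDerivWithinAt P P' S t :=
    HasDerivWithinAt.fun_sum fun n _ => (h n).smul_const (waveBCF T n)
  have hd2 := (integralCLM T).hasFDerivAt.comp_hasDerivWithinAt t ((hd.fun_mul hd.star).fun_pow 2)
  have hd3 := Complex.reCLM.hasFDerivAt.comp_hasDerivWithinAt t hd2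
  have hPx : ∀ t x, P t x = trigSum T N (c t) x := fun t x => sum_smul_waveBCF_apply N (c t) x
  have hPx' : ∀ x, P' x = trigSum T N c' x := fun x => sum_smul_waveBCF_apply N c' x
  have hre : ∀ {F : ℝ → ℂ}, Continuous F → (∫ x in (0 : ℝ)..T, F x).re = ∫ x in (0 : ℝ)..T, (F x).re :=
    fun hF => (Complex.reCLM.intervalIntegral_comp_comm (hF.intervalIntegrable 0 T)).symm
  -- `|p|⁴ = (p p̄)²`
  have hfun : (fun t => quartic T (trigSum T N (c t))) =
      Complex.reCLM ∘ (integralCLM T ∘ fun t => (P t * star (P t)) ^ 2) := by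
    funext t
    simp only [Function.comp_apply, integralCLM_apply, Complex.reCLM_apply]
    rw [hre (BoundedContinuousFunction.continuous _), quartic]
    refine intervalIntegral.integral_congr fun x _ => ?_
    simp only [BoundedContinuousFunction.coe_pow, BoundedContinuousFunction.coe_mul,
      BoundedContinuousFunction.coe_star, Pi.pow_apply, Pi.mul_apply, Pi.star_apply, hPx]
    rw [Complex.star_def, Complex.mul_conj, Complex.normSq_eq_norm_sq, ← Complex.ofReal_pow,
      Complex.ofReal_re]
    ring
  rw [hfun]
  refine hd3.congr_deriv ?_
  have c₁ : Continuous (trigSum T N (c t)) := continuous_trigSum N _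
  have c₂ : Continuous (trigSum T N c') := continuous_trigSum N _
  have c₃ : Continuous fun x => conj (((‖trigSum T N (c t) x‖ ^ 2 : ℝ) : ℂ) * trigSum T N (c t) x) *
      trigSum T N c' x :=
    (Complex.continuous_conj.comp (by fun_prop)).mul c₂
  simp only [integralCLM_apply, Complex.reCLM_apply]
  rw [hre (BoundedContinuousFunction.continuous _), hre c₃, ← intervalIntegral.integral_const_mul]
  refine intervalIntegral.integral_congr fun x _ => ?_
  simp only [BoundedContinuousFunction.coe_pow, BoundedContinuousFunction.coe_mul,
    BoundedContinuousFunction.coe_star, BoundedContinuousFunction.coe_add, Pi.add_apply,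
    Pi.pow_apply, Pi.mul_apply, Pi.star_apply, hPx, hPx', Complex.star_def]
  have h2 : trigSum T N (c t) x * conj (trigSum T N (c t) x) =
      ((‖trigSum T N (c t) x‖ ^ 2 : ℝ) : ℂ) := by
    rw [Complex.mul_conj, Complex.normSq_eq_norm_sq]
  generalize ‖trigSum T N (c t) x‖ ^ 2 = m at h2 ⊢
  simp [h2]
  ring

/-- Along the flow of the Fourier coefficients of the equation, the derivative of the truncated
energy is the pairing of the variational derivative with the truncated vector field. -/
theorem hasDerivWithinAt_truncatedEnergy (hT : 0 < T) (ω : ℝ) {c : ℝ → ℤ → ℂ} {G : ℝ → ℂ}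
    (hG : Continuous G) {S : Set ℝ} {t : ℝ} (N : ℕ)
    (h : ∀ n, HasDerivWithinAt (fun t => c t n)
      (-((Complex.I * waveNumber T n) ^ 3 * c t n + fourierCoef T G n)) S t) :
    HasDerivWithinAt (fun t => truncatedEnergy T ω N (c t))
      (2 * (∫ x in (0 : ℝ)..T, conj (trigSum T N
        (fun n => -((waveNumber T n - ω) ^ 2 : ℝ) * c t n) x) * G x).re +
      4 * (∫ x in (0 : ℝ)..T, conj (((‖trigSum T N (c t) x‖ ^ 2 : ℝ) : ℂ) * trigSum T N (c t) x) *
        (trigSum T N (fun n => (Complex.I * waveNumber T n) ^ 3 * c t n) x +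
          fourierPartialSum T N G x)).re) S t := by
  have h1 := (HasDerivWithinAt.fun_sum (u := Finset.Icc (-(N : ℤ)) N) fun n _ =>
    ((h n).norm_sq).const_mul ((waveNumber T n - ω) ^ 2)).const_mul T
  refine (h1.fun_sub (hasDerivWithinAt_quartic_trigSum N h)).congr_deriv ?_
  have h2 : ∀ x, trigSum T N
      (fun n => -((Complex.I * waveNumber T n) ^ 3 * c t n + fourierCoef T G n)) x =
      -(trigSum T N (fun n => (Complex.I * waveNumber T n) ^ 3 * c t n) x +
        fourierPartialSum T N G x) := fun x => by
    simp only [fourierPartialSum, trigSum]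
    rw [← Finset.sum_add_distrib, ← Finset.sum_neg_distrib]
    exact Finset.sum_congr rfl fun n _ => by ring
  simp only [h2, mul_neg, intervalIntegral.integral_neg, Complex.neg_re, sub_neg_eq_add]
  congr 1
  rw [integral_conj_trigSum_mul hT N _ hG, Complex.re_ofReal_mul, Complex.re_sum, mul_left_comm,
    Finset.mul_sum _ _ (2 : ℝ)]
  congr 1
  refine Finset.sum_congr rfl fun n _ => ?_
  rw [Complex.inner]
  simp [pow_succ]
  ring

/-- Convergence of the Fourier series in `L²`. -/
theorem tendsto_l2Norm_sub_fourierPartialSum (hT : 0 < T) (hf : Continuous f) :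
    Tendsto (fun N => l2Norm T (fun x => f x - fourierPartialSum T N f x)) atTop (𝓝 0) := by
  have h := hasSum_sq_fourierCoef hT hf
  have hlim := h.comp (Finset.tendsto_Icc_neg (R := ℤ))
  have h1 : ∀ N : ℕ, sqNorm T (fun x => f x - fourierPartialSum T N f x) =
      T * (T⁻¹ * sqNorm T f - ∑ n ∈ Finset.Icc (-(N : ℤ)) N, ‖fourierCoef T f n‖ ^ 2) := by
    intro N
    have h2 := hasSum_sq_fourierCoef hT (f := fun x => f x - fourierPartialSum T N f x)
      (hf.sub (continuous_fourierPartialSum N f))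
    have h3 : HasSum (fun n => if n ∈ Finset.Icc (-(N : ℤ)) N then ‖fourierCoef T f n‖ ^ 2 else 0)
        (∑ n ∈ Finset.Icc (-(N : ℤ)) N, ‖fourierCoef T f n‖ ^ 2) := by
      rw [show ∑ n ∈ Finset.Icc (-(N : ℤ)) N, ‖fourierCoef T f n‖ ^ 2 =
        ∑ n ∈ Finset.Icc (-(N : ℤ)) N,
          if n ∈ Finset.Icc (-(N : ℤ)) N then ‖fourierCoef T f n‖ ^ 2 else 0 from
        Finset.sum_congr rfl fun n hn => (if_pos hn).symm]
      exact hasSum_sum_of_ne_finset_zero fun n hn => if_neg hn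
    rw [← mul_inv_cancel_left₀ hT.ne' (sqNorm T (fun x => f x - fourierPartialSum T N f x))]
    congr 1
    refine h2.unique ((h.sub h3).congr_fun fun n => ?_)
    rw [fourierCoef_sub_fourierPartialSum hT hf]
    split_ifs <;> simp
  have h5 : Tendsto (fun N => sqNorm T (fun x => f x - fourierPartialSum T N f x)) atTop (𝓝 0) := by
    have := (hlim.const_sub (T⁻¹ * sqNorm T f)).const_mul T
    rw [sub_self, mul_zero] at this
    exact this.congr fun N => (h1 N).symm
  have := (Real.continuous_sqrt.tendsto 0).comp h5
  rwa [Real.sqrt_zero] at this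

theorem tendsto_truncatedEnergy (hT : 0 < T) (ω : ℝ) (hf : ContDiff ℝ 1 f)
    (hp : Function.Periodic f T) :
    Tendsto (fun N => truncatedEnergy T ω N (fourierCoef T f)) atTop (𝓝 (twistedEnergy T ω f)) := by
  have hfc : Continuous f := hf.continuous
  have hdc : Continuous (deriv f) := hf.continuous_deriv le_rfl
  have hd : ∀ x, HasDerivAt f (deriv f x) x := fun x =>
    (hf.differentiable one_ne_zero x).hasDerivAt
  have hp0 : f T = f 0 := by simpa using hp 0
  refine Tendsto.sub ?_ ?_
  · have h := hasSum_sq_fourierCoef hT (f := fun x => deriv f x - Complex.I * ω * f x) (by fun_prop)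
    have hlim := (h.comp (Finset.tendsto_Icc_neg (R := ℤ))).const_mul T
    rw [mul_inv_cancel_left₀ hT.ne'] at hlim
    refine hlim.congr fun N => ?_
    rw [Function.comp_apply]
    congr 1
    refine Finset.sum_congr rfl fun n _ => ?_
    beta_reduce
    rw [fourierCoef_sub hdc (by fun_prop), fourierCoef_const_mul, fourierCoef_deriv hT hd hdc hp0,
      ← sub_mul, ← mul_sub, norm_mul, norm_mul, Complex.norm_I, one_mul, ← Complex.ofReal_sub,
      Complex.norm_real, Real.norm_eq_abs, mul_pow, sq_abs]
  · refine tendsto_integral_norm_pow hT (fun N => (continuous_trigSum N _).continuousOn)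
      hfc.continuousOn ?_ 4
    have h0 := tendsto_l2Norm_sub_fourierPartialSum hT hfc
    have h1 := tendsto_l2Norm_sub_fourierPartialSum hT hdc
    have h2 := (h0.add h1).const_mul (Real.sqrt (2 / T + 2 * T))
    rw [add_zero, mul_zero] at h2
    rw [Metric.tendstoUniformlyOn_iff]
    intro ε hε
    filter_upwards [h2.eventually (gt_mem_nhds hε)] with N hN x hx
    rw [dist_eq_norm]
    refine lt_of_le_of_lt (norm_le_of_l2Norm_le hT
      (fun x => (hd x).fun_sub (fourierPartialSum_deriv hT hd hdc hp0 N x))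
      (hdc.sub (continuous_fourierPartialSum N _)) ?_
      (le_add_of_nonneg_right (l2Norm_nonneg _)) (le_add_of_nonneg_left (l2Norm_nonneg _)) x hx) hN
    rw [hp0, show fourierPartialSum T N f T = fourierPartialSum T N f 0 from trigSum_period hT N _]

/-- The equation, mode by mode: the evaluation of a coordinate is continuous on `ℓ²`. -/
theorem IsSolution.hasDerivWithinAt_fourierCoef {s : ℝ} {τ : EReal} {u : ℝ → ℝ → ℂ}
    (hu : IsSolution T s τ u) {t : ℝ} (ht : t ∈ timeInterval τ) (n : ℤ) :
    HasDerivWithinAt (fun t => fourierCoef T (u t) n)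
      (-((Complex.I * waveNumber T n) ^ 3 * fourierCoef T (u t) n +
        fourierCoef T (fun x => 6 * ((‖u t x‖ ^ 2 : ℝ) : ℂ) * deriv (u t) x) n))
      (timeInterval τ) t := by
  obtain ⟨V, V', -, hV⟩ := hu.equation
  set w : ℂ := (((1 + (n : ℝ) ^ 2) ^ ((s - 3) / 2) : ℝ) : ℂ) with hw
  have hw0 : w ≠ 0 := by
    rw [hw, Complex.ofReal_ne_zero]
    positivity
  have h1 : HasDerivWithinAt (fun t => V t n) (V' t n) (timeInterval τ) t :=
    ((lp.evalCLM ℝ (fun _ : ℤ => ℂ) 2 n).hasFDerivAt).comp_hasDerivWithinAt t (hV t ht).1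
  have h2 := h1.const_mul w⁻¹
  have e : ∀ t ∈ timeInterval τ, fourierCoef T (u t) n = w⁻¹ * V t n := fun t ht => by
    rw [(hV t ht).2.1 n, ← hw, inv_mul_cancel_left₀ hw0]
  refine (h2.congr e (e t ht)).congr_deriv ?_
  rw [(hV t ht).2.2 n, ← hw, inv_mul_cancel_left₀ hw0, rhsCoef, waveNumber]
  push_cast
  ring

theorem Icc_subset_timeInterval {τ : EReal} {t : ℝ} (ht : t ∈ timeInterval τ) :
    Icc 0 t ⊆ timeInterval τ := fun _ hr =>
  ⟨hr.1, lt_of_le_of_lt (EReal.coe_le_coe_iff.2 hr.2) ht.2⟩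

/-- The twisted energies, and hence mass, momentum and energy, are conserved. On `[0,t]` the
solution is bounded in the Sobolev space of order `min s 2`, so that the truncated energies vary
by at most `t` times the truncation error, which tends to zero. -/
theorem IsSolution.twistedEnergy_eq {s : ℝ} {τ : EReal} {u : ℝ → ℝ → ℂ} (hT : 0 < T)
    (hs : 3 / 2 < s) (hu : IsSolution T s τ u) (ω : ℝ) {t : ℝ} (ht : t ∈ timeInterval τ) :
    twistedEnergy T ω (u t) = twistedEnergy T ω (u 0) := by
  have hsub := Icc_subset_timeInterval ht
  have h0 : (0 : ℝ) ∈ Icc 0 t := ⟨le_rfl, ht.1⟩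
  have h1 : t ∈ Icc 0 t := ⟨ht.1, le_rfl⟩
  obtain ⟨U, hUc, hU⟩ := hu.continuous_curve
  obtain ⟨R, hR⟩ := isCompact_Icc.exists_bound_of_continuousOn (hUc.mono hsub)
  have hR0 : 0 ≤ R := (norm_nonneg _).trans (hR 0 h0)
  have hG : ∀ r ∈ Icc 0 t, Continuous fun x => 6 * ((‖u r x‖ ^ 2 : ℝ) : ℂ) * deriv (u r) x := by
    intro r hr
    have h2 := (hu.contDiff r (hsub hr)).continuous
    have h3 := (hu.contDiff r (hsub hr)).continuous_deriv le_rfl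
    fun_prop
  have key : ∀ N, |truncatedEnergy T ω N (fourierCoef T (u t)) -
      truncatedEnergy T ω N (fourierCoef T (u 0))| ≤ truncationError T ω (min s 2) R N * |t - 0| := by
    intro N
    refine Convex.norm_image_sub_le_of_norm_hasDerivWithin_le
      (f := fun t => truncatedEnergy T ω N (fourierCoef T (u t)))
      (fun r hr => (hasDerivWithinAt_truncatedEnergy hT ω (hG r hr) N
        fun n => hu.hasDerivWithinAt_fourierCoef (hsub hr) n).mono hsub)
      (fun r hr => ?_) (convex_Icc 0 t) h0 h1
    exact abs_energy_rate_le hT ω (lt_min hs (by norm_num)) (min_le_right _ _) hR0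
      (fun x => ((hu.contDiff r (hsub hr)).differentiable one_ne_zero x).hasDerivAt)
      ((hu.contDiff r (hsub hr)).continuous_deriv le_rfl)
      (by simpa using hu.periodic r (hsub hr) 0)
      ((hU r (hsub hr)).sobolevBound (hR r hr) (min_le_left _ _)) N
  have hl := ((tendsto_truncatedEnergy hT ω (hu.contDiff t ht) (hu.periodic t ht)).sub
    (tendsto_truncatedEnergy hT ω (hu.contDiff 0 (hsub h0)) (hu.periodic 0 (hsub h0)))).abs
  have hr := (tendsto_truncationError T ω R (lt_min hs (by norm_num : (3 : ℝ) / 2 < 2))).mul_const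
    |t - 0|
  rw [zero_mul] at hr
  exact sub_eq_zero.1 (abs_nonpos_iff.1 (le_of_tendsto_of_tendsto' hl hr key))

end CmKdV

theorem theorem4p1 (a T ω : ℝ) (ha : a < 0) (hT : 2 * Real.pi / Real.sqrt (-2 * a) < T)
    (hω : ω ≠ 0) (hωT : ∃ m : ℤ, ω * T / (2 * Real.pi) = (m : ℝ)) :
    (∃ r₀ k : ℝ, CmKdV.IsDnoidalParam a T r₀ k) ∧
    ∀ r₀ k : ℝ, CmKdV.IsDnoidalParam a T r₀ k →
      ∀ σ : ℝ, (σ = 1 ∨ σ = -1) → ∀ y₀ : ℝ, ∀ φ : ℝ → ℝ → ℂ,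
        φ = CmKdV.travellingWave a ω (fun y => σ * r₀ * CmKdV.jacobiDn k (r₀ * (y - y₀))) →
        ∀ ε : ℝ, 0 < ε → ∃ δ : ℝ, 0 < δ ∧
          ∀ (s : ℝ) (τ : EReal) (u : ℝ → ℝ → ℂ), 3 / 2 < s → 0 < τ →
            CmKdV.IsSolution T s τ u →
            CmKdV.orbitDist T ω (u 0) (φ 0) < δ →
            ∀ t ∈ CmKdV.timeInterval τ, CmKdV.orbitDist T ω (u t) (φ t) < ε := by
  refine ⟨CmKdV.exists_isDnoidalParam ha hT, fun r₀ k hP σ hσ y₀ φ hφ ε hε => ?_⟩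
  have hT0 : 0 < T := (by positivity : (0 : ℝ) ≤ 2 * Real.pi / Real.sqrt (-2 * a)).trans_lt hT
  obtain ⟨δ, hδ, h⟩ := CmKdV.exists_orbitDist_lt hω hωT hP hσ y₀ hε
  refine ⟨δ, hδ, fun s τ u hs hτ hu hd t ht => ?_⟩
  have h0 : (0 : ℝ) ∈ CmKdV.timeInterval τ := ⟨le_rfl, hτ⟩
  have hE : ∀ ν : ℝ, CmKdV.twistedEnergy T ν (u t) = CmKdV.twistedEnergy T ν (u 0) := fun ν =>
    hu.twistedEnergy_eq hT0 hs ν ht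
  have hM : CmKdV.sqNorm T (u t) = CmKdV.sqNorm T (u 0) := by
    have h1 := CmKdV.two_mul_sqNorm_eq (T := T) (hu.contDiff t ht)
    have h2 := CmKdV.two_mul_sqNorm_eq (T := T) (hu.contDiff 0 h0)
    rw [hE, hE, hE] at h1
    linarith
  subst hφ
  exact h (u 0) (u t) (hu.contDiff 0 h0) (hu.contDiff t ht) (hu.periodic 0 h0) (hu.periodic t ht)
    hM (hE ω) 0 t hd
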